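/- Let $d\in\{2,3\}$, let $\Omega\subset\mathbb R^d$ be a bounded open polyhedral set, and let $\mathcal T$ be a mesh of $\Omega$ consisting of finitely many pairwise disjoint open polytopic elements $\kappa$ with $\bar\Omega=\bigcup_\kappa\bar\kappa$. Hanging nodes and edges are permitted. The boundaries of the elements are divided into finitely many disjoint open $(d-1)$-simplices $F$ (the faces). An interior face lies in $\Omega$ and in the boundaries of exactly two elements; a boundary face lies in $\partial\Omega$ and in the boundary of exactly one element. Let $\Gamma$ be the union of the faces, $h_\kappa=\operatorname{diam}\kappa$, and let $\rho_\kappa$ be the diameter of the largest ball contained in $\kappa$. To each $\kappa$ let a degree $p_\kappa\ge 2$ be given. Let $S^{\mathbf p}_{\mathcal T}$ be the space of functions in $L_2(\Omega)$ that are polynomials of total degree at most $p_\kappa$ on each $\kappa$, let $\mathcal S=H^2(\Omega)+S^{\mathbf p}_{\mathcal T}$, and let $\Pi$ be the $L_2(\Omega)$-projection onto $S^{\mathbf p-2}_{\mathcal T}$. On an interior face shared by $\kappa_i,\kappa_j$ with unit normals $n_i,n_j$ pointing out of $\kappa_i,\kappa_j$, set $\{v\}=\frac12(v_i+v_j)$,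 $[v]=v_in_i+v_jn_j$ for scalar $v$ and $\{q\}=\frac12(q_i+q_j)$, $[q]=q_i\cdot n_i+q_j\cdot n_j$ for vector-valued $q$, where the index denotes the trace from the respective element; on a boundary face of $\kappa_i$ set $\{v\}=v_i$, $[v]=v_in_i$, $\{q\}=q_i$, $[q]=q_i\cdot n_i$. Derivatives being taken elementwise, put for $u,v\in\mathcal S$ $$\begin{aligned}\tilde B(u,v)={}&\sum_{\kappa}\int_\kappa \Delta u\,\Delta v\,dx+\int_\Gamma\big(\{\nabla\Pi(\Delta u)\}\cdot[v]+\{\nabla\Pi(\Delta v)\}\cdot[u]\big)ds\\&-\int_\Gamma\big(\{\Pi(\Delta u)\}[\nabla v]+\{\Pi(\Delta v)\}[\nabla u]\big)ds+\int_\Gamma\big(\sigma[u]\cdot[v]+\tau[\nabla u][\nabla v]\big)ds,\end{aligned}$$ $$\|v\|_{DG}^2=\sum_\kappa\|\Delta v\|_{L_2(\kappa)}^2+\int_\Gamma\big(\sigma|[v]|^2+\tau|[\nabla v]|^2\big)ds.$$ An element $\kappa$ is called $p$-coverable, with constants $C_{as},c_{as},C_{sh}>0$, if it is contained in the union of finitely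 many closed simplices $K$ such that, for each of them, $\operatorname{diam}K\le C_{sh}\,\rho_K$ ($\rho_K$ being the diameter of the largest ball contained in $K$), $|K|\ge c_{as}|\kappa|$, and every point of $K\setminus\kappa$ has distance less than $C_{as}\operatorname{diam}(K)/p^2$ from $\partial K$. For a face $F\subset\partial\kappa$ let $\kappa_\flat^F$ range over the $d$-simplices contained in $\kappa$ that have $F$ as a face, and let $$C_{\rm INV}(p,\kappa,F)=C_{{\rm inv},1}\min\Big\{\frac{|\kappa|}{\sup|\kappa_\flat^F|},\,p^{2(d-1)}\Big\}\ \text{ if }\kappa\text{ is }p\text{-coverable},\qquad C_{\rm INV}(p,\kappa,F)=C_{{\rm inv},1}\frac{|\kappa|}{\sup|\kappa_\flat^F|}\ \text{ otherwise.}$$ Here $C_{{\rm inv},1},C_{{\rm inv},2}$ are positive constants (for instance those of the $hp$-version trace inverse inequality and of the $H^1$–$L_2$ inverse inequality on such elements). The penalties are constant on each face $F$, with values $$\sigma|_F=C_\sigma\max_{\kappa:\,F\subset\partial\kappa}\Big\{C_{\rm INV}(p_\kappa,\kappa,F)\frac{p_\kappa^2|F|}{|\kappa|}\;C_{{\rm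 inv},2}\frac{p_\kappa^4}{h_\kappa^2}\Big\},\qquad \tau|_F=C_\tau\max_{\kappa:\,F\subset\partial\kappa}\Big\{C_{\rm INV}(p_\kappa,\kappa,F)\frac{p_\kappa^2|F|}{|\kappa|}\Big\},$$ the maximum being over the two elements sharing an interior face, or the single element of a boundary face. **Claim.** Given $d$ and constants $C_F,C_r,C_{as},c_{as},C_{sh},C_{{\rm inv},1},C_{{\rm inv},2}$, there are positive thresholds for $C_\sigma$ and $C_\tau$ and constants $C_{\rm coer},C_{\rm cont}>0$, depending on these data only (in particular not on $\Omega$, the mesh, the element sizes $h_\kappa$, the degrees $p_\kappa$ or the measures of the faces), such that the following holds whenever $C_\sigma$ and $C_\tau$ are at least their thresholds. If every element has at most $C_F$ faces, $h_\kappa/\rho_\kappa\le C_r$ for all $\kappa\in\mathcal T$, and every $\kappa\in\mathcal T$ is $p_\kappa$-coverable with constants $C_{as},c_{as},C_{sh}$, then $$\tilde B(v,v)\ge C_{\rm coer}\|v\|_{DG}^2\quad\text{for all }v\in\mathcal S,\qquad \tilde B(w,v)\le C_{\rm cont}\|w\|_{DG}\|v\|_{DG}\quad\text{for all }w,v\in\mathcal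 S.$$ -/

import Mathlib

open MeasureTheory Set Filter Topology
open scoped ENNReal ContDiff

noncomputable section

namespace DGBiharmonic

/-- The physical space `ℝᵈ` with its Euclidean norm. -/
abbrev Pt (d : ℕ) : Type := EuclideanSpace ℝ (Fin d)

/-! ### Sobolev spaces through weak derivatives -/

/-- `g` is the weak `j`-th partial derivative of `u` on the open set `U`. -/
def HasWeakPartial {d : ℕ} (U : Set (Pt d)) (j : Fin d) (u g : Pt d → ℝ) : Prop :=
  ∀ φ : Pt d → ℝ, ContDiff ℝ ∞ φ → HasCompactSupport φ → tsupport φ ⊆ U →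
    ∫ x in U, u x * fderiv ℝ φ x (EuclideanSpace.single j 1) = - ∫ x in U, g x * φ x

/-- The space `L₂(U)`. -/
def MemL2 {d : ℕ} (U : Set (Pt d)) (u : Pt d → ℝ) : Prop :=
  MemLp u 2 (volume.restrict U)

/-- The Sobolev space `H¹(U)`. -/
def MemH1 {d : ℕ} (U : Set (Pt d)) (u : Pt d → ℝ) : Prop :=
  MemL2 U u ∧ ∀ j, ∃ g, MemL2 U g ∧ HasWeakPartial U j u g

/-- The Sobolev space `H²(U)`. -/
def MemH2 {d : ℕ} (U : Set (Pt d)) (u : Pt d → ℝ) : Prop :=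
  MemL2 U u ∧ ∀ j, ∃ g, MemH1 U g ∧ HasWeakPartial U j u g

open Classical in
/-- The square-integrable weak `j`-th partial derivative of `u` on `U` (unique almost everywhere
on `U` when it exists; `0` when it does not exist). -/
def weakPartial {d : ℕ} (U : Set (Pt d)) (j : Fin d) (u : Pt d → ℝ) : Pt d → ℝ :=
  if h : ∃ g, MemL2 U g ∧ HasWeakPartial U j u g then h.choose else 0

/-- The weak Laplacian on `U`. -/
def weakLaplacian {d : ℕ} (U : Set (Pt d)) (u : Pt d → ℝ) : Pt d → ℝ :=
  fun x => ∑ j, weakPartial U j (weakPartial U j u) x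

/-! ### Polytopes, faces, and their measures -/

/-- Open polygons (`d = 2`) and polyhedra (`d = 3`): nonempty open sets that are the interior of
their closure, the closure being a finite union of nondegenerate closed `d`-simplices. -/
def IsOpenPolytope {d : ℕ} (s : Set (Pt d)) : Prop :=
  IsOpen s ∧ s.Nonempty ∧ interior (closure s) = s ∧
    ∃ (m : ℕ) (T : Fin m → Affine.Simplex ℝ (Pt d) d), closure s = ⋃ j, (T j).closedInterior

/-- Nondegenerate `(d-1)`-simplices in `ℝᵈ`. The open face is `F.interior`, the relative interior
of the simplex. -/
abbrev Face (d : ℕ) : Type := Affine.Simplex ℝ (Pt d) (d - 1)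

/-- Surface measure on the face `F`: the `(d-1)`-dimensional Hausdorff measure, normalised to agree
with Lebesgue measure on hyperplanes. -/
def faceMeasure {d : ℕ} (F : Face d) : Measure (Pt d) :=
  (Measure.euclideanHausdorffMeasure (d - 1)).restrict F.interior

/-- The `(d-1)`-dimensional measure `|F|` of a face. -/
def faceArea {d : ℕ} (F : Face d) : ℝ := (faceMeasure F).real univ

/-- `n` is the unit normal vector on the face `F` of `κ` that points out of `κ`. -/
def IsOutwardNormal {d : ℕ} (κ : Set (Pt d)) (F : Face d) (n : Pt d) : Prop :=
  ‖n‖ = 1 ∧ (∀ i j, inner ℝ n (F.points i - F.points j) = 0) ∧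
    ∀ x ∈ F.interior, ∀ᶠ t : ℝ in 𝓝[>] 0, x - t • n ∈ κ ∧ x + t • n ∉ κ

/-- The diameter of the largest ball contained in `s`. -/
def inballDiam {d : ℕ} (s : Set (Pt d)) : ℝ :=
  sSup {t : ℝ | 0 < t ∧ ∃ x, Metric.ball x (t / 2) ⊆ s}

open Classical in
/-- The indices of the elements having `F` as a face, i.e. whose boundary contains `F`. -/
def adjElems {d n : ℕ} (elem : Fin n → Set (Pt d)) (F : Face d) : Finset (Fin n) :=
  Finset.univ.filter fun i => F.interior ⊆ frontier (elem i)

/-- A polytopic mesh of `Ω`. Hanging nodes and edges are permitted: a face is a simplicial piece of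
an interface between two elements, or of the boundary of `Ω`. -/
structure PolytopicMesh (d : ℕ) (Ω : Set (Pt d)) where
  /-- the number of elements -/
  numElem : ℕ
  /-- the open elements -/
  elem : Fin numElem → Set (Pt d)
  isOpenPolytope_elem : ∀ i, IsOpenPolytope (elem i)
  disjoint_elem : Pairwise fun i j => Disjoint (elem i) (elem j)
  closure_eq : closure Ω = ⋃ i, closure (elem i)
  /-- the number of faces -/
  numFace : ℕ
  /-- the faces -/
  face : Fin numFace → Face d
  disjoint_face : Pairwise fun k l => Disjoint (face k).interior (face l).interior
  /-- the faces make up the boundaries of the elements -/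
  skeleton_eq : ⋃ k, (face k).closedInterior = ⋃ i, frontier (elem i)
  /-- a face is either an interior face, shared by exactly two elements, or a boundary face,
  belonging to exactly one element -/
  interior_or_boundary : ∀ k,
    ((face k).interior ⊆ Ω ∧ (adjElems elem (face k)).card = 2) ∨
      ((face k).interior ⊆ frontier Ω ∧ (adjElems elem (face k)).card = 1)
  /-- `normal k i` is the unit normal on the face `k` that points out of the element `i`
  (only relevant if the element `i` has the face `k`) -/
  normal : Fin numFace → Fin numElem → Pt d
  isOutwardNormal : ∀ k, ∀ i ∈ adjElems elem (face k),
    IsOutwardNormal (elem i) (face k) (normal k i)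

/-! ### Traces on faces -/

/-- `t ∈ L₂(F)` is the trace on the face `F`, with outward normal `n`, of the function `g` on `κ`:
Green's formula holds for all test functions that meet the boundary of `κ` only inside `F`. -/
def IsFaceTrace {d : ℕ} (κ : Set (Pt d)) (F : Face d) (n : Pt d) (g t : Pt d → ℝ) : Prop :=
  MemLp t 2 (faceMeasure F) ∧
    ∀ φ : Pt d → ℝ, ContDiff ℝ ∞ φ → HasCompactSupport φ → tsupport φ ∩ frontier κ ⊆ F.interior →
      ∀ j, (∫ x in κ, g x * fderiv ℝ φ x (EuclideanSpace.single j 1)) +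
          (∫ x in κ, weakPartial κ j g x * φ x) =
        ∫ x, t x * φ x * n j ∂(faceMeasure F)

open Classical in
/-- The trace on `F` of the function `g` on `κ` (unique almost everywhere on `F` when it exists;
`0` when it does not exist). -/
def faceTrace {d : ℕ} (κ : Set (Pt d)) (F : Face d) (n : Pt d) (g : Pt d → ℝ) : Pt d → ℝ :=
  if h : ∃ t, IsFaceTrace κ F n g t then h.choose else 0

/-! ### Polynomials -/

/-- The value of a polynomial in `d` variables at a point of `ℝᵈ`. -/
def polyVal {d : ℕ} (q : MvPolynomial (Fin d) ℝ) (x : Pt d) : ℝ :=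
  MvPolynomial.eval (fun j => x j) q

/-- The gradient of a polynomial at a point of `ℝᵈ`. -/
def polyGrad {d : ℕ} (q : MvPolynomial (Fin d) ℝ) (x : Pt d) : Pt d :=
  WithLp.toLp 2 fun j => polyVal (MvPolynomial.pderiv j q) x

/-! ### Constants of the inverse inequalities -/

/-- The largest volume of a `d`-simplex that is contained in `κ` and has `F` as a face; the other
vertex of the simplex is `a`. -/
def supFlatVolume {d : ℕ} (κ : Set (Pt d)) (F : Face d) : ℝ≥0∞ :=
  ⨆ (a : Pt d) (_ : a ∉ affineSpan ℝ (Set.range F.points))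
    (_ : interior (convexHull ℝ (insert a F.closedInterior)) ⊆ κ),
      volume (convexHull ℝ (insert a F.closedInterior))

/-- `κ` is `p`-coverable, with distance constant `Cas`, volume constant `cas` and
shape-regularity constant `Csh` of the covering simplices: `κ` is covered by finitely many
overlapping shape-regular simplices `K`, each of measure at least `cas |κ|`, such that the part of
`K` outside `κ` is within distance `Cas diam(K) / p²` of the boundary of `K`. -/
def IsPCoverable {d : ℕ} (Cas cas Csh : ℝ) (κ : Set (Pt d)) (p : ℕ) : Prop :=
  ∃ (m : ℕ) (K : Fin m → Affine.Simplex ℝ (Pt d) d),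
    κ ⊆ (⋃ i, (K i).closedInterior) ∧
    ∀ i, Metric.diam (K i).closedInterior ≤ Csh * inballDiam (K i).closedInterior ∧
      (∀ x ∈ (K i).closedInterior, x ∉ κ →
        Metric.infDist x (frontier (K i).closedInterior) <
          Cas * Metric.diam (K i).closedInterior / (p : ℝ) ^ 2) ∧
      cas * volume.real κ ≤ volume.real (K i).closedInterior

open Classical in
/-- The constant `C_INV(p, κ, F)` of the trace inverse inequality. The quotient is taken in
`[0, ∞]`. -/
def CINV {d : ℕ} (Cas cas Csh Cinv1 : ℝ) (p : ℕ) (κ : Set (Pt d)) (F : Face d) : ℝ :=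
  Cinv1 *
    (if IsPCoverable Cas cas Csh κ p then
      min (volume κ / supFlatVolume κ F) ((p : ℝ≥0∞) ^ (2 * (d - 1)))
    else volume κ / supFlatVolume κ F).toReal

namespace PolytopicMesh

variable {d : ℕ} {Ω : Set (Pt d)}

/-- The elements having the face `k`: two for an interior face, one for a boundary face. -/
def adj (T : PolytopicMesh d Ω) (k : Fin T.numFace) : Finset (Fin T.numElem) :=
  adjElems T.elem (T.face k)

theorem adj_nonempty (T : PolytopicMesh d Ω) (k : Fin T.numFace) : (T.adj k).Nonempty := by
  rw [← Finset.card_pos]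
  have := T.interior_or_boundary k
  unfold adj
  omega

open Classical in
/-- The number `C_κ` of faces of the element `i`. -/
def faceCount (T : PolytopicMesh d Ω) (i : Fin T.numElem) : ℕ :=
  (Finset.univ.filter fun k => (T.face k).interior ⊆ frontier (T.elem i)).card

/-- The finite element space `S^p_T`. -/
def MemFESpace (T : PolytopicMesh d Ω) (p : Fin T.numElem → ℕ) (w : Pt d → ℝ) : Prop :=
  MemL2 Ω w ∧ ∀ i, ∃ q : MvPolynomial (Fin d) ℝ, q.totalDegree ≤ p i ∧
    ∀ᵐ x ∂(volume.restrict (T.elem i)), w x = polyVal q x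

/-- The space `𝒮 = H²(Ω) + S^p_T`. -/
def MemSumSpace (T : PolytopicMesh d Ω) (p : Fin T.numElem → ℕ) (v : Pt d → ℝ) : Prop :=
  ∃ u w : Pt d → ℝ, MemH2 Ω u ∧ T.MemFESpace p w ∧ ∀ᵐ x ∂(volume.restrict Ω), v x = u x + w x

/-- The broken Laplacian of `v` on the element `i`. -/
def laplacian (T : PolytopicMesh d Ω) (v : Pt d → ℝ) (i : Fin T.numElem) : Pt d → ℝ :=
  weakLaplacian (T.elem i) v

/-- The trace of `v` on the face `k` taken from within the element `i`. -/
def trace (T : PolytopicMesh d Ω) (v : Pt d → ℝ) (k : Fin T.numFace) (i : Fin T.numElem) :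
    Pt d → ℝ :=
  faceTrace (T.elem i) (T.face k) (T.normal k i) v

/-- The trace of `∇v` on the face `k` taken from within the element `i`. -/
def gradTrace (T : PolytopicMesh d Ω) (v : Pt d → ℝ) (k : Fin T.numFace) (i : Fin T.numElem)
    (x : Pt d) : Pt d :=
  WithLp.toLp 2 fun j => T.trace (weakPartial (T.elem i) j v) k i x

/-- The jump `⟦v⟧` on the face `k`. -/
def jump (T : PolytopicMesh d Ω) (v : Pt d → ℝ) (k : Fin T.numFace) (x : Pt d) : Pt d :=
  ∑ i ∈ T.adj k, T.trace v k i x • T.normal k i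

/-- The jump `⟦∇v⟧` on the face `k`. -/
def gradJump (T : PolytopicMesh d Ω) (v : Pt d → ℝ) (k : Fin T.numFace) (x : Pt d) : ℝ :=
  ∑ i ∈ T.adj k, inner ℝ (T.gradTrace v k i x) (T.normal k i)

/-- The piecewise polynomial `Q` is the `L₂(Ω)`-projection onto `S^{p-2}_T` of the function given
by `f i` on the element `i`. -/
def IsL2Projection (T : PolytopicMesh d Ω) (p : Fin T.numElem → ℕ)
    (f : Fin T.numElem → Pt d → ℝ) (Q : Fin T.numElem → MvPolynomial (Fin d) ℝ) : Prop :=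
  (∀ i, (Q i).totalDegree ≤ p i - 2) ∧
    ∀ W : Fin T.numElem → MvPolynomial (Fin d) ℝ, (∀ i, (W i).totalDegree ≤ p i - 2) →
      ∑ i, ∫ x in T.elem i, (f i x - polyVal (Q i) x) * polyVal (W i) x = 0

open Classical in
/-- The projection `Π(Δv)` of the broken Laplacian of `v` onto `S^{p-2}_T`, as a polynomial on each
element. -/
def projLaplacian (T : PolytopicMesh d Ω) (p : Fin T.numElem → ℕ) (v : Pt d → ℝ) :
    Fin T.numElem → MvPolynomial (Fin d) ℝ :=
  if h : ∃ Q, T.IsL2Projection p (T.laplacian v) Q then h.choose else 0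

/-- The average of a piecewise polynomial on the face `k`. -/
def polyMean (T : PolytopicMesh d Ω) (Q : Fin T.numElem → MvPolynomial (Fin d) ℝ)
    (k : Fin T.numFace) (x : Pt d) : ℝ :=
  ((T.adj k).card : ℝ)⁻¹ * ∑ i ∈ T.adj k, polyVal (Q i) x

/-- The average of the gradient of a piecewise polynomial on the face `k`. -/
def polyGradMean (T : PolytopicMesh d Ω) (Q : Fin T.numElem → MvPolynomial (Fin d) ℝ)
    (k : Fin T.numFace) (x : Pt d) : Pt d :=
  ((T.adj k).card : ℝ)⁻¹ • ∑ i ∈ T.adj k, polyGrad (Q i) x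

/-- The factor `C_INV(p_κ, κ, F) p_κ² |F| / |κ|` for the element `i` and the face `k`. -/
def traceFactor (T : PolytopicMesh d Ω) (p : Fin T.numElem → ℕ) (Cas cas Csh Cinv1 : ℝ)
    (k : Fin T.numFace) (i : Fin T.numElem) : ℝ :=
  CINV Cas cas Csh Cinv1 (p i) (T.elem i) (T.face k) *
    ((p i : ℝ) ^ 2 * faceArea (T.face k) / volume.real (T.elem i))

/-- The factor `C_{inv,2} p_κ⁴ / h_κ²` for the element `i`. -/
def gradFactor (T : PolytopicMesh d Ω) (p : Fin T.numElem → ℕ) (Cinv2 : ℝ)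
    (i : Fin T.numElem) : ℝ :=
  Cinv2 * ((p i : ℝ) ^ 4 / Metric.diam (T.elem i) ^ 2)

/-- The constant value of the penalty `σ` on the face `k`. -/
def sigma (T : PolytopicMesh d Ω) (p : Fin T.numElem → ℕ) (Cas cas Csh Cinv1 Cinv2 Cσ : ℝ)
    (k : Fin T.numFace) : ℝ :=
  Cσ * (T.adj k).sup' (T.adj_nonempty k)
    fun i => T.traceFactor p Cas cas Csh Cinv1 k i * T.gradFactor p Cinv2 i

/-- The constant value of the penalty `τ` on the face `k`. -/
def tau (T : PolytopicMesh d Ω) (p : Fin T.numElem → ℕ) (Cas cas Csh Cinv1 Cτ : ℝ)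
    (k : Fin T.numFace) : ℝ :=
  Cτ * (T.adj k).sup' (T.adj_nonempty k) fun i => T.traceFactor p Cas cas Csh Cinv1 k i

/-- The inconsistent bilinear form `B̃(u, v)`, for facewise constant penalties `σ` and `τ`. -/
def Btilde (T : PolytopicMesh d Ω) (p : Fin T.numElem → ℕ) (σ τ : Fin T.numFace → ℝ)
    (u v : Pt d → ℝ) : ℝ :=
  (∑ i, ∫ x in T.elem i, T.laplacian u i x * T.laplacian v i x)
  + (∑ k, ∫ x, (inner ℝ (T.polyGradMean (T.projLaplacian p u) k x) (T.jump v k x)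
      + inner ℝ (T.polyGradMean (T.projLaplacian p v) k x) (T.jump u k x)) ∂(faceMeasure (T.face k)))
  - (∑ k, ∫ x, (T.polyMean (T.projLaplacian p u) k x * T.gradJump v k x
      + T.polyMean (T.projLaplacian p v) k x * T.gradJump u k x) ∂(faceMeasure (T.face k)))
  + (∑ k, ∫ x, (σ k * inner ℝ (T.jump u k x) (T.jump v k x)
      + τ k * (T.gradJump u k x * T.gradJump v k x)) ∂(faceMeasure (T.face k)))

/-- The DG norm. -/
def dgNorm (T : PolytopicMesh d Ω) (σ τ : Fin T.numFace → ℝ) (v : Pt d → ℝ) : ℝ :=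
  Real.sqrt ((∑ i, ∫ x in T.elem i, T.laplacian v i x ^ 2)
    + ∑ k, ∫ x, (σ k * ‖T.jump v k x‖ ^ 2 + τ k * T.gradJump v k x ^ 2) ∂(faceMeasure (T.face k)))

end PolytopicMesh

end DGBiharmonic

end

/-! Let X, Y, Z be the three parts of the DG norm of v: the broken Laplacian, the σ-weighted jumps
of v and the τ-weighted jumps of ∇v. Then B̃(v,v) equals X² + Y² + Z² plus cross terms that pair the
face averages of ∇Π(Δv) and Π(Δv) with the jumps. Suppose that for every polynomial q of degree at
most p_κ and every face F of κ ∫_F q² ≤ A τ ∫_κ q² and ∫_F |∇q|² ≤ A σ ∫_κ q². Since Π does not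
increase the L₂ norm on an element and each element is met at most C_F times in the sum over faces,
Cauchy–Schwarz bounds the cross terms by multiples of √(A C_F) X Y and √(A C_F) X Z. Large C_σ and
C_τ make A C_F ≤ 1/16, and the cross terms are absorbed (`coercive_and_continuous`). Boundedness
uses the same estimates.

What remains is a pair of inverse inequalities (`exists_face_inequalities`) that are proved here,
not assumed; `Cinv1` and `Cinv2` may be any positive numbers because the thresholds compensate for
them. In the minimum defining C_INV, the simplex alternative comes from the trace inequality on a
cone over F (`volume_cone_mul_integral_face_le`), a one-dimensional end point inequality integrated
over rays from the apex. The alternative p^{2(d-1)} comes from maximum norm bounds on κ. The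
gradient also needs its L₂ inverse inequality with the factor p⁴/h².

The bounds on κ (`exists_inverse_inequalities`) use coverability and shape regularity in one way
only: from each x in κ the cone over some ball of radius comparable to h lies in κ, except for a tip
of relative length ε ~ p⁻² (`exists_hasTruncatedCones`). Extrapolating a polynomial of degree p from
[ε,1] to 0 then costs no more than the usual end point estimate, because the Legendre polynomial of
degree n is at most exp(2n²t) at −t. The resulting segment estimate is averaged over the end points
y. Its weight (1−s)^d r(s)² (`exists_segment_kernel`) has two purposes: r is at least 1 at x but has
∫r² ~ p⁻², which gives the sharp p⁴ in the L₂ bound of ∇q, and (1−s)^d cancels the Jacobian when x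
is integrated with y fixed. -/

noncomputable section

namespace DGBiharmonic

open Polynomial in
/-- The shifted Legendre polynomial of degree `n` on `[0, 1]`, with value `1` at `0`. -/
def legendre (n : ℕ) : Polynomial ℝ := (shiftedLegendre n).map (Int.castRingHom ℝ)

/-! ### Legendre polynomials: orthogonality, growth outside the interval, end point estimates -/

section Legendre

open Polynomial

theorem intervalIntegrable_polynomial (f : ℝ[X]) (a b : ℝ) :
    IntervalIntegrable (fun x => f.eval x) volume a b :=
  f.continuous.intervalIntegrable a b

theorem integral_polynomial_derivative (f : ℝ[X]) (a b : ℝ) :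
    ∫ x in a..b, (derivative f).eval x = f.eval b - f.eval a :=
  intervalIntegral.integral_eq_sub_of_hasDerivAt (fun x _ => f.hasDerivAt x)
    (intervalIntegrable_polynomial _ a b)

theorem natDegree_legendre (n : ℕ) : (legendre n).natDegree = n := by
  rw [legendre, natDegree_map_eq_of_injective (Int.castRingHom ℝ).injective_int,
    natDegree_shiftedLegendre]

theorem legendre_ne_zero (n : ℕ) : legendre n ≠ 0 := by
  rw [legendre, Ne, Polynomial.map_eq_zero_iff (Int.castRingHom ℝ).injective_int]
  intro h
  have := degree_shiftedLegendre n
  simp [h] at this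

theorem coeff_legendre (n k : ℕ) :
    (legendre n).coeff k = (-1) ^ k * n.choose k * (n + k).choose n := by
  simp [legendre, coeff_shiftedLegendre]

theorem legendre_eval_zero (n : ℕ) : (legendre n).eval 0 = 1 := by
  rw [← coeff_zero_eq_eval_zero, coeff_legendre]; simp

theorem legendre_eval_one_sq (n : ℕ) : (legendre n).eval 1 ^ 2 = 1 := by
  have h := shiftedLegendre_eval_symm n (1 : ℝ)
  have e : ∀ x : ℝ, aeval x (shiftedLegendre n) = (legendre n).eval x := by
    intro x; rw [legendre, eval_map, aeval_def]; rfl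
  rw [e, e, sub_self, legendre_eval_zero] at h
  rw [h]; rcases neg_one_pow_eq_or ℝ n with h | h <;> simp [h]

theorem factorial_mul_legendre (n : ℕ) :
    C (n.factorial : ℝ) * legendre n = derivative^[n] (X ^ n * (1 - X) ^ n) := by
  have h := congrArg (Polynomial.map (Int.castRingHom ℝ)) (factorial_mul_shiftedLegendre_eq n)
  rw [Polynomial.map_mul, ← iterate_derivative_map] at h
  simpa [legendre] using h

/-- Integration by parts k times. Both end points are zeros of order n of w, so every boundary term
vanishes while fewer than n derivatives fall on w. With Rodrigues' formula this gives orthogonality.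
-/
theorem integral_iterate_derivative_mul (w : ℝ[X]) (n : ℕ) (h0 : X ^ n ∣ w) (h1 : (X - 1) ^ n ∣ w)
    (k : ℕ) (hk : k ≤ n) (q : ℝ[X]) :
    ∫ x in (0 : ℝ)..1, (derivative^[k] w).eval x * q.eval x
      = (-1) ^ k * ∫ x in (0 : ℝ)..1, w.eval x * (derivative^[k] q).eval x := by
  induction k generalizing q with
  | zero => simp
  | succ k ih =>
    have hz : ∀ a : ℝ, (X - C a) ^ n ∣ w → (derivative^[k] w).eval a = 0 := by
      intro a ha
      have h := pow_sub_dvd_iterate_derivative_of_pow_dvd k ha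
      have h2 : (X - C a) ∣ derivative^[k] w := (dvd_pow_self _ (by omega)).trans h
      rwa [dvd_iff_isRoot] at h2
    have e0 := hz 0 (by simpa using h0)
    have e1 := hz 1 (by simpa using h1)
    have key := integral_polynomial_derivative (derivative^[k] w * q) 0 1
    rw [derivative_mul, eval_mul, eval_mul, e0, e1] at key
    simp only [eval_add, eval_mul] at key
    rw [intervalIntegral.integral_add, ih (by omega) (derivative q)] at key
    · rw [Function.iterate_succ_apply', Function.iterate_succ_apply, pow_succ]
      linarith
    · simpa using intervalIntegrable_polynomial (derivative (derivative^[k] w) * q) 0 1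
    · simpa using intervalIntegrable_polynomial (derivative^[k] w * derivative q) 0 1

theorem integral_legendre_mul_eq_zero (n : ℕ) (q : ℝ[X]) (hq : q.degree < n) :
    ∫ x in (0 : ℝ)..1, (legendre n).eval x * q.eval x = 0 := by
  have h := integral_iterate_derivative_mul (X ^ n * (1 - X) ^ n) n (dvd_mul_right _ _)
    (by
      refine dvd_mul_of_dvd_right (pow_dvd_pow_of_dvd ?_ n) _
      exact ⟨-1, by ring⟩) n le_rfl q
  rw [iterate_derivative_eq_zero_of_degree_lt hq, ← factorial_mul_legendre] at h
  simp only [eval_mul, eval_C, eval_zero, mul_zero, intervalIntegral.integral_zero, mul_assoc,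
    intervalIntegral.integral_const_mul] at h
  rcases mul_eq_zero.1 h with h | h
  · exact absurd h (by positivity)
  · exact h

theorem integral_legendre_mul_legendre {m n : ℕ} (h : m ≠ n) :
    ∫ x in (0 : ℝ)..1, (legendre n).eval x * (legendre m).eval x = 0 := by
  rcases lt_or_gt_of_ne h with h | h
  · apply integral_legendre_mul_eq_zero
    rw [degree_eq_natDegree (legendre_ne_zero m), natDegree_legendre]
    exact_mod_cast h
  · simp_rw [mul_comm ((legendre n).eval _)]
    apply integral_legendre_mul_eq_zero
    rw [degree_eq_natDegree (legendre_ne_zero n), natDegree_legendre]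
    exact_mod_cast h

/-- Write L for the Legendre polynomial and integrate the derivative of X L². The leading terms of X
L' − n L cancel, so it has degree below n and is orthogonal to L; what is left is (2n+1) ∫L² = L(1)²
= 1. -/
theorem integral_legendre_sq (n : ℕ) :
    ∫ x in (0 : ℝ)..1, (legendre n).eval x * (legendre n).eval x = 1 / (2 * n + 1) := by
  have key := integral_polynomial_derivative (X * (legendre n) ^ 2) 0 1
  have hsplit : derivative (X * legendre n ^ 2) = C (2 * n + 1 : ℝ) * (legendre n * legendre n)
      + C 2 * (legendre n * (X * derivative (legendre n) - C (n : ℝ) * legendre n)) := by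
    simp only [derivative_mul, derivative_X, derivative_pow, map_add, map_mul, map_one,
      map_natCast, map_ofNat]
    simp
    ring
  have hdeg : (X * derivative (legendre n) - C (n : ℝ) * legendre n).degree < (n : WithBot ℕ) := by
    rw [degree_lt_iff_coeff_zero]
    intro m hm
    rcases m with _ | m
    · have : n = 0 := by omega
      subst this; simp
    · rw [coeff_sub, coeff_X_mul, coeff_C_mul, coeff_derivative]
      rcases eq_or_lt_of_le hm with h | h
      · subst h; push_cast; ring
      · rw [coeff_eq_zero_of_natDegree_lt (p := legendre n)]
        · simp
        · rw [natDegree_legendre]; exact h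
  have hz := integral_legendre_mul_eq_zero n _ hdeg
  rw [hsplit] at key
  simp only [eval_add, eval_mul, eval_C, eval_X, eval_pow, legendre_eval_one_sq] at key hz
  rw [intervalIntegral.integral_add, intervalIntegral.integral_const_mul,
    intervalIntegral.integral_const_mul, hz] at key
  · have : (2 * (n : ℝ) + 1) ≠ 0 := by positivity
    rw [eq_div_iff this]
    linarith
  · exact Continuous.intervalIntegrable (by fun_prop) _ _
  · exact Continuous.intervalIntegrable (by fun_prop) _ _

/-- These are the absolute values of the Legendre coefficients. The step from k to k + 1 multiplies
them by (n−k)(n+k+1)/(k+1)² ≤ 2n²/(k+1), so they are dominated by the Taylor coefficients of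
exp(2n²t). -/
theorem choose_mul_choose_le (n k : ℕ) :
    ((n.choose k : ℝ) * (n + k).choose n) ≤ (2 * n ^ 2) ^ k / k.factorial := by
  induction k with
  | zero => simp
  | succ k ih =>
    have h1 : (n.choose (k + 1) : ℝ) * (k + 1) = n.choose k * ((n - k : ℕ) : ℝ) := by
      exact_mod_cast Nat.choose_succ_right_eq n k
    have h2 : ((n + (k + 1)).choose n : ℝ) * (k + 1) = (n + k).choose n * (n + k + 1) := by
      have := Nat.choose_mul_succ_eq (n + k) n
      have e : n + k + 1 - n = k + 1 := by omega
      rw [e] at this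
      have h := this.symm
      rw [add_assoc n k 1] at h
      exact_mod_cast h
    have h3 : (n.choose (k + 1) : ℝ) * (n + (k + 1)).choose n * ((k + 1) * (k + 1))
        = (n.choose k * (n + k).choose n) * (((n - k : ℕ) : ℝ) * (n + k + 1)) := by
      linear_combination ((n + (k + 1)).choose n : ℝ) * (k + 1) * h1
        + (n.choose k : ℝ) * ((n - k : ℕ) : ℝ) * h2
    have h4 : (((n - k : ℕ) : ℝ) * (n + k + 1)) ≤ 2 * n ^ 2 := by
      rcases le_or_gt n k with h | h
      · rw [Nat.sub_eq_zero_of_le h]; simp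
      · rw [Nat.cast_sub h.le]
        have : (n : ℝ) ≥ 1 := by exact_mod_cast (by omega : 1 ≤ n)
        nlinarith [sq_nonneg (k : ℝ), (Nat.cast_nonneg k : (0 : ℝ) ≤ k)]
    have hk : (0 : ℝ) ≤ k := Nat.cast_nonneg k
    have h5 : (n.choose (k + 1) : ℝ) * (n + (k + 1)).choose n * (k + 1) ≤
        (n.choose (k + 1) : ℝ) * (n + (k + 1)).choose n * ((k + 1) * (k + 1)) := by
      gcongr
      nlinarith
    rw [le_div_iff₀ (by positivity)] at ih ⊢
    calc (n.choose (k + 1) : ℝ) * (n + (k + 1)).choose n * (k + 1).factorial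
        = ((n.choose (k + 1) : ℝ) * (n + (k + 1)).choose n * (k + 1)) * k.factorial := by
          rw [Nat.factorial_succ]; push_cast; ring
      _ ≤ ((n.choose k * (n + k).choose n) * (((n - k : ℕ) : ℝ) * (n + k + 1))) * k.factorial := by
          rw [← h3]; gcongr
      _ = (n.choose k * (n + k).choose n * k.factorial) * (((n - k : ℕ) : ℝ) * (n + k + 1)) := by
          ring
      _ ≤ (2 * n ^ 2) ^ k * (2 * n ^ 2) := by gcongr
      _ = (2 * n ^ 2) ^ (k + 1) := by ring

/-- To the left of 0 the alternating signs of the coefficients cancel, which makes both the lower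
bound 1 and the exponential upper bound termwise. -/
theorem legendre_eval_neg (n : ℕ) (t : ℝ) :
    (legendre n).eval (-t) = ∑ k ∈ Finset.range (n + 1), (n.choose k : ℝ) * (n + k).choose n * t ^ k := by
  rw [eval_eq_sum_range, natDegree_legendre]
  refine Finset.sum_congr rfl fun k _ => ?_
  rw [coeff_legendre, neg_pow]
  have : ((-1 : ℝ) ^ k) * (-1) ^ k = 1 := by rw [← mul_pow]; simp
  linear_combination (n.choose k : ℝ) * (n + k).choose n * t ^ k * this

theorem one_le_legendre_eval_neg (n : ℕ) {t : ℝ} (ht : 0 ≤ t) : 1 ≤ (legendre n).eval (-t) := by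
  rw [legendre_eval_neg]
  refine le_trans ?_ (Finset.single_le_sum (f := fun k => (n.choose k : ℝ) * (n + k).choose n * t ^ k)
    (fun k _ => by positivity) (Finset.mem_range.2 (Nat.succ_pos n)))
  simp

theorem legendre_eval_neg_le (n : ℕ) {t : ℝ} (ht : 0 ≤ t) :
    (legendre n).eval (-t) ≤ Real.exp (2 * n ^ 2 * t) := by
  rw [legendre_eval_neg]
  refine le_trans (Finset.sum_le_sum fun k _ => ?_)
    (Real.sum_le_exp_of_nonneg (by positivity : 0 ≤ 2 * (n : ℝ) ^ 2 * t) (n + 1))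
  calc _ ≤ (2 * (n : ℝ) ^ 2) ^ k / k.factorial * t ^ k := by
        gcongr; exact choose_mul_choose_le n k
    _ = _ := by rw [mul_pow _ t]; ring

theorem abs_derivative_legendre_eval_neg_le (n : ℕ) {t : ℝ} (ht : 0 ≤ t) :
    |(derivative (legendre n)).eval (-t)| ≤ 2 * n ^ 2 * Real.exp (2 * n ^ 2 * t) := by
  rcases Nat.eq_zero_or_pos n with hn | hn
  · subst hn
    rw [derivative_of_natDegree_zero (natDegree_legendre 0)]; simp
  have hd : (derivative (legendre n)).eval (-t) = ∑ k ∈ Finset.range n,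
      (-1) ^ (k + 1) * ((n.choose (k + 1) : ℝ) * (n + (k + 1)).choose n * (k + 1)) * (-t) ^ k := by
    rw [eval_eq_sum_range' (n := n) ((natDegree_derivative_lt
      (by rw [natDegree_legendre]; omega)).trans_eq (natDegree_legendre n))]
    refine Finset.sum_congr rfl fun k _ => ?_
    rw [coeff_derivative, coeff_legendre]; ring
  rw [hd]
  refine (Finset.abs_sum_le_sum_abs _ _).trans ?_
  have hexp := mul_le_mul_of_nonneg_left
    (Real.sum_le_exp_of_nonneg (by positivity : 0 ≤ 2 * (n : ℝ) ^ 2 * t) n)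
    (by positivity : 0 ≤ 2 * (n : ℝ) ^ 2)
  refine le_trans ?_ hexp
  rw [Finset.mul_sum]
  refine Finset.sum_le_sum fun k _ => ?_
  rw [abs_mul, abs_mul, abs_pow, abs_pow, abs_neg, abs_neg, abs_one, one_pow, one_mul,
    abs_of_nonneg ht, abs_of_nonneg (by positivity)]
  have h := choose_mul_choose_le n (k + 1)
  calc _ ≤ (2 * (n : ℝ) ^ 2) ^ (k + 1) / (k + 1).factorial * (k + 1) * t ^ k := by gcongr
    _ = _ := by
      rw [Nat.factorial_succ, mul_pow _ t]
      push_cast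
      field_simp
      ring

theorem exists_eq_sum_legendre (n : ℕ) : ∀ f : ℝ[X], f.natDegree ≤ n →
    ∃ c : ℕ → ℝ, f = ∑ k ∈ Finset.range (n + 1), C (c k) * legendre k := by
  induction n with
  | zero =>
    intro f hf
    have h1 := eq_C_of_natDegree_le_zero hf
    have h2 := eq_C_of_natDegree_le_zero (natDegree_legendre 0).le
    have h3 : (legendre 0).coeff 0 = 1 := by simp [coeff_legendre]
    refine ⟨fun _ => f.coeff 0, ?_⟩
    rw [h3] at h2
    simpa [h2] using h1
  | succ n ih =>
    intro f hf
    have hl : (legendre (n + 1)).coeff (n + 1) ≠ 0 := by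
      have := legendre_ne_zero (n + 1)
      rw [← leadingCoeff_ne_zero, leadingCoeff, natDegree_legendre] at this
      exact this
    set a := f.coeff (n + 1) / (legendre (n + 1)).coeff (n + 1) with ha
    obtain ⟨c, hc⟩ := ih (f - C a * legendre (n + 1)) (by
      rw [natDegree_le_iff_coeff_eq_zero]
      intro m hm
      rw [coeff_sub, coeff_C_mul]
      rcases eq_or_lt_of_le (Nat.succ_le_of_lt hm) with h | h
      · rw [← h, ha]; simp only [Nat.succ_eq_add_one]; field_simp; ring
      · rw [coeff_eq_zero_of_natDegree_lt (lt_of_le_of_lt hf h),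
          coeff_eq_zero_of_natDegree_lt (by rw [natDegree_legendre]; exact h)]
        simp)
    refine ⟨fun k => if k = n + 1 then a else c k, ?_⟩
    simp only [Finset.sum_range_succ _ (n + 1), if_true]
    rw [← sub_eq_iff_eq_add, hc]
    refine Finset.sum_congr rfl fun k hk => ?_
    rw [if_neg (by have := Finset.mem_range.1 hk; omega)]

theorem integral_sum_legendre_sq (n : ℕ) (c : ℕ → ℝ) :
    ∫ x in (0 : ℝ)..1, (∑ k ∈ Finset.range n, C (c k) * legendre k).eval x ^ 2
      = ∑ k ∈ Finset.range n, c k ^ 2 / (2 * k + 1) := by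
  have h : ∀ x : ℝ, (∑ k ∈ Finset.range n, C (c k) * legendre k).eval x ^ 2
      = ∑ k ∈ Finset.range n, ∑ l ∈ Finset.range n,
        (c k * c l) * ((legendre k).eval x * (legendre l).eval x) := by
    intro x
    rw [eval_finsetSum, sq, Finset.sum_mul_sum]
    refine Finset.sum_congr rfl fun k _ => Finset.sum_congr rfl fun l _ => ?_
    simp only [eval_mul, eval_C]; ring
  simp_rw [h]
  rw [intervalIntegral.integral_finsetSum
    fun k _ => Continuous.intervalIntegrable (by fun_prop) _ _]
  refine Finset.sum_congr rfl fun k hk => ?_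
  rw [intervalIntegral.integral_finsetSum
    fun k _ => Continuous.intervalIntegrable (by fun_prop) _ _]
  simp_rw [intervalIntegral.integral_const_mul]
  rw [Finset.sum_eq_single_of_mem k hk, integral_legendre_sq]
  · ring
  · intro l _ hl
    rw [integral_legendre_mul_legendre hl, mul_zero]

theorem sum_range_odd (n : ℕ) : ∑ k ∈ Finset.range n, (2 * (k : ℝ) + 1) = n ^ 2 := by
  induction n with
  | zero => simp
  | succ n ih => rw [Finset.sum_range_succ, ih]; push_cast; ring

/-- A linear functional bounded by `M` on the Legendre polynomials of degree at most `n` has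
norm at most `(n + 1) M` on the polynomials of degree at most `n`. -/
theorem sq_linearMap_le (φ : ℝ[X] →ₗ[ℝ] ℝ) (n : ℕ) (M : ℝ)
    (hM : ∀ k ≤ n, φ (legendre k) ^ 2 ≤ M) (f : ℝ[X]) (hf : f.natDegree ≤ n) :
    φ f ^ 2 ≤ (n + 1) ^ 2 * M * ∫ x in (0 : ℝ)..1, f.eval x ^ 2 := by
  obtain ⟨c, rfl⟩ := exists_eq_sum_legendre n f hf
  have hφ : φ (∑ k ∈ Finset.range (n + 1), C (c k) * legendre k)
      = ∑ k ∈ Finset.range (n + 1), c k * φ (legendre k) := by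
    rw [map_sum]
    refine Finset.sum_congr rfl fun k _ => ?_
    rw [← smul_eq_C_mul, map_smul, smul_eq_mul]
  rw [hφ, integral_sum_legendre_sq]
  -- The weights are the L₂ norms 1/√(2k+1) of the Legendre polynomials; summing 2k + 1 over k ≤ n
  -- produces the factor (n+1)².
  have hcs := Finset.sum_mul_sq_le_sq_mul_sq (Finset.range (n + 1))
    (fun k => c k / Real.sqrt (2 * k + 1)) (fun k => Real.sqrt (2 * k + 1) * φ (legendre k))
  have e1 : ∀ k : ℕ, c k / Real.sqrt (2 * k + 1) * (Real.sqrt (2 * k + 1) * φ (legendre k))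
      = c k * φ (legendre k) := by
    intro k
    have : Real.sqrt (2 * (k : ℝ) + 1) ≠ 0 := by positivity
    rw [div_mul_eq_mul_div, mul_div_assoc, mul_div_cancel_left₀ _ this]
  have e2 : ∀ k : ℕ, (c k / Real.sqrt (2 * k + 1)) ^ 2 = c k ^ 2 / (2 * k + 1) := by
    intro k; rw [div_pow, Real.sq_sqrt (by positivity)]
  have e3 : ∀ k : ℕ, (Real.sqrt (2 * k + 1) * φ (legendre k)) ^ 2
      = (2 * k + 1) * φ (legendre k) ^ 2 := by
    intro k; rw [mul_pow, Real.sq_sqrt (by positivity)]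
  simp_rw [e1, e2, e3] at hcs
  refine hcs.trans ?_
  rw [mul_comm]
  refine mul_le_mul_of_nonneg_right ?_ (Finset.sum_nonneg fun k _ => by positivity)
  calc _ ≤ ∑ k ∈ Finset.range (n + 1), (2 * (k : ℝ) + 1) * M := by
        refine Finset.sum_le_sum fun k hk => ?_
        have := hM k (by have := Finset.mem_range.1 hk; omega)
        gcongr
    _ = _ := by rw [← Finset.sum_mul, sum_range_odd]; push_cast; ring

theorem sq_eval_neg_le (n : ℕ) {t : ℝ} (ht : 0 ≤ t) (f : ℝ[X]) (hf : f.natDegree ≤ n) :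
    f.eval (-t) ^ 2
      ≤ (n + 1) ^ 2 * Real.exp (4 * n ^ 2 * t) * ∫ x in (0 : ℝ)..1, f.eval x ^ 2 := by
  refine sq_linearMap_le (leval (-t)) n _ (fun k hk => ?_) f hf
  simp only [leval_apply]
  have h1 := legendre_eval_neg_le k ht
  have h0 := one_le_legendre_eval_neg k ht
  calc _ ≤ Real.exp (2 * k ^ 2 * t) ^ 2 := by gcongr
    _ = Real.exp (4 * k ^ 2 * t) := by rw [← Real.exp_nat_mul]; congr 1; push_cast; ring
    _ ≤ _ := by gcongr

theorem sq_derivative_eval_neg_le (n : ℕ) {t : ℝ} (ht : 0 ≤ t) (f : ℝ[X]) (hf : f.natDegree ≤ n) :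
    (derivative f).eval (-t) ^ 2 ≤ (n + 1) ^ 2 * (4 * n ^ 4 * Real.exp (4 * n ^ 2 * t))
      * ∫ x in (0 : ℝ)..1, f.eval x ^ 2 := by
  refine sq_linearMap_le (leval (-t) ∘ₗ derivative) n _ (fun k hk => ?_) f hf
  simp only [LinearMap.comp_apply, leval_apply]
  have h1 := abs_derivative_legendre_eval_neg_le k ht
  rw [← sq_abs]
  calc _ ≤ (2 * k ^ 2 * Real.exp (2 * k ^ 2 * t)) ^ 2 := by gcongr
    _ = 4 * k ^ 4 * Real.exp (4 * k ^ 2 * t) := by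
      rw [mul_pow, ← Real.exp_nat_mul]; congr 1; · ring
      congr 1; push_cast; ring
    _ ≤ _ := by gcongr

/-- A polynomial concentrated at the end point `0` of `[0, 1]`. -/
theorem exists_concentrated_polynomial (n : ℕ) : ∃ R : ℝ[X], R.natDegree ≤ n ∧
    (∀ t : ℝ, 0 ≤ t → 1 ≤ R.eval (-t)) ∧
    ∫ x in (0 : ℝ)..1, R.eval x ^ 2 = 1 / (n + 1) ^ 2 := by
  -- The reproducing kernel of evaluation at 0, scaled to have the value 1 there. Positive
  -- coefficients keep it at least 1 to the left of 0.
  refine ⟨∑ k ∈ Finset.range (n + 1), C ((2 * k + 1) / ((n + 1) ^ 2 : ℝ)) * legendre k, ?_, ?_, ?_⟩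
  · refine natDegree_sum_le_of_forall_le _ _ fun k hk => ?_
    refine (natDegree_C_mul_le _ _).trans ?_
    rw [natDegree_legendre]
    have := Finset.mem_range.1 hk; omega
  · intro t ht
    rw [eval_finsetSum]
    calc (1 : ℝ) = ∑ k ∈ Finset.range (n + 1), (2 * k + 1) / ((n + 1) ^ 2 : ℝ) := by
          rw [← Finset.sum_div, sum_range_odd]; push_cast; field_simp
      _ ≤ _ := by
          refine Finset.sum_le_sum fun k _ => ?_
          rw [eval_mul, eval_C]
          exact le_mul_of_one_le_right (by positivity) (one_le_legendre_eval_neg k ht)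
  · rw [integral_sum_legendre_sq]
    calc _ = ∑ k ∈ Finset.range (n + 1), (2 * (k : ℝ) + 1) / ((n + 1) ^ 4 : ℝ) := by
          refine Finset.sum_congr rfl fun k _ => ?_
          field_simp
      _ = _ := by
          rw [← Finset.sum_div, sum_range_odd]; push_cast; field_simp

/-- The endpoint trace inequality with the weight `t ^ m`. -/
theorem sq_eval_one_le (m p : ℕ) (f : ℝ[X]) (hf : f.natDegree ≤ p) :
    f.eval 1 ^ 2 ≤ (p + m + 1) ^ 2 * ∫ x in (0 : ℝ)..1, x ^ m * f.eval x ^ 2 := by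
  -- The weight is absorbed into the polynomial at the price of degree p + m, and the reflection
  -- moves the end point 1 to 0. The square of x^m is at most x^m on [0,1].
  set g : ℝ[X] := (f * X ^ m).comp (1 - X) with hg
  have hdeg : g.natDegree ≤ p + m := by
    refine natDegree_comp_le.trans ?_
    have h1 : (f * X ^ m).natDegree ≤ p + m :=
      natDegree_mul_le.trans (add_le_add hf (natDegree_X_pow_le m))
    have h2 : (1 - X : ℝ[X]).natDegree ≤ 1 :=
      (natDegree_sub_le _ _).trans (by simp)
    calc _ ≤ (p + m) * 1 := Nat.mul_le_mul h1 h2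
      _ = _ := mul_one _
  have h := sq_eval_neg_le (p + m) le_rfl g hdeg
  have e0 : g.eval (-0) = f.eval 1 := by simp [hg]
  rw [e0] at h
  simp only [mul_zero, Real.exp_zero, mul_one] at h
  refine h.trans ?_
  push_cast
  refine mul_le_mul_of_nonneg_left ?_ (by positivity)
  have e1 : (∫ x in (0 : ℝ)..1, g.eval x ^ 2) = ∫ x in (0 : ℝ)..1, (f.eval x * x ^ m) ^ 2 := by
    have := intervalIntegral.integral_comp_sub_left (a := 0) (b := 1)
      (fun x => (f.eval x * x ^ m) ^ 2) (1 : ℝ)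
    simpa [hg] using this
  rw [e1]
  refine intervalIntegral.integral_mono_on zero_le_one
    (Continuous.intervalIntegrable (by fun_prop) _ _)
    (Continuous.intervalIntegrable (by fun_prop) _ _) fun x hx => ?_
  have h1 : x ^ m ≤ 1 := pow_le_one₀ hx.1 hx.2
  have h0 : 0 ≤ x ^ m := pow_nonneg hx.1 m
  calc _ = (x ^ m * x ^ m) * f.eval x ^ 2 := by ring
    _ ≤ (x ^ m * 1) * f.eval x ^ 2 := by gcongr
    _ = _ := by ring

end Legendre

/-! ### A concentrated kernel for evaluation just outside a segment -/

section Kernel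

open Polynomial

set_option maxHeartbeats 1000000 in
/-- Point evaluation of polynomials of degree `p`, and of their derivatives, at a point slightly
outside the segment `[ε, 1]`, by a kernel that is concentrated near the end point `ε` and decays
like `(1 - s) ^ d` at the other one. -/
theorem exists_segment_kernel (d : ℕ) (A ε₀ : ℝ) (hε₀ : ε₀ < 1) :
    ∃ K : ℝ, 0 < K ∧ ∀ p : ℕ, 1 ≤ p → ∀ ε : ℝ, 0 ≤ ε → ε ≤ ε₀ → ε * p ^ 2 ≤ A →
      ∃ r : ℝ[X], (∀ f : ℝ[X], f.natDegree ≤ p →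
          f.eval 0 ^ 2 ≤ K * p ^ 2 *
            ∫ s in ε..1, (1 - s) ^ d * r.eval s ^ 2 * f.eval s ^ 2 ∧
          (derivative f).eval 0 ^ 2 ≤ K * p ^ 6 *
            ∫ s in ε..1, (1 - s) ^ d * r.eval s ^ 2 * f.eval s ^ 2) ∧
        ∫ s in ε..1, r.eval s ^ 2 ≤ K / p ^ 2 := by
  set b₀ : ℝ := 1 - ε₀ with hb₀
  have hb₀0 : 0 < b₀ := by linarith
  set D : ℝ := d + 3 with hD
  have hD0 : 0 < D := by positivity
  set E : ℝ := Real.exp (4 * D ^ 2 * A / b₀) with hE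
  have hE0 : 0 < E := Real.exp_pos _
  set c₀ : ℝ := D ^ 2 * E with hc₀
  set c₁ : ℝ := 8 * D ^ 6 * E + 8 * D ^ 8 * E ^ 2 with hc₁
  set β : ℝ := (b₀ ^ (d + 1))⁻¹ with hβ
  have hβ0 : 0 < β := by positivity
  have hc₀0 : 0 < c₀ := by positivity
  have hc₁0 : 0 < c₁ := by positivity
  clear_value b₀ D E c₀ c₁ β
  refine ⟨β * (c₀ + c₁ / b₀ ^ 2) + 1, by positivity, ?_⟩
  intro p hp ε hε hεε hεp
  have hp1 : (1 : ℝ) ≤ p := by exact_mod_cast hp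
  set b : ℝ := 1 - ε with hb
  have hb1 : b₀ ≤ b := by linarith
  have hb0 : 0 < b := by linarith
  have hble : b ≤ 1 := by linarith
  -- The affine map t ↦ ε + b t sends [0,1] to [ε,1] and −η to 0, so the task becomes extrapolation
  -- from [0,1] to −η.
  set η : ℝ := ε / b with hη
  have hη0 : 0 ≤ η := by positivity
  -- A degree bound for the product of the transplanted f with (1−X)^d R. Since N is of order p and
  -- ε p² ≤ A, the exponent N²η stays bounded.
  set N : ℕ := p + d + p with hN
  have hND : (N : ℝ) + 1 ≤ D * p := by
    rw [hN, hD]; push_cast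
    nlinarith [(Nat.cast_nonneg d : (0 : ℝ) ≤ d)]
  have hND' : (N : ℝ) ≤ D * p := by linarith
  have hexp : Real.exp (4 * N ^ 2 * η) ≤ E := by
    rw [hE]
    apply Real.exp_le_exp.2
    calc 4 * (N : ℝ) ^ 2 * η ≤ 4 * (D * p) ^ 2 * (ε / b₀) := by rw [hη]; gcongr
      _ = 4 * D ^ 2 * (ε * p ^ 2) / b₀ := by ring
      _ ≤ _ := by gcongr
  have ev : ∀ u : ℝ[X], u.natDegree ≤ N →
      u.eval (-η) ^ 2 ≤ D ^ 2 * E * p ^ 2 * ∫ x in (0 : ℝ)..1, u.eval x ^ 2 := by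
    intro u hu
    have hI : 0 ≤ ∫ x in (0 : ℝ)..1, u.eval x ^ 2 :=
      intervalIntegral.integral_nonneg zero_le_one fun _ _ => sq_nonneg _
    refine (sq_eval_neg_le N hη0 u hu).trans (mul_le_mul_of_nonneg_right ?_ hI)
    calc _ ≤ (D * p) ^ 2 * E := by gcongr
      _ = _ := by ring
  have ed : ∀ u : ℝ[X], u.natDegree ≤ N →
      (derivative u).eval (-η) ^ 2 ≤ 4 * D ^ 6 * E * p ^ 6 * ∫ x in (0 : ℝ)..1, u.eval x ^ 2 := by
    intro u hu
    have hI : 0 ≤ ∫ x in (0 : ℝ)..1, u.eval x ^ 2 :=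
      intervalIntegral.integral_nonneg zero_le_one fun _ _ => sq_nonneg _
    refine (sq_derivative_eval_neg_le N hη0 u hu).trans (mul_le_mul_of_nonneg_right ?_ hI)
    calc _ ≤ (D * p) ^ 2 * (4 * (D * p) ^ 4 * E) := by gcongr
      _ = _ := by ring
  obtain ⟨R, hRdeg, hR1, hRI⟩ := exists_concentrated_polynomial p
  -- J is at least 1 at −η, so multiplying by J does not lower a value there, while J² ≤ (1−t)^d R²
  -- on [0,1] is controlled by the weight.
  set J : ℝ[X] := (1 - X) ^ d * R with hJ
  have hlin : (1 - X : ℝ[X]).natDegree ≤ 1 := (natDegree_sub_le _ _).trans (by simp)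
  have hJdeg : J.natDegree ≤ p + d := by
    refine natDegree_mul_le.trans ?_
    have := natDegree_pow_le_of_le d hlin
    omega
  have hJ1 : 1 ≤ J.eval (-η) := by
    rw [hJ, eval_mul, eval_pow, eval_sub, eval_one, eval_X]
    have h1 : 1 ≤ (1 - -η) ^ d := one_le_pow₀ (by linarith)
    nlinarith [hR1 η hη0]
  -- The general derivative bound carries p⁶; the small norm of R returns p⁻².
  have hJ' : (derivative J).eval (-η) ^ 2 ≤ 4 * D ^ 6 * E * p ^ 4 := by
    refine (ed J (by omega)).trans ?_
    have : ∫ x in (0 : ℝ)..1, J.eval x ^ 2 ≤ 1 / p ^ 2 := by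
      calc _ ≤ ∫ x in (0 : ℝ)..1, R.eval x ^ 2 := by
            refine intervalIntegral.integral_mono_on zero_le_one
              (Continuous.intervalIntegrable (by fun_prop) _ _)
              (Continuous.intervalIntegrable (by fun_prop) _ _) fun x hx => ?_
            rw [hJ, eval_mul, eval_pow, eval_sub, eval_one, eval_X, mul_pow]
            have h1 : (1 - x) ^ d ≤ 1 := pow_le_one₀ (by linarith [hx.2]) (by linarith [hx.1])
            have h0 : 0 ≤ (1 - x) ^ d := pow_nonneg (by linarith [hx.2]) d
            have : ((1 - x) ^ d) ^ 2 ≤ 1 := pow_le_one₀ h0 h1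
            exact mul_le_of_le_one_left (sq_nonneg _) this
        _ ≤ _ := by
          rw [hRI]
          gcongr
          linarith
    calc _ ≤ 4 * D ^ 6 * E * p ^ 6 * (1 / p ^ 2) := by gcongr
      _ = _ := by field_simp
  clear_value J N η
  set r : ℝ[X] := R.comp (C b⁻¹ * (X - C ε)) with hr
  have hrR : ∀ t : ℝ, r.eval (ε + b * t) = R.eval t := by
    intro t
    simp only [hr, eval_comp, eval_mul, eval_C, eval_sub, eval_X]
    congr 1; field_simp; ring
  have hsub : ∀ h : ℝ → ℝ, ∫ t in (0 : ℝ)..1, h (ε + b * t) = b⁻¹ * ∫ s in ε..1, h s := by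
    intro h
    rw [intervalIntegral.integral_comp_add_mul _ hb0.ne', smul_eq_mul]
    congr 2 <;> simp [hb]
  refine ⟨r, fun f hf => ?_, ?_⟩
  · set F : ℝ[X] := f.comp (C ε + C b * X) with hF
    have hFdeg : F.natDegree ≤ p := by
      refine natDegree_comp_le.trans ?_
      have : (C ε + C b * X : ℝ[X]).natDegree ≤ 1 := by
        refine natDegree_add_le_of_degree_le (by simp) ((natDegree_C_mul_le _ _).trans (by simp))
      calc _ ≤ p * 1 := Nat.mul_le_mul hf this
        _ = p := mul_one _
    have hz : ε + b * (-η) = 0 := by rw [hη]; field_simp; ring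
    have hF0 : F.eval (-η) = f.eval 0 := by
      simp only [hF, eval_comp, eval_add, eval_mul, eval_C, eval_X, hz]
    have hF1 : (derivative F).eval (-η) = b * (derivative f).eval 0 := by
      simp only [hF, derivative_comp, eval_mul, eval_comp, eval_add, eval_C, eval_X, hz]
      simp
    set g : ℝ[X] := F * J with hg
    have hgdeg : g.natDegree ≤ N := natDegree_mul_le.trans (by omega)
    set I : ℝ := ∫ x in (0 : ℝ)..1, g.eval x ^ 2 with hI
    set W : ℝ := ∫ s in ε..1, (1 - s) ^ d * r.eval s ^ 2 * f.eval s ^ 2 with hW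
    have hI0 : 0 ≤ I := intervalIntegral.integral_nonneg zero_le_one fun _ _ => sq_nonneg _
    have hIW : I ≤ β * W := by
      have hW0 : 0 ≤ W := intervalIntegral.integral_nonneg (by linarith) fun s hs =>
        mul_nonneg (mul_nonneg (pow_nonneg (by linarith [hs.2]) _) (sq_nonneg _)) (sq_nonneg _)
      have h1 : I ≤ ∫ t in (0 : ℝ)..1, (b ^ d)⁻¹ *
          ((1 - (ε + b * t)) ^ d * r.eval (ε + b * t) ^ 2 * f.eval (ε + b * t) ^ 2) := by
        refine intervalIntegral.integral_mono_on zero_le_one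
          (Continuous.intervalIntegrable (by fun_prop) _ _)
          (Continuous.intervalIntegrable (by fun_prop) _ _) fun t ht => ?_
        have hfe : f.eval (ε + b * t) = F.eval t := by simp [hF, eval_comp]
        have h1t : 1 - (ε + b * t) = b * (1 - t) := by rw [hb]; ring
        rw [hrR, hfe, h1t, mul_pow, hg, hJ, eval_mul, eval_mul, eval_pow, eval_sub, eval_one,
          eval_X]
        have h1 : (1 - t) ^ d ≤ 1 := pow_le_one₀ (by linarith [ht.2]) (by linarith [ht.1])
        have h0 : 0 ≤ (1 - t) ^ d := pow_nonneg (by linarith [ht.2]) d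
        calc _ = ((1 - t) ^ d * (1 - t) ^ d) * (F.eval t ^ 2 * R.eval t ^ 2) := by ring
          _ ≤ ((1 - t) ^ d * 1) * (F.eval t ^ 2 * R.eval t ^ 2) := by gcongr
          _ = _ := by field_simp
      rw [intervalIntegral.integral_const_mul,
        hsub (fun s => (1 - s) ^ d * r.eval s ^ 2 * f.eval s ^ 2)] at h1
      refine h1.trans ?_
      rw [← mul_assoc, ← mul_inv, ← pow_succ]
      refine mul_le_mul_of_nonneg_right ?_ hW0
      rw [hβ]
      gcongr
    have hW0 : 0 ≤ W := by
      by_contra h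
      push Not at h
      nlinarith
    have hgv := ev g hgdeg
    have hgd := ed g hgdeg
    rw [← hI] at hgv hgd
    clear_value F g I W
    have hfg : F.eval (-η) ^ 2 ≤ g.eval (-η) ^ 2 := by
      rw [hg, eval_mul, mul_pow]
      exact le_mul_of_one_le_right (sq_nonneg _) (one_le_pow₀ hJ1)
    have hfv : F.eval (-η) ^ 2 ≤ c₀ * p ^ 2 * I := hfg.trans (hgv.trans_eq (by rw [hc₀]))
    have hfd : (derivative F).eval (-η) ^ 2 ≤ c₁ * p ^ 6 * I := by
      -- The product rule solved for F'. The term F J' is of the same order as g', since F²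
      -- contributes p² and J'² contributes p⁴.
      have e : (derivative F).eval (-η) * J.eval (-η)
          = (derivative g).eval (-η) - F.eval (-η) * (derivative J).eval (-η) := by
        simp only [hg, derivative_mul, eval_add, eval_mul]; ring
      calc _ ≤ ((derivative F).eval (-η) * J.eval (-η)) ^ 2 := by
            rw [mul_pow]
            exact le_mul_of_one_le_right (sq_nonneg _) (one_le_pow₀ hJ1)
        _ ≤ 2 * (derivative g).eval (-η) ^ 2
            + 2 * (F.eval (-η) ^ 2 * (derivative J).eval (-η) ^ 2) := by
            rw [e]
            nlinarith [sq_nonneg ((derivative g).eval (-η)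
              + F.eval (-η) * (derivative J).eval (-η))]
        _ ≤ 2 * (4 * D ^ 6 * E * p ^ 6 * I)
            + 2 * ((c₀ * p ^ 2 * I) * (4 * D ^ 6 * E * p ^ 4)) := by gcongr
        _ = _ := by rw [hc₁, hc₀]; ring
    constructor
    · rw [← hF0]
      calc _ ≤ c₀ * p ^ 2 * I := hfv
        _ ≤ c₀ * p ^ 2 * (β * W) := by gcongr
        _ = (β * (c₀ + 0)) * p ^ 2 * W := by ring
        _ ≤ _ := by
          gcongr
          have : 0 ≤ β * (c₁ / b₀ ^ 2) := by positivity
          linarith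
    · have h1 : (derivative f).eval 0 ^ 2 = (derivative F).eval (-η) ^ 2 / b ^ 2 := by
        rw [hF1]; field_simp
      rw [h1]
      calc _ ≤ (c₁ * p ^ 6 * (β * W)) / b₀ ^ 2 := by
            gcongr
            exact hfd.trans (by gcongr)
        _ = (β * (0 + c₁ / b₀ ^ 2)) * p ^ 6 * W := by ring
        _ ≤ _ := by
          gcongr
          have : 0 ≤ β * c₀ := by positivity
          linarith
  · have h := hsub (fun s => r.eval s ^ 2)
    simp only [hrR, hRI] at h
    have h2 : ∫ s in ε..1, r.eval s ^ 2 = b * (1 / ((p : ℝ) + 1) ^ 2) := by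
      rw [h]; field_simp
    rw [h2]
    have h3 : 0 ≤ β * (c₀ + c₁ / b₀ ^ 2) := by positivity
    calc _ ≤ 1 * (1 / ((p : ℝ)) ^ 2) := by gcongr; linarith
      _ = 1 / (p : ℝ) ^ 2 := one_mul _
      _ ≤ _ := by gcongr; linarith

end Kernel

/-! ### Inscribed balls, volumes and truncated cones -/

/-- From every point `x` of `κ` the cone over some ball of radius `ρ` stays inside `κ`, except
possibly for the part closest to `x`, of relative length `ε`. -/
def HasTruncatedCones {d : ℕ} (κ : Set (Pt d)) (ρ ε : ℝ) : Prop :=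
  ∀ x ∈ κ, ∃ c, ∀ y ∈ Metric.ball c ρ, ∀ s ∈ Icc ε 1, x + s • (y - x) ∈ κ

theorem HasTruncatedCones.ball_subset {d : ℕ} {κ : Set (Pt d)} {ρ ε : ℝ} (hε : ε ≤ 1)
    {x c : Pt d} (h : ∀ y ∈ Metric.ball c ρ, ∀ s ∈ Icc ε 1, x + s • (y - x) ∈ κ) :
    Metric.ball c ρ ⊆ κ := fun y hy => by
  simpa using h y hy 1 ⟨hε, le_rfl⟩

section Inball

variable {d : ℕ}

/-- The supremum is 0 by convention for an empty set, so positivity yields a ball. The proof chooses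
one with more than half the supremal diameter, hence the factor 1/4 for its radius. -/
theorem exists_ball_of_inballDiam_pos {s : Set (Pt d)} (h : 0 < inballDiam s) :
    ∃ c, ∃ r, inballDiam s / 4 ≤ r ∧ Metric.ball c r ⊆ s := by
  have hne : {t : ℝ | 0 < t ∧ ∃ x, Metric.ball x (t / 2) ⊆ s}.Nonempty := by
    by_contra hne
    rw [not_nonempty_iff_eq_empty] at hne
    rw [inballDiam, hne, Real.sSup_empty] at h
    exact lt_irrefl _ h
  obtain ⟨t, ⟨_, c, hc⟩, ht⟩ := exists_lt_of_lt_csSup hne (half_lt_self h)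
  refine ⟨c, t / 2, ?_, hc⟩
  have : inballDiam s / 2 < t := ht
  linarith

theorem le_diam_of_ball_subset [NeZero d] {s : Set (Pt d)} (hs : Bornology.IsBounded s) {c : Pt d}
    {r : ℝ} (hr : 0 < r) (h : Metric.ball c r ⊆ s) : r / 2 ≤ Metric.diam s := by
  have he : ‖EuclideanSpace.single (0 : Fin d) (1 : ℝ)‖ = 1 := by simp
  have h2 : c + (r / 2) • EuclideanSpace.single (0 : Fin d) (1 : ℝ) ∈ s := by
    apply h
    rw [Metric.mem_ball, dist_self_add_left, norm_smul, he, Real.norm_of_nonneg (by positivity)]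
    linarith
  have := Metric.dist_le_diam_of_mem hs h2 (h (Metric.mem_ball_self hr))
  rwa [dist_self_add_left, norm_smul, he, Real.norm_of_nonneg (by positivity), mul_one] at this

theorem inballDiam_pos [NeZero d] {s : Set (Pt d)} (hb : Bornology.IsBounded s) (ho : IsOpen s)
    (hne : s.Nonempty) : 0 < inballDiam s := by
  obtain ⟨x, hx⟩ := hne
  obtain ⟨r, hr, hball⟩ := Metric.isOpen_iff.1 ho x hx
  have hbdd : BddAbove {t : ℝ | 0 < t ∧ ∃ x, Metric.ball x (t / 2) ⊆ s} := by
    refine ⟨4 * Metric.diam s, ?_⟩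
    rintro t ⟨ht, c, hc⟩
    have := le_diam_of_ball_subset hb (half_pos ht) hc
    linarith
  have : 2 * r ≤ inballDiam s :=
    le_csSup hbdd ⟨by positivity, x, by simpa using hball⟩
  linarith

theorem diam_pos_of_isOpen [NeZero d] {s : Set (Pt d)} (hb : Bornology.IsBounded s) (ho : IsOpen s)
    (hne : s.Nonempty) : 0 < Metric.diam s := by
  obtain ⟨x, hx⟩ := hne
  obtain ⟨r, hr, hball⟩ := Metric.isOpen_iff.1 ho x hx
  have := le_diam_of_ball_subset hb hr hball
  linarith

theorem le_infDist_frontier_of_ball_subset {s : Set (Pt d)} (hne : (frontier s).Nonempty) {z : Pt d}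
    {r : ℝ} (h : Metric.ball z r ⊆ s) : r ≤ Metric.infDist z (frontier s) := by
  rw [Metric.le_infDist hne]
  intro y hy
  by_contra hlt
  push Not at hlt
  have : y ∈ interior s := interior_maximal h Metric.isOpen_ball (by rwa [Metric.mem_ball'])
  exact hy.2 this

/-- The homothety with centre x and ratio t maps the ball about y onto the smaller ball and
preserves s. -/
theorem Convex.ball_subset_of_ball_subset {s : Set (Pt d)} (hs : Convex ℝ s) {x y : Pt d} {r t : ℝ}
    (hx : x ∈ s) (hy : Metric.ball y r ⊆ s) (ht0 : 0 < t) (ht1 : t ≤ 1) :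
    Metric.ball (x + t • (y - x)) (t * r) ⊆ s := by
  intro w hw
  have hmem : y + t⁻¹ • (w - (x + t • (y - x))) ∈ s := by
    apply hy
    rw [Metric.mem_ball, dist_self_add_left, norm_smul, norm_inv, Real.norm_of_nonneg ht0.le,
      inv_mul_lt_iff₀ ht0, ← dist_eq_norm]
    exact hw
  have h := hs hx hmem (sub_nonneg.2 ht1) ht0.le (by ring)
  convert h using 1
  rw [smul_add, smul_smul, mul_inv_cancel₀ ht0.ne', one_smul]
  module

theorem volume_real_ball_eq [NeZero d] {c : Pt d} {r : ℝ} (hr : 0 ≤ r) :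
    volume.real (Metric.ball c r) = r ^ d * volume.real (Metric.ball (0 : Pt d) 1) := by
  have h := Measure.addHaar_ball (volume : Measure (Pt d)) c hr
  rw [finrank_euclideanSpace_fin] at h
  rw [Measure.real, h, ENNReal.toReal_mul, ENNReal.toReal_ofReal (by positivity)]; rfl

theorem volume_real_ball_zero_one_pos : 0 < volume.real (Metric.ball (0 : Pt d) 1) :=
  ENNReal.toReal_pos (Metric.measure_ball_pos _ _ one_pos).ne' measure_ball_lt_top.ne

theorem volume_real_le_diam_pow {s : Set (Pt d)} (hb : Bornology.IsBounded s) :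
    volume.real s ≤ Metric.diam s ^ d * volume.real (Metric.ball (0 : Pt d) 1) := by
  rcases s.eq_empty_or_nonempty with rfl | ⟨x, hx⟩
  · simp; positivity
  have hsub : s ⊆ Metric.closedBall x (Metric.diam s) := fun y hy =>
    Metric.dist_le_diam_of_mem hb hy hx
  have h := Measure.addHaar_closedBall (volume : Measure (Pt d)) x (Metric.diam_nonneg (s := s))
  rw [finrank_euclideanSpace_fin] at h
  calc _ ≤ volume.real (Metric.closedBall x (Metric.diam s)) :=
        measureReal_mono hsub measure_closedBall_lt_top.ne
    _ = _ := by
      rw [Measure.real, h, ENNReal.toReal_mul,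
        ENNReal.toReal_ofReal (pow_nonneg Metric.diam_nonneg _)]; rfl

/-- With B the unit ball, a r^d |B| ≤ a |s| ≤ |K| ≤ diam(K)^d |B|, and a^d ≤ a because a ≤ 1. -/
theorem diam_ge_of_volume_ge [NeZero d] {s K : Set (Pt d)} (hs : Bornology.IsBounded s)
    (hK : Bornology.IsBounded K) {c : Pt d} {r a : ℝ} (hr : 0 ≤ r) (hball : Metric.ball c r ⊆ s)
    (ha : 0 ≤ a) (ha1 : a ≤ 1) (h : a * volume.real s ≤ volume.real K) :
    a * r ≤ Metric.diam K := by
  have h1 : a * (r ^ d * volume.real (Metric.ball (0 : Pt d) 1))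
      ≤ Metric.diam K ^ d * volume.real (Metric.ball (0 : Pt d) 1) := by
    rw [← volume_real_ball_eq (c := c) hr]
    refine le_trans ?_ (h.trans (volume_real_le_diam_pow hK))
    gcongr
    exact hs.measure_lt_top.ne
  rw [← mul_assoc] at h1
  have h2 := le_of_mul_le_mul_right h1 volume_real_ball_zero_one_pos
  refine le_of_pow_le_pow_left₀ (NeZero.ne d) Metric.diam_nonneg ?_
  refine le_trans ?_ h2
  rw [mul_pow]
  gcongr
  exact pow_le_of_le_one ha ha1 (NeZero.ne d)

end Inball

/-- Shape-regular `p`-coverable elements have truncated cones with `ε ~ p⁻²`. -/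
theorem exists_hasTruncatedCones (d : ℕ) [NeZero d] {Cr Cas cas Csh : ℝ} (hCr : 0 < Cr)
    (hCas : 0 < Cas) (hcas : 0 < cas) (hCsh : 0 < Csh) :
    ∃ c₀ A ε₀ : ℝ, 0 < c₀ ∧ 0 < A ∧ ε₀ < 1 ∧ ∀ (κ : Set (Pt d)) (p : ℕ), Bornology.IsBounded κ →
      IsOpen κ → κ.Nonempty → 2 ≤ p → Metric.diam κ / inballDiam κ ≤ Cr →
      IsPCoverable Cas cas Csh κ p →
      ∃ ε : ℝ, 1 ≤ ε * p ^ 2 ∧ ε * p ^ 2 ≤ A ∧ ε ≤ ε₀ ∧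
        HasTruncatedCones κ (c₀ * Metric.diam κ) ε := by
  set a : ℝ := min 1 cas with ha
  have ha0 : 0 < a := lt_min one_pos hcas
  -- A covering simplex contains a ball of radius r₀ ≥ diam/(4 C_sh). The point with parameter s on
  -- a segment to the inner half of that ball has distance at least s r₀/2 from the boundary, which
  -- reaches C_as diam/p² once s ≥ 8 C_as C_sh/p².
  set A₁ : ℝ := max (8 * Cas * Csh) 1 with hA₁
  have hA₁1 : 1 ≤ A₁ := le_max_right _ _
  set ε₀ : ℝ := max (3 / 4) (1 - 1 / (8 * Cr)) with hε₀
  refine ⟨min (a / (32 * Cr * Csh)) (1 / (8 * Cr)), 2 * A₁, ε₀, by positivity, by positivity,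
    max_lt (by norm_num) (by linarith [show 0 < 1 / (8 * Cr) by positivity]), ?_⟩
  intro κ p hb ho hne hp hratio ⟨m, K, hcov, hK⟩
  have hp2 : (2 : ℝ) ≤ p := by exact_mod_cast hp
  have hppos : (0 : ℝ) < p ^ 2 := by positivity
  set h : ℝ := Metric.diam κ with hh
  have hh0 : 0 < h := diam_pos_of_isOpen hb ho hne
  have hin := inballDiam_pos hb ho hne
  rw [div_le_iff₀ hin] at hratio
  obtain ⟨c, r, hr, hball⟩ := exists_ball_of_inballDiam_pos hin
  have hhr : h / (4 * Cr) ≤ r := by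
    refine le_trans ?_ hr
    rw [div_le_div_iff₀ (by positivity) (by norm_num)]
    linarith
  have hr0 : 0 < r := lt_of_lt_of_le (by positivity) hhr
  -- For large p the cones live in the covering simplices and ε = A₁/p² ≤ 1/2. For bounded p, ε need
  -- not be small and the inscribed ball of κ itself suffices.
  rcases le_or_gt (2 * A₁) ((p : ℝ) ^ 2) with hlarge | hsmall
  · refine ⟨A₁ / p ^ 2, ?_, ?_, ?_, ?_⟩
    · rwa [div_mul_cancel₀ _ hppos.ne']
    · rw [div_mul_cancel₀ _ hppos.ne']; linarith
    · refine le_trans ?_ (le_max_left _ _)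
      rw [div_le_iff₀ hppos]; linarith
    · intro x hx
      obtain ⟨i, hi⟩ := mem_iUnion.1 (hcov hx)
      obtain ⟨hdiam, hdist, hvol⟩ := hK i
      set Q : Set (Pt d) := (K i).closedInterior with hQ
      have hQc : IsCompact Q := (K i).isCompact_closedInterior
      have hQconv : Convex ℝ Q := by
        rw [hQ, ← Affine.Simplex.convexHull_eq_closedInterior]; exact convex_convexHull _ _
      have hQfr : (frontier Q).Nonempty := nonempty_frontier_iff.2 ⟨⟨x, hi⟩, hQc.ne_univ⟩
      -- The volume condition keeps the simplex from being small compared with κ, so its inscribed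
      -- ball has radius of order h.
      have hδ : a * r ≤ Metric.diam Q := by
        refine diam_ge_of_volume_ge hb hQc.isBounded hr0.le hball ha0.le (min_le_left _ _) ?_
        refine le_trans ?_ hvol
        gcongr
        exact min_le_right _ _
      have hδ0 : 0 < Metric.diam Q := lt_of_lt_of_le (by positivity) hδ
      have hinQ : 0 < inballDiam Q := by
        by_contra hneg
        push Not at hneg
        nlinarith
      obtain ⟨e, r₀, hr₀, hballQ⟩ := exists_ball_of_inballDiam_pos hinQ
      have hδr : Metric.diam Q ≤ 4 * Csh * r₀ := by
        calc _ ≤ Csh * inballDiam Q := hdiam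
          _ ≤ Csh * (4 * r₀) := by gcongr; linarith
          _ = _ := by ring
      have hr₀0 : 0 < r₀ := by
        by_contra hneg
        push Not at hneg
        nlinarith
      refine ⟨e, fun y hy s hs => ?_⟩
      have hρ : min (a / (32 * Cr * Csh)) (1 / (8 * Cr)) * h ≤ r₀ / 2 := by
        have h1 : a * (h / (4 * Cr)) ≤ 4 * Csh * r₀ :=
          le_trans (by gcongr) (hδ.trans hδr)
        calc _ ≤ a / (32 * Cr * Csh) * h := by gcongr; exact min_le_left _ _
          _ = (a * (h / (4 * Cr))) / (8 * Csh) := by field_simp; ring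
          _ ≤ (4 * Csh * r₀) / (8 * Csh) := by gcongr
          _ = _ := by field_simp; ring
      have hyball : Metric.ball y (r₀ / 2) ⊆ Q := by
        refine Subset.trans (Metric.ball_subset_ball' ?_) hballQ
        have := Metric.mem_ball.1 hy
        linarith
      have hs0 : 0 < s := lt_of_lt_of_le (by positivity) hs.1
      have hzball := Convex.ball_subset_of_ball_subset hQconv hi hyball hs0 hs.2
      by_contra hz
      have h1 := hdist _ (hzball (Metric.mem_ball_self (by positivity))) hz
      have h2 := le_infDist_frontier_of_ball_subset hQfr hzball
      have h3 : 8 * Cas * Csh / p ^ 2 ≤ s := by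
        refine le_trans ?_ hs.1
        gcongr
        exact le_max_left _ _
      have h4 : Cas * Metric.diam Q / p ^ 2 ≤ s * (r₀ / 2) := by
        calc _ ≤ Cas * (4 * Csh * r₀) / p ^ 2 := by gcongr
          _ = 8 * Cas * Csh / p ^ 2 * (r₀ / 2) := by ring
          _ ≤ _ := by gcongr
      linarith
  -- Here 1 − s ≤ 1/(8 C_r), so x + s(y−x) lies within r/2 of y and y lies within r/2 of the centre.
  -- The lower bound 1 ≤ ε₀p² uses ε₀ ≥ 3/4 and p ≥ 2.
  · refine ⟨ε₀, ?_, ?_, le_rfl, ?_⟩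
    · have h1 : (3 / 4 : ℝ) ≤ ε₀ := le_max_left _ _
      nlinarith
    · have h1 : ε₀ ≤ 1 :=
        max_le (by norm_num) (by linarith [show 0 < 1 / (8 * Cr) by positivity])
      nlinarith
    · intro x hx
      refine ⟨c, fun y hy s hs => hball ?_⟩
      have hρ : min (a / (32 * Cr * Csh)) (1 / (8 * Cr)) * h ≤ r / 2 := by
        calc _ ≤ 1 / (8 * Cr) * h := by gcongr; exact min_le_right _ _
          _ = (h / (4 * Cr)) / 2 := by field_simp; ring
          _ ≤ _ := by gcongr
      have hyc : dist y c < r / 2 := lt_of_lt_of_le (Metric.mem_ball.1 hy) hρ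
      have hyκ : y ∈ κ := hball (Metric.mem_ball.2 (by linarith))
      have hxy : dist x y ≤ h := Metric.dist_le_diam_of_mem hb hx hyκ
      have hs1 : 1 - s ≤ 1 / (8 * Cr) := by
        have := (le_max_right (3 / 4) (1 - 1 / (8 * Cr))).trans hs.1
        linarith
      have hz : dist (x + s • (y - x)) y = (1 - s) * dist x y := by
        rw [dist_eq_norm, dist_eq_norm, ← Real.norm_of_nonneg (sub_nonneg.2 hs.2), ← norm_smul]
        congr 1; module
      rw [Metric.mem_ball]
      calc _ ≤ dist (x + s • (y - x)) y + dist y c := dist_triangle _ _ _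
        _ < 1 / (8 * Cr) * h + r / 2 := by
          rw [hz]
          refine add_lt_add_of_le_of_lt ?_ hyc
          gcongr
        _ ≤ r / 2 + r / 2 := by
          gcongr
          calc _ = (h / (4 * Cr)) / 2 := by field_simp; ring
            _ ≤ _ := by gcongr
        _ = r := by ring

/-! ### Polynomials on lines and dilations of space -/

section Line

variable {d : ℕ}

/-- The restriction of a polynomial to the line through `x` and `y`. -/
def linePoly (q : MvPolynomial (Fin d) ℝ) (x y : Pt d) : Polynomial ℝ :=
  MvPolynomial.aeval (fun j => Polynomial.C (x j) + Polynomial.C (y j - x j) * Polynomial.X) q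

theorem linePoly_eval (q : MvPolynomial (Fin d) ℝ) (x y : Pt d) (s : ℝ) :
    (linePoly q x y).eval s = polyVal q (x + s • (y - x)) := by
  have h : ((Polynomial.aeval s).comp (MvPolynomial.aeval
      (fun j => Polynomial.C (x j) + Polynomial.C (y j - x j) * Polynomial.X))) q
      = MvPolynomial.aeval (fun j => x j + s * (y j - x j)) q := by
    congr 1
    ext j
    simp [mul_comm]
  rw [AlgHom.comp_apply, Polynomial.coe_aeval_eq_eval] at h
  rw [linePoly, h, polyVal, MvPolynomial.aeval_eq_eval]
  rfl

theorem natDegree_linePoly_le (q : MvPolynomial (Fin d) ℝ) (x y : Pt d) :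
    (linePoly q x y).natDegree ≤ q.totalDegree := by
  have h := MvPolynomial.aeval_natDegree_le q le_rfl
    (fun j => Polynomial.C (x j) + Polynomial.C (y j - x j) * Polynomial.X) (n := 1) fun j =>
      Polynomial.natDegree_add_le_of_degree_le (by simp)
        ((Polynomial.natDegree_C_mul_le _ _).trans (by simp))
  simpa [linePoly] using h

theorem linePoly_derivative_eval_zero (q : MvPolynomial (Fin d) ℝ) (x y : Pt d) :
    (Polynomial.derivative (linePoly q x y)).eval 0 = inner ℝ (polyGrad q x) (y - x) := by
  have hl : ∀ q, (linePoly q x y).eval 0 = MvPolynomial.eval (fun j => x j) q := by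
    intro q; rw [linePoly_eval]; simp [polyVal]
  have hg : ∀ q, (inner ℝ (polyGrad q x) (y - x) : ℝ)
      = ∑ j, MvPolynomial.eval (fun j => x j) (MvPolynomial.pderiv j q) * (y j - x j) := by
    intro q
    simp [PiLp.inner_apply, polyGrad, polyVal, mul_comm]
  rw [hg]
  induction q using MvPolynomial.induction_on with
  | C a => simp [linePoly]
  | add p q hp hq =>
    rw [linePoly, map_add, Polynomial.derivative_add, Polynomial.eval_add]
    rw [linePoly] at hp hq
    rw [hp, hq, ← Finset.sum_add_distrib]
    refine Finset.sum_congr rfl fun j _ => ?_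
    rw [map_add, map_add, add_mul]
  | mul_X p i hp =>
    have e : linePoly (p * MvPolynomial.X i) x y = linePoly p x y *
        (Polynomial.C (x i) + Polynomial.C (y i - x i) * Polynomial.X) := by
      simp [linePoly]
    rw [e, Polynomial.derivative_mul, Polynomial.eval_add, Polynomial.eval_mul, hp,
      Polynomial.eval_mul, hl]
    simp only [MvPolynomial.pderiv_mul, map_add, map_mul, add_mul, Finset.sum_add_distrib]
    simp [MvPolynomial.pderiv_X, Pi.single_apply, Finset.sum_mul, mul_right_comm, apply_ite]

theorem continuous_polyVal (q : MvPolynomial (Fin d) ℝ) : Continuous (polyVal q) := by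
  unfold polyVal
  exact (MvPolynomial.continuous_eval q).comp (by fun_prop)

theorem continuous_polyGrad (q : MvPolynomial (Fin d) ℝ) : Continuous (polyGrad q) := by
  unfold polyGrad
  have := fun j => continuous_polyVal (MvPolynomial.pderiv j q)
  fun_prop

/-- Moving the centre by ρ/2 along ±ξ, with the sign of ξ·(c−x), makes |ξ·(y−x)| at least ‖ξ‖ρ/2 −
‖ξ‖ρ/4 on the ball of radius ρ/4. With ξ = ∇q(x), derivatives along the segments towards this ball
control the full gradient. -/
theorem exists_ball_sq_inner_ge (ξ x c : Pt d) {ρ : ℝ} (hρ : 0 < ρ) :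
    ∃ c', Metric.ball c' (ρ / 4) ⊆ Metric.ball c ρ ∧
      ∀ y ∈ Metric.ball c' (ρ / 4), ‖ξ‖ ^ 2 * ρ ^ 2 / 16 ≤ inner ℝ ξ (y - x) ^ 2 := by
  rcases eq_or_ne ξ 0 with rfl | hξ
  · exact ⟨c, Metric.ball_subset_ball (by linarith), fun y _ => by simp⟩
  have hn : 0 < ‖ξ‖ := norm_pos_iff.2 hξ
  obtain ⟨σ, hσ, hσi⟩ : ∃ σ : ℝ, (σ = 1 ∨ σ = -1) ∧ 0 ≤ σ * inner ℝ ξ (c - x) := by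
    rcases le_total 0 (inner ℝ ξ (c - x)) with h | h
    · exact ⟨1, Or.inl rfl, by simpa using h⟩
    · exact ⟨-1, Or.inr rfl, by simpa using h⟩
  have hσσ : σ * σ = 1 := by rcases hσ with rfl | rfl <;> norm_num
  have hσa : |σ| = 1 := by rcases hσ with rfl | rfl <;> norm_num
  set v : Pt d := (σ * (ρ / 2) / ‖ξ‖) • ξ with hv
  have hvn : ‖v‖ = ρ / 2 := by
    rw [hv, norm_smul, Real.norm_eq_abs, abs_div, abs_mul, hσa, abs_norm,
      abs_of_pos (by positivity)]
    field_simp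
  refine ⟨c + v, Metric.ball_subset_ball' ?_, fun y hy => ?_⟩
  · rw [dist_self_add_left, hvn]; linarith
  · have e : (inner ℝ ξ (y - x) : ℝ) = inner ℝ ξ (c - x) + σ * (ρ / 2) * ‖ξ‖
        + inner ℝ ξ (y - (c + v)) := by
      have h1 : y - x = (c - x) + v + (y - (c + v)) := by abel
      rw [h1, inner_add_right, inner_add_right, hv, inner_smul_right, real_inner_self_eq_norm_sq]
      field_simp
    have h2 : |(inner ℝ ξ (y - (c + v)) : ℝ)| ≤ ‖ξ‖ * (ρ / 4) := by
      refine (abs_real_inner_le_norm _ _).trans ?_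
      rw [← dist_eq_norm]
      gcongr
      exact (Metric.mem_ball.1 hy).le
    have h3 : ‖ξ‖ * ρ / 4 ≤ σ * inner ℝ ξ (y - x) := by
      have h4 : |σ * (inner ℝ ξ (y - (c + v)) : ℝ)| ≤ ‖ξ‖ * (ρ / 4) := by
        rwa [abs_mul, hσa, one_mul]
      have h5 := (abs_le.1 h4).1
      have h6 : σ * inner ℝ ξ (y - x) = σ * inner ℝ ξ (c - x) + (σ * σ) * ((ρ / 2) * ‖ξ‖)
          + σ * inner ℝ ξ (y - (c + v)) := by rw [e]; ring
      rw [h6, hσσ]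
      linarith
    calc _ = (‖ξ‖ * ρ / 4) ^ 2 := by ring
      _ ≤ (σ * inner ℝ ξ (y - x)) ^ 2 := by gcongr
      _ = (σ * σ) * inner ℝ ξ (y - x) ^ 2 := by ring
      _ = _ := by rw [hσσ, one_mul]

theorem lintegral_comp_add_smul (Q : Pt d → ℝ≥0∞) (hQ : Measurable Q) (a : Pt d) {s : ℝ}
    (hs : 0 < s) :
    ∫⁻ y, Q (a + s • y) = (ENNReal.ofReal (s ^ d))⁻¹ * ∫⁻ y, Q y := by
  have h := Measure.map_addHaar_smul (volume : Measure (Pt d)) hs.ne'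
  have h2 : ∫⁻ y, Q (a + s • y) = ∫⁻ z, Q (a + z) ∂(Measure.map (s • ·) volume) := by
    rw [lintegral_map (by fun_prop) (by fun_prop)]
  rw [h2, h, lintegral_smul_measure, lintegral_add_left_eq_self, finrank_euclideanSpace_fin,
    abs_of_pos (by positivity), ENNReal.ofReal_inv_of_pos (by positivity), smul_eq_mul]

theorem lintegral_segment_right (Q : Pt d → ℝ≥0∞) (hQ : Measurable Q) (x : Pt d) {s : ℝ}
    (hs : 0 < s) :
    ∫⁻ y, Q (x + s • (y - x)) = (ENNReal.ofReal (s ^ d))⁻¹ * ∫⁻ y, Q y := by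
  rw [← lintegral_comp_add_smul Q hQ (x - s • x) hs]
  congr 1; ext y; congr 1; module

theorem lintegral_segment_left (Q : Pt d → ℝ≥0∞) (hQ : Measurable Q) (y : Pt d) {s : ℝ}
    (hs : s < 1) :
    ∫⁻ x, Q (x + s • (y - x)) = (ENNReal.ofReal ((1 - s) ^ d))⁻¹ * ∫⁻ y, Q y := by
  rw [← lintegral_comp_add_smul Q hQ (s • y) (sub_pos.2 hs)]
  congr 1; ext y; congr 1; module

end Line

/-! ### Averaging segment estimates over end points -/

section Averaging

variable {d : ℕ}

/-- The function `q ^ 2` on `κ`, extended by zero. -/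
def sqOn (κ : Set (Pt d)) (q : MvPolynomial (Fin d) ℝ) : Pt d → ℝ≥0∞ :=
  κ.indicator fun z => ENNReal.ofReal (polyVal q z ^ 2)

theorem measurable_sqOn {κ : Set (Pt d)} (hκ : MeasurableSet κ) (q : MvPolynomial (Fin d) ℝ) :
    Measurable (sqOn κ q) :=
  (by have := continuous_polyVal q; fun_prop :
    Measurable fun z => ENNReal.ofReal (polyVal q z ^ 2)).indicator hκ

theorem integrableOn_of_continuous {κ : Set (Pt d)} (hb : Bornology.IsBounded κ) {f : Pt d → ℝ}
    (hf : Continuous f) : IntegrableOn f κ :=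
  (hf.continuousOn.integrableOn_compact hb.isCompact_closure).mono_set subset_closure

theorem lintegral_sqOn {κ : Set (Pt d)} (hb : Bornology.IsBounded κ) (hκ : MeasurableSet κ)
    (q : MvPolynomial (Fin d) ℝ) :
    ∫⁻ z, sqOn κ q z = ENNReal.ofReal (∫ z in κ, polyVal q z ^ 2) := by
  have hc := continuous_polyVal q
  rw [ofReal_integral_eq_lintegral_ofReal (integrableOn_of_continuous hb (by fun_prop))
    (ae_of_all _ fun _ => sq_nonneg _)]
  exact lintegral_indicator hκ _

/-- The weight of the segment kernels. -/
def segWeight (d : ℕ) (r : Polynomial ℝ) (s : ℝ) : ℝ≥0∞ :=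
  ENNReal.ofReal ((1 - s) ^ d * r.eval s ^ 2)

theorem measurable_segWeight (r : Polynomial ℝ) : Measurable (segWeight d r) := by
  unfold segWeight; fun_prop

theorem measurable_segment_integrand {α : Type*} [MeasurableSpace α] {κ : Set (Pt d)}
    (hκ : MeasurableSet κ) (q : MvPolynomial (Fin d) ℝ) (r : Polynomial ℝ) {x y : α → Pt d}
    {s : α → ℝ} (hx : Measurable x) (hy : Measurable y) (hs : Measurable s) :
    Measurable fun z => segWeight d r (s z) * sqOn κ q (x z + s z • (y z - x z)) :=
  ((measurable_segWeight r).comp hs).mul ((measurable_sqOn hκ q).comp (by fun_prop))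

theorem ofReal_integral_segment {κ : Set (Pt d)} (q : MvPolynomial (Fin d) ℝ) (r : Polynomial ℝ)
    {ε : ℝ} (hε : ε ≤ 1) {x y : Pt d} (h : ∀ s ∈ Icc ε 1, x + s • (y - x) ∈ κ) :
    ENNReal.ofReal (∫ s in ε..1, (1 - s) ^ d * r.eval s ^ 2 * (linePoly q x y).eval s ^ 2)
      = ∫⁻ s in Ioc ε 1, segWeight d r s * sqOn κ q (x + s • (y - x)) := by
  rw [intervalIntegral.integral_of_le hε, ofReal_integral_eq_lintegral_ofReal]
  · refine setLIntegral_congr_fun measurableSet_Ioc fun s hs => ?_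
    have hs' : s ∈ Icc ε 1 := Ioc_subset_Icc_self hs
    simp only [segWeight, sqOn, indicator_of_mem (h s hs'), linePoly_eval]
    rw [← ENNReal.ofReal_mul]
    exact mul_nonneg (pow_nonneg (by linarith [hs.2]) _) (sq_nonneg _)
  · change IntegrableOn _ _ _
    rw [← intervalIntegrable_iff_integrableOn_Ioc_of_le hε]
    exact Continuous.intervalIntegrable (by fun_prop) _ _
  · refine (ae_restrict_iff' measurableSet_Ioc).2 (ae_of_all _ fun s hs => ?_)
    exact mul_nonneg (mul_nonneg (pow_nonneg (by linarith [hs.2]) _) (sq_nonneg _)) (sq_nonneg _)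

theorem lintegral_sq_eval {r : Polynomial ℝ} {ε : ℝ} (hε : ε ≤ 1) :
    ∫⁻ s in Ioc ε 1, ENNReal.ofReal (r.eval s ^ 2)
      = ENNReal.ofReal (∫ s in ε..1, r.eval s ^ 2) := by
  rw [intervalIntegral.integral_of_le hε, ofReal_integral_eq_lintegral_ofReal]
  · change IntegrableOn _ _ _
    rw [← intervalIntegrable_iff_integrableOn_Ioc_of_le hε]
    exact Continuous.intervalIntegrable (by fun_prop) _ _
  · exact ae_of_all _ fun _ => sq_nonneg _

/-- Averaging a segment estimate over a set of end points. -/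
theorem ofReal_mul_volume_le {κ : Set (Pt d)} (q : MvPolynomial (Fin d) ℝ) (r : Polynomial ℝ)
    {ε : ℝ} (hε : ε ≤ 1) {x : Pt d} {U : Set (Pt d)} (hU : MeasurableSet U)
    (h : ∀ y ∈ U, ∀ s ∈ Icc ε 1, x + s • (y - x) ∈ κ) {G L : ℝ} (hL : 0 ≤ L)
    (hG : ∀ y ∈ U, G ≤ L * ∫ s in ε..1, (1 - s) ^ d * r.eval s ^ 2 * (linePoly q x y).eval s ^ 2) :
    ENNReal.ofReal G * volume U ≤ ENNReal.ofReal L *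
      ∫⁻ y in U, ∫⁻ s in Ioc ε 1, segWeight d r s * sqOn κ q (x + s • (y - x)) := by
  rw [← setLIntegral_const, ← lintegral_const_mul' _ _ ENNReal.ofReal_ne_top]
  refine setLIntegral_mono' hU fun y hy => ?_
  rw [← ofReal_integral_segment q r hε (h y hy), ← ENNReal.ofReal_mul hL]
  exact ENNReal.ofReal_le_ofReal (hG y hy)

theorem segWeight_le (r : Polynomial ℝ) {s : ℝ} (hs0 : 0 ≤ s) (hs : s ≤ 1) :
    segWeight d r s ≤ ENNReal.ofReal (r.eval s ^ 2) :=
  ENNReal.ofReal_le_ofReal (mul_le_of_le_one_left (sq_nonneg _)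
    (pow_le_one₀ (by linarith) (by linarith)))

/-- With x fixed, the substitution in y costs s⁻ᵈ ≤ ε⁻ᵈ. This loss, of order p^{2d}, is the one in
the maximum norm bounds. -/
theorem lintegral_segment_le {κ : Set (Pt d)} (hb : Bornology.IsBounded κ) (hκ : MeasurableSet κ)
    (q : MvPolynomial (Fin d) ℝ) (r : Polynomial ℝ) {ε : ℝ} (hε0 : 0 < ε) (hε : ε ≤ 1) (x : Pt d)
    (U : Set (Pt d)) :
    ∫⁻ y in U, ∫⁻ s in Ioc ε 1, segWeight d r s * sqOn κ q (x + s • (y - x))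
      ≤ ENNReal.ofReal ((∫ s in ε..1, r.eval s ^ 2) * (ε ^ d)⁻¹ * ∫ z in κ, polyVal q z ^ 2) := by
  have hQ := measurable_sqOn hκ q
  have hr0 : 0 ≤ ∫ s in ε..1, r.eval s ^ 2 :=
    intervalIntegral.integral_nonneg hε fun _ _ => sq_nonneg _
  calc _ ≤ ∫⁻ y, ∫⁻ s in Ioc ε 1, segWeight d r s * sqOn κ q (x + s • (y - x)) :=
        setLIntegral_le_lintegral _ _
    _ = ∫⁻ s in Ioc ε 1, ∫⁻ y, segWeight d r s * sqOn κ q (x + s • (y - x)) := by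
        refine lintegral_lintegral_swap (Measurable.aemeasurable ?_)
        exact measurable_segment_integrand hκ q r measurable_const measurable_fst measurable_snd
    _ ≤ ∫⁻ s in Ioc ε 1, ENNReal.ofReal (r.eval s ^ 2) *
          ((ENNReal.ofReal (ε ^ d))⁻¹ * ∫⁻ z, sqOn κ q z) := by
        refine setLIntegral_mono' measurableSet_Ioc fun s hs => ?_
        have hs0 : 0 < s := hε0.trans hs.1
        rw [lintegral_const_mul' (segWeight d r s) _ ENNReal.ofReal_ne_top, lintegral_segment_right _ hQ x hs0]
        gcongr
        · exact segWeight_le r hs0.le hs.2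
        · exact hs.1.le
    _ = _ := by
        rw [lintegral_mul_const _ (by fun_prop), lintegral_sq_eval hε, lintegral_sqOn hb hκ,
          ← ENNReal.ofReal_inv_of_pos (by positivity), ← ENNReal.ofReal_mul (by positivity),
          ← ENNReal.ofReal_mul hr0, mul_assoc]

/-- With y fixed, the substitution in x costs (1−s)⁻ᵈ, which the weight cancels exactly. No power of
ε is lost, unlike in the pointwise bound. -/
theorem lintegral_lintegral_segment_le {κ : Set (Pt d)} (hb : Bornology.IsBounded κ)
    (hκ : MeasurableSet κ) (q : MvPolynomial (Fin d) ℝ) (r : Polynomial ℝ) {ε : ℝ}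
    (hε : ε ≤ 1) :
    ∫⁻ x, ∫⁻ y in κ, ∫⁻ s in Ioc ε 1, segWeight d r s * sqOn κ q (x + s • (y - x))
      ≤ ENNReal.ofReal ((∫ s in ε..1, r.eval s ^ 2) * (∫ z in κ, polyVal q z ^ 2)
          * volume.real κ) := by
  have hQ := measurable_sqOn hκ q
  have hr0 : 0 ≤ ∫ s in ε..1, r.eval s ^ 2 :=
    intervalIntegral.integral_nonneg hε fun _ _ => sq_nonneg _
  have hq0 : 0 ≤ ∫ z in κ, polyVal q z ^ 2 := integral_nonneg fun _ => sq_nonneg _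
  calc _ = ∫⁻ y in κ, ∫⁻ x, ∫⁻ s in Ioc ε 1, segWeight d r s * sqOn κ q (x + s • (y - x)) := by
        refine lintegral_lintegral_swap (Measurable.aemeasurable ?_)
        have hm : Measurable fun z : (Pt d × Pt d) × ℝ =>
            segWeight d r z.2 * sqOn κ q (z.1.1 + z.2 • (z.1.2 - z.1.1)) :=
          measurable_segment_integrand hκ q r (by fun_prop) (by fun_prop) measurable_snd
        exact hm.lintegral_prod_right'
    _ = ∫⁻ y in κ, ∫⁻ s in Ioc ε 1, ∫⁻ x, segWeight d r s * sqOn κ q (x + s • (y - x)) := by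
        refine lintegral_congr fun y => lintegral_lintegral_swap (Measurable.aemeasurable ?_)
        exact measurable_segment_integrand hκ q r measurable_fst measurable_const measurable_snd
    _ ≤ ∫⁻ y in κ, ∫⁻ s in Ioc ε 1, ENNReal.ofReal (r.eval s ^ 2) * ∫⁻ z, sqOn κ q z := by
        refine lintegral_mono fun y => ?_
        -- At s = 1 the map x ↦ x + s(y−x) collapses to a point; that parameter is a null set.
        rw [← setLIntegral_congr (Ioo_ae_eq_Ioc), ← setLIntegral_congr (Ioo_ae_eq_Ioc)]
        refine setLIntegral_mono' measurableSet_Ioo fun s hs => ?_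
        have hpos : 0 < (1 - s) ^ d := pow_pos (by linarith [hs.2]) d
        rw [lintegral_const_mul' (segWeight d r s) _ ENNReal.ofReal_ne_top, lintegral_segment_left _ hQ y hs.2, ← mul_assoc,
          segWeight, mul_comm ((1 - s) ^ d), ENNReal.ofReal_mul (sq_nonneg _), mul_assoc,
          mul_assoc, ← mul_assoc (ENNReal.ofReal ((1 - s) ^ d)), ENNReal.mul_inv_cancel
            (by simpa using hpos) ENNReal.ofReal_ne_top, one_mul]
    _ = _ := by
        rw [setLIntegral_const, lintegral_mul_const _ (by fun_prop), lintegral_sq_eval hε,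
          lintegral_sqOn hb hκ, ENNReal.ofReal_mul (by positivity), ENNReal.ofReal_mul hr0,
          ofReal_measureReal hb.measure_lt_top.ne]

end Averaging

/-- The inverse inequalities on elements with truncated cones: bounds of `q` and `∇q` in the
maximum norm, and of `∇q` in `L₂`, by the `L₂` norm of `q`. -/
theorem exists_inverse_inequalities (d : ℕ) [NeZero d] {c₀ A ε₀ : ℝ} (hc₀ : 0 < c₀)
    (hε₀ : ε₀ < 1) :
    ∃ K : ℝ, 0 < K ∧ ∀ (κ : Set (Pt d)) (p : ℕ) (ε : ℝ), Bornology.IsBounded κ → IsOpen κ →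
      κ.Nonempty → 1 ≤ p → 1 ≤ ε * p ^ 2 → ε * p ^ 2 ≤ A → ε ≤ ε₀ →
      HasTruncatedCones κ (c₀ * Metric.diam κ) ε →
      ∀ q : MvPolynomial (Fin d) ℝ, q.totalDegree ≤ p →
        (∀ x ∈ κ, volume.real κ * polyVal q x ^ 2 ≤
          K * p ^ (2 * d) * ∫ z in κ, polyVal q z ^ 2) ∧
        (∀ x ∈ κ, volume.real κ * ‖polyGrad q x‖ ^ 2 ≤
          K * p ^ (2 * d) * (p ^ 4 / Metric.diam κ ^ 2) * ∫ z in κ, polyVal q z ^ 2) ∧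
        ∫ x in κ, ‖polyGrad q x‖ ^ 2 ≤
          K * (p ^ 4 / Metric.diam κ ^ 2) * ∫ z in κ, polyVal q z ^ 2 := by
  obtain ⟨K, hK0, hK⟩ := exists_segment_kernel d A ε₀ hε₀
  set K₁ : ℝ := K ^ 2 / c₀ ^ d with hK₁
  set K₂ : ℝ := K ^ 2 * (16 * 4 ^ d) / c₀ ^ (d + 2) with hK₂
  have hK₁0 : 0 < K₁ := by positivity
  have hK₂0 : 0 < K₂ := by positivity
  refine ⟨K₁ + K₂, by positivity, ?_⟩
  intro κ p ε hb ho hne hp hεp hεA hε hcone q hq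
  have hκ := ho.measurableSet
  have hp1 : (1 : ℝ) ≤ p := by exact_mod_cast hp
  have hε0 : 0 < ε := by
    by_contra h
    push Not at h
    nlinarith [sq_nonneg (p : ℝ)]
  have hε1 : ε ≤ 1 := hε.trans hε₀.le
  obtain ⟨r, hr, hrI⟩ := hK p hp ε hε0.le hε hεA
  have hr0 : 0 ≤ ∫ s in ε..1, r.eval s ^ 2 :=
    intervalIntegral.integral_nonneg hε1 fun _ _ => sq_nonneg _
  set h : ℝ := Metric.diam κ with hh
  have hh0 : 0 < h := diam_pos_of_isOpen hb ho hne
  set ρ : ℝ := c₀ * h with hρ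
  have hρ0 : 0 < ρ := by positivity
  set N : ℝ := ∫ z in κ, polyVal q z ^ 2 with hN
  have hN0 : 0 ≤ N := integral_nonneg fun _ => sq_nonneg _
  set b : ℝ := volume.real (Metric.ball (0 : Pt d) 1) with hbdef
  have hb0 : 0 < b := volume_real_ball_zero_one_pos
  have hvol : volume.real κ ≤ h ^ d * b := volume_real_le_diam_pow hb
  have hvol0 : 0 ≤ volume.real κ := measureReal_nonneg
  have hdeg : ∀ x y, (linePoly q x y).natDegree ≤ p := fun x y =>
    (natDegree_linePoly_le q x y).trans hq
  have hball : ∀ (c : Pt d) {t : ℝ}, 0 ≤ t →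
      volume (Metric.ball c t) = ENNReal.ofReal (t ^ d * b) := by
    intro c t ht
    rw [hbdef, ← volume_real_ball_eq ht, ofReal_measureReal measure_ball_lt_top.ne]
  have hεd : (ε ^ d)⁻¹ ≤ p ^ (2 * d) := by
    rw [pow_mul, ← inv_pow]
    gcongr
    rw [inv_le_iff_one_le_mul₀ hε0]
    linarith
  -- Common form of both pointwise bounds: a segment estimate averaged over a ball of end points,
  -- with ε⁻ᵈ ≤ p^{2d} inserted. For values L ~ p² and for gradients L ~ p⁶; the kernel divides each
  -- by p².
  have hpoint : ∀ (x c : Pt d) (t G L : ℝ), 0 ≤ t → 0 ≤ L → 0 ≤ G →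
      (∀ y ∈ Metric.ball c t, ∀ s ∈ Icc ε 1, x + s • (y - x) ∈ κ) →
      (∀ y ∈ Metric.ball c t, G ≤ L * ∫ s in ε..1,
        (1 - s) ^ d * r.eval s ^ 2 * (linePoly q x y).eval s ^ 2) →
      G * (t ^ d * b) ≤ L * (K / p ^ 2 * p ^ (2 * d) * N) := by
    intro x c t G L ht hL hG0 hc hG
    have h1 := ofReal_mul_volume_le q r hε1 measurableSet_ball hc hL hG
    have h2 := h1.trans (mul_le_mul_right
      (lintegral_segment_le hb hκ q r hε0 hε1 x (Metric.ball c t)) _)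
    rw [hball c ht, ← ENNReal.ofReal_mul hG0, ← ENNReal.ofReal_mul hL] at h2
    rw [ENNReal.ofReal_le_ofReal_iff (by positivity)] at h2
    refine h2.trans ?_
    gcongr
  refine ⟨fun x hx => ?_, fun x hx => ?_, ?_⟩
  · obtain ⟨c, hc⟩ := hcone x hx
    have h1 := hpoint x c ρ (polyVal q x ^ 2) (K * p ^ 2) hρ0.le (by positivity) (sq_nonneg _) hc
      (fun y hy => by
        have := (hr _ (hdeg x y)).1
        rwa [linePoly_eval, zero_smul, add_zero] at this)
    calc _ ≤ (h ^ d * b) * polyVal q x ^ 2 := by gcongr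
      _ = (polyVal q x ^ 2 * (ρ ^ d * b)) / c₀ ^ d := by rw [hρ, mul_pow]; field_simp
      _ ≤ (K * p ^ 2 * (K / p ^ 2 * p ^ (2 * d) * N)) / c₀ ^ d := by gcongr
      _ = K₁ * p ^ (2 * d) * N := by rw [hK₁]; field_simp
      _ ≤ _ := by gcongr; linarith
  · obtain ⟨c, hc⟩ := hcone x hx
    obtain ⟨c', hc', hin⟩ := exists_ball_sq_inner_ge (polyGrad q x) x c hρ0
    have h1 := hpoint x c' (ρ / 4) (‖polyGrad q x‖ ^ 2 * ρ ^ 2 / 16) (K * p ^ 6) (by positivity)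
      (by positivity) (by positivity) (fun y hy => hc y (hc' hy))
      (fun y hy => by
        have := (hr _ (hdeg x y)).2
        rw [linePoly_derivative_eval_zero] at this
        exact (hin y hy).trans this)
    calc _ ≤ (h ^ d * b) * ‖polyGrad q x‖ ^ 2 := by gcongr
      _ = (‖polyGrad q x‖ ^ 2 * ρ ^ 2 / 16 * ((ρ / 4) ^ d * b))
          * (16 * 4 ^ d / (c₀ ^ (d + 2) * h ^ 2)) := by
        rw [hρ, div_pow, mul_pow, mul_pow, pow_add]; field_simp
      _ ≤ (K * p ^ 6 * (K / p ^ 2 * p ^ (2 * d) * N)) * (16 * 4 ^ d / (c₀ ^ (d + 2) * h ^ 2)) := by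
        gcongr
      _ = K₂ * p ^ (2 * d) * (p ^ 4 / h ^ 2) * N := by rw [hK₂]; field_simp
      _ ≤ _ := by gcongr; linarith
  -- The ball of end points depends on x, so it is enlarged to κ before integrating in x. The
  -- resulting factor |κ| is balanced by the volume of the ball, as both are bounded in terms of hᵈ.
  · have hx : ∀ x ∈ κ, ENNReal.ofReal (‖polyGrad q x‖ ^ 2) *
        ENNReal.ofReal (ρ ^ 2 / 16 * ((ρ / 4) ^ d * b)) ≤ ENNReal.ofReal (K * p ^ 6) *
        ∫⁻ y in κ, ∫⁻ s in Ioc ε 1, segWeight d r s * sqOn κ q (x + s • (y - x)) := by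
      intro x hx
      obtain ⟨c, hc⟩ := hcone x hx
      obtain ⟨c', hc', hin⟩ := exists_ball_sq_inner_ge (polyGrad q x) x c hρ0
      have h1 := ofReal_mul_volume_le (κ := κ) (G := ‖polyGrad q x‖ ^ 2 * ρ ^ 2 / 16)
        (L := K * p ^ 6) q r hε1 measurableSet_ball
        (fun y hy => hc y (hc' hy)) (by positivity) (fun y hy => by
          have := (hr _ (hdeg x y)).2
          rw [linePoly_derivative_eval_zero] at this
          exact (hin y hy).trans this)
      rw [hball c' (by positivity), ← ENNReal.ofReal_mul (by positivity)] at h1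
      rw [← ENNReal.ofReal_mul (by positivity)]
      calc _ = _ := by congr 1; ring
        _ ≤ _ := h1
        _ ≤ _ := by
          gcongr
          exact hc'.trans (HasTruncatedCones.ball_subset hε1 hc)
    have hgc := continuous_polyGrad q
    have hint : ENNReal.ofReal (∫ x in κ, ‖polyGrad q x‖ ^ 2) *
        ENNReal.ofReal (ρ ^ 2 / 16 * ((ρ / 4) ^ d * b)) ≤ ENNReal.ofReal (K * p ^ 6) *
        ENNReal.ofReal ((∫ s in ε..1, r.eval s ^ 2) * N * volume.real κ) := by
      rw [ofReal_integral_eq_lintegral_ofReal (integrableOn_of_continuous hb (by fun_prop))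
        (ae_of_all _ fun _ => sq_nonneg _), ← lintegral_mul_const' _ _ ENNReal.ofReal_ne_top]
      refine (setLIntegral_mono' hκ hx).trans ?_
      rw [lintegral_const_mul' _ _ ENNReal.ofReal_ne_top]
      gcongr
      exact (setLIntegral_le_lintegral _ _).trans
        (lintegral_lintegral_segment_le hb hκ q r hε1)
    have hG0 : 0 ≤ ∫ x in κ, ‖polyGrad q x‖ ^ 2 := integral_nonneg fun _ => sq_nonneg _
    rw [← ENNReal.ofReal_mul hG0, ← ENNReal.ofReal_mul (by positivity),
      ENNReal.ofReal_le_ofReal_iff (by positivity)] at hint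
    calc _ = (∫ x in κ, ‖polyGrad q x‖ ^ 2) * (ρ ^ 2 / 16 * ((ρ / 4) ^ d * b))
          * (16 * 4 ^ d / (ρ ^ (d + 2) * b)) := by
          rw [div_pow, pow_add]; field_simp
      _ ≤ (K * p ^ 6 * (K / p ^ 2 * N * (h ^ d * b))) * (16 * 4 ^ d / (ρ ^ (d + 2) * b)) := by
        refine mul_le_mul_of_nonneg_right (hint.trans ?_) (by positivity)
        gcongr
      _ = K₂ * (p ^ 4 / h ^ 2) * N := by
        rw [hK₂, hρ, mul_pow, pow_add h]; field_simp
      _ ≤ _ := by gcongr; linarith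

/-! ### Slicing a cone over a face, and the trace inequality on a simplex -/

section Cone

variable {d : ℕ}

/-- The component of F.points 0 − a orthogonal to the direction of the face is nonzero because a is
off its plane. Its normalisation is n and its length δ is the height of the cone. -/
theorem exists_unit_normal (F : Face d) {a : Pt d}
    (ha : a ∉ affineSpan ℝ (Set.range F.points)) :
    ∃ (n : Pt d) (δ : ℝ), ‖n‖ = 1 ∧ 0 < δ ∧
      ∀ y ∈ affineSpan ℝ (Set.range F.points), inner ℝ n (y - a) = δ := by
  set S := affineSpan ℝ (Set.range F.points) with hS
  have hp : F.points 0 ∈ S := mem_affineSpan ℝ (mem_range_self 0)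
  set w : Pt d := F.points 0 - a with hw
  obtain ⟨u, hu, v, hv, huv⟩ := Submodule.exists_add_mem_mem_orthogonal (K := S.direction) w
  have hv0 : v ≠ 0 := by
    rintro rfl
    rw [add_zero] at huv
    apply ha
    have h1 : -w ∈ S.direction := S.direction.neg_mem (huv ▸ hu)
    have h2 := AffineSubspace.vadd_mem_of_mem_direction h1 hp
    simpa [hw] using h2
  have hvn : 0 < ‖v‖ := norm_pos_iff.2 hv0
  refine ⟨‖v‖⁻¹ • v, ‖v‖, ?_, hvn, fun y hy => ?_⟩
  · rw [norm_smul, norm_inv, norm_norm, inv_mul_cancel₀ hvn.ne']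
  · have h1 : y - F.points 0 ∈ S.direction := AffineSubspace.vsub_mem_direction hy hp
    have h2 : y - a = (y - F.points 0) + (u + v) := by rw [← huv, hw]; abel
    have h3 : (inner ℝ v (y - F.points 0) : ℝ) = 0 :=
      Submodule.inner_left_of_mem_orthogonal h1 hv
    have h4 : (inner ℝ v u : ℝ) = 0 := Submodule.inner_left_of_mem_orthogonal hu hv
    rw [real_inner_smul_left, h2, inner_add_right, inner_add_right, h3, h4,
      real_inner_self_eq_norm_sq]
    field_simp
    ring

/-- Integration along the hyperplanes orthogonal to a unit vector. -/
theorem lintegral_eq_lintegral_hyperplane {n : Pt d} (hn : ‖n‖ = 1) (a : Pt d)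
    {g : Pt d → ℝ≥0∞} (hg : Measurable g) :
    ∫⁻ z, g z = ∫⁻ x : ℝ, ∫⁻ u : (Submodule.span ℝ {n})ᗮ, g (a + x • n + u) := by
  have h1 := (Submodule.span ℝ {n}).measurePreserving_measurableEquivProd a
  rw [InnerProductSpace.euclideanHausdorffMeasure_eq_volume] at h1
  rw [← h1.symm.lintegral_comp hg, Measure.volume_eq_prod, lintegral_prod _ (by fun_prop),
    ← (LinearIsometryEquiv.toSpanUnitSingleton (𝕜 := ℝ) n hn).measurePreserving.lintegral_comp_emb
      (LinearIsometryEquiv.toSpanUnitSingleton (𝕜 := ℝ) n hn).toHomeomorph.measurableEmbedding]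
  refine lintegral_congr fun x => lintegral_congr fun u => ?_
  congr 1
  rw [Submodule.measurableEquivProd_symm_apply]
  simp only [LinearIsometryEquiv.toSpanUnitSingleton_apply, vadd_eq_add]
  abel

theorem lintegral_real_comp_mul {f : ℝ → ℝ≥0∞} (hf : Measurable f) {δ : ℝ} (hδ : 0 < δ) :
    ∫⁻ x, f x = ENNReal.ofReal δ * ∫⁻ t, f (t * δ) := by
  have h := Real.map_volume_mul_right hδ.ne'
  have h2 := lintegral_map (μ := volume) hf (measurable_mul_const δ)
  rw [← h2, h, lintegral_smul_measure, smul_eq_mul, ← mul_assoc,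
    ← ENNReal.ofReal_mul hδ.le, abs_of_pos (by positivity), mul_inv_cancel₀ hδ.ne',
    ENNReal.ofReal_one, one_mul]

theorem lintegral_submodule_comp_smul (D : Submodule ℝ (Pt d)) {G : D → ℝ≥0∞} (hG : Measurable G)
    {t : ℝ} (ht : 0 < t) :
    ∫⁻ u, G u = ENNReal.ofReal (t ^ Module.finrank ℝ D) * ∫⁻ u, G (t • u) := by
  have h := Measure.map_addHaar_smul (volume : Measure D) ht.ne'
  have h2 := lintegral_map (μ := volume) hG (measurable_const_smul t)
  rw [← h2, h, lintegral_smul_measure, smul_eq_mul, ← mul_assoc,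
    ← ENNReal.ofReal_mul (by positivity), abs_of_pos (by positivity),
    mul_inv_cancel₀ (by positivity), ENNReal.ofReal_one, one_mul]

theorem finrank_orthogonal_unit [NeZero d] {n : Pt d} (hn : ‖n‖ = 1) :
    Module.finrank ℝ (Submodule.span ℝ {n})ᗮ = d - 1 := by
  have h1 := (Submodule.span ℝ {n}).finrank_add_finrank_orthogonal
  rw [finrank_span_singleton (by rintro rfl; simp at hn), finrank_euclideanSpace_fin] at h1
  omega

theorem Face.measurableSet_interior (hd : 2 ≤ d) (F : Face d) : MeasurableSet F.interior := by
  have : NeZero (d - 1) := ⟨by omega⟩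
  rw [← sdiff_sdiff_cancel_left F.interior_subset_closedInterior, F.closedInterior_sdiff_interior]
  exact F.isClosed_closedInterior.measurableSet.diff
    (MeasurableSet.iUnion fun i => (F.faceOpposite i).isClosed_closedInterior.measurableSet)

/-- The parametrization of a hyperplane over its direction. -/
def planeMap (b : Pt d) (D : Submodule ℝ (Pt d)) : D →ᵃ[ℝ] Pt d :=
  D.subtype.toAffineMap + AffineMap.const ℝ D b

theorem planeMap_apply (b : Pt d) (D : Submodule ℝ (Pt d)) (u : D) : planeMap b D u = b + u := by
  simp [planeMap, add_comm]

theorem isometry_planeMap (b : Pt d) (D : Submodule ℝ (Pt d)) : Isometry (planeMap b D) := by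
  refine Isometry.of_dist_eq fun u v => ?_
  rw [planeMap_apply, planeMap_apply, dist_add_left]; rfl

/-- Normalised Hausdorff measure is preserved by isometries and equals Lebesgue measure on a
(d−1)-dimensional inner product space, so face integrals become integrals over D. -/
theorem faceMeasure_eq_map {F : Face d} {b : Pt d} {D : Submodule ℝ (Pt d)}
    (hD : Module.finrank ℝ D = d - 1) (hF : F.interior ⊆ Set.range (planeMap b D)) :
    faceMeasure F = (volume.restrict (planeMap b D ⁻¹' F.interior)).map (planeMap b D) := by
  have hψ := isometry_planeMap b D
  rw [← hψ.isClosedEmbedding.measurableEmbedding.restrict_map,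
    ← InnerProductSpace.euclideanHausdorffMeasure_eq_volume, hD, hψ.map_euclideanHausdorffMeasure,
    Measure.restrict_restrict_of_subset hF, faceMeasure]

/-- The relative boundary of the simplex lies in the affine spans of its facets. Each is a proper
subspace of the plane, since by affine independence it misses the opposite vertex. -/
theorem volume_preimage_closedInterior (hd : 2 ≤ d) {F : Face d} {b : Pt d}
    {D : Submodule ℝ (Pt d)} (hF : F.closedInterior ⊆ Set.range (planeMap b D)) :
    volume (planeMap b D ⁻¹' F.closedInterior) = volume (planeMap b D ⁻¹' F.interior) := by
  have : NeZero (d - 1) := ⟨by omega⟩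
  refine le_antisymm ?_ (measure_mono (preimage_mono F.interior_subset_closedInterior))
  rw [F.closedInterior_eq_interior_union, preimage_union, preimage_iUnion]
  refine (measure_union_le _ _).trans_eq ?_
  rw [measure_iUnion_null, add_zero]
  intro i
  refine measure_mono_null (preimage_mono (F.faceOpposite i).closedInterior_subset_affineSpan) ?_
  have h := Measure.addHaar_affineSubspace (volume : Measure D)
    ((affineSpan ℝ (Set.range (F.faceOpposite i).points)).comap (planeMap b D)) (by
      intro htop
      obtain ⟨u, hu⟩ := hF (F.point_mem_closedInterior i)
      have h1 : u ∈ (affineSpan ℝ (Set.range (F.faceOpposite i).points)).comap (planeMap b D) := by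
        rw [htop]; trivial
      rw [AffineSubspace.mem_comap, hu, Affine.Simplex.range_faceOpposite_points,
        F.independent.mem_affineSpan_iff] at h1
      simp at h1)
  simpa using h

theorem mem_cone_of_mem {s : Set (Pt d)} {a y : Pt d} (hy : y ∈ s) {t : ℝ} (ht0 : 0 ≤ t)
    (ht1 : t ≤ 1) : a + t • (y - a) ∈ convexHull ℝ (insert a s) := by
  have h := (convex_convexHull ℝ (insert a s)) (subset_convexHull ℝ _ (mem_insert a s))
    (subset_convexHull ℝ _ (mem_insert_of_mem a hy)) (sub_nonneg.2 ht1) ht0 (by ring)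
  convert h using 1
  module

theorem Face.convex_closedInterior (F : Face d) : Convex ℝ F.closedInterior := by
  rw [← Affine.Simplex.convexHull_eq_closedInterior]; exact convex_convexHull _ _

theorem exists_of_mem_cone {F : Face d} {a z : Pt d}
    (hz : z ∈ convexHull ℝ (insert a F.closedInterior)) :
    ∃ y ∈ F.closedInterior, ∃ t : ℝ, 0 ≤ t ∧ t ≤ 1 ∧ z = a + t • (y - a) := by
  rw [convexHull_insert F.nonempty_closedInterior, (Face.convex_closedInterior F).convexHull_eq,
    mem_convexJoin] at hz
  obtain ⟨x, rfl, y, hy, h⟩ := hz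
  rw [segment_eq_image'] at h
  obtain ⟨t, ht, rfl⟩ := h
  exact ⟨y, hy, t, ht.1, ht.2, rfl⟩

theorem isCompact_cone (F : Face d) (a : Pt d) :
    IsCompact (convexHull ℝ (insert a F.closedInterior)) := by
  have h : convexHull ℝ (insert a F.closedInterior)
      = (fun z : ℝ × Pt d => a + z.1 • (z.2 - a)) '' (Icc (0 : ℝ) 1 ×ˢ F.closedInterior) := by
    ext z
    constructor
    · intro hz
      obtain ⟨y, hy, t, h0, h1, rfl⟩ := exists_of_mem_cone hz
      exact ⟨(t, y), ⟨⟨h0, h1⟩, hy⟩, rfl⟩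
    · rintro ⟨⟨t, y⟩, ⟨ht, hy⟩, rfl⟩
      exact mem_cone_of_mem hy ht.1 ht.2
  rw [h]
  exact (isCompact_Icc.prod F.isCompact_closedInterior).image (by fun_prop)

/-- Integration over a hyperplane fibration, in coordinates adapted to cones with apex `a`. -/
theorem lintegral_eq_lintegral_cone [NeZero d] {n : Pt d} (hn : ‖n‖ = 1) (a : Pt d) {δ : ℝ}
    (hδ : 0 < δ) {g : Pt d → ℝ≥0∞} (hg : Measurable g) :
    ∫⁻ z, g z = ENNReal.ofReal δ * ∫⁻ t : ℝ, ∫⁻ u : (Submodule.span ℝ {n})ᗮ,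
      g (a + (t * δ) • n + u) := by
  rw [lintegral_eq_lintegral_hyperplane hn a hg]
  refine lintegral_real_comp_mul (f := fun x => ∫⁻ u : (Submodule.span ℝ {n})ᗮ,
      g (a + x • n + u)) ?_ hδ
  have : Measurable fun z : ℝ × (Submodule.span ℝ {n})ᗮ => g (a + z.1 • n + z.2) := by fun_prop
  exact this.lintegral_prod_right'

theorem lintegral_slice_eq [NeZero d] {n : Pt d} (hn : ‖n‖ = 1) (a : Pt d) (δ : ℝ) {t : ℝ}
    (ht : 0 < t) {g : Pt d → ℝ≥0∞} (hg : Measurable g) :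
    ∫⁻ u : (Submodule.span ℝ {n})ᗮ, g (a + (t * δ) • n + u) = ENNReal.ofReal (t ^ (d - 1)) *
      ∫⁻ u : (Submodule.span ℝ {n})ᗮ,
        g (a + t • (planeMap (a + δ • n) (Submodule.span ℝ {n})ᗮ u - a)) := by
  rw [lintegral_submodule_comp_smul _ (by fun_prop) ht, finrank_orthogonal_unit hn]
  congr 1
  refine lintegral_congr fun u => ?_
  congr 1
  rw [planeMap_apply, Submodule.coe_smul]
  module

/-- The trace inverse inequality on a simplex with face `F`. -/
theorem volume_cone_mul_integral_face_le (hd : 2 ≤ d) {κ : Set (Pt d)} (F : Face d) {a : Pt d}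
    (ha : a ∉ affineSpan ℝ (Set.range F.points))
    (hsub : interior (convexHull ℝ (insert a F.closedInterior)) ⊆ κ) {p : ℕ}
    (q : MvPolynomial (Fin d) ℝ) (hq : q.totalDegree ≤ p) :
    volume (convexHull ℝ (insert a F.closedInterior)) *
        ∫⁻ x, ENNReal.ofReal (polyVal q x ^ 2) ∂(faceMeasure F)
      ≤ ENNReal.ofReal ((p + d) ^ 2) * faceMeasure F univ *
        ∫⁻ x in κ, ENNReal.ofReal (polyVal q x ^ 2) := by
  have : NeZero d := ⟨by omega⟩
  obtain ⟨n, δ, hn, hδ, hnδ⟩ := exists_unit_normal F ha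
  set D := (Submodule.span ℝ {n})ᗮ with hD
  set ψ := planeMap (a + δ • n) D with hψ
  have hψc : Continuous ψ := (isometry_planeMap _ _).continuous
  have hψn : ∀ u : D, inner ℝ n (ψ u - a) = δ := by
    intro u
    have h1 : (inner ℝ n (u : Pt d) : ℝ) = 0 :=
      Submodule.inner_right_of_mem_orthogonal (Submodule.mem_span_singleton_self n) u.2
    rw [hψ, planeMap_apply, show a + δ • n + (u : Pt d) - a = δ • n + u by abel, inner_add_right,
      h1, inner_smul_right, real_inner_self_eq_norm_sq, hn]
    ring
  have hrange : F.closedInterior ⊆ Set.range ψ := by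
    intro y hy
    have h1 := hnδ y (F.closedInterior_subset_affineSpan hy)
    refine ⟨⟨y - (a + δ • n), ?_⟩, ?_⟩
    · rw [hD, Submodule.mem_orthogonal_singleton_iff_inner_right, ← sub_sub, inner_sub_right, h1,
        inner_smul_right, real_inner_self_eq_norm_sq, hn]
      ring
    · rw [hψ, planeMap_apply]; simp
  have hrange' : F.interior ⊆ Set.range ψ := F.interior_subset_closedInterior.trans hrange
  have hmap := faceMeasure_eq_map (finrank_orthogonal_unit hn) hrange'
  have hFm := Face.measurableSet_interior hd F
  set F' : Set D := ψ ⁻¹' F.interior with hF'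
  have hF'm : MeasurableSet F' := hψc.measurable hFm
  set H := convexHull ℝ (insert a F.closedInterior) with hH
  have hHm : MeasurableSet H := (isCompact_cone F a).isClosed.measurableSet
  have hqc := continuous_polyVal q
  have hg0 : Measurable fun z => ENNReal.ofReal (polyVal q z ^ 2) := by fun_prop
  have hface : ∫⁻ x, ENNReal.ofReal (polyVal q x ^ 2) ∂(faceMeasure F)
      = ∫⁻ u in F', ENNReal.ofReal (polyVal q (ψ u) ^ 2) := by
    rw [hmap, lintegral_map hg0 hψc.measurable]
  have harea : faceMeasure F univ = volume F' := by
    rw [hmap, Measure.map_apply hψc.measurable MeasurableSet.univ]; simp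
  -- The exact volume has an extra factor 1/d; each slice is simply compared with the full face,
  -- which is enough.
  have hvol : volume H ≤ ENNReal.ofReal δ * faceMeasure F univ := by
    rw [harea, hF', ← volume_preimage_closedInterior hd hrange, ← lintegral_indicator_one hHm,
      lintegral_eq_lintegral_cone hn a hδ (measurable_one.indicator hHm)]
    gcongr
    calc _ ≤ ∫⁻ t : ℝ, (Icc (0 : ℝ) 1).indicator
            (fun _ => volume (ψ ⁻¹' F.closedInterior)) t := by
          refine lintegral_mono_ae ?_
          filter_upwards [Measure.ae_ne volume (0 : ℝ)] with t ht0
          have hlevel : ∀ z ∈ H, inner ℝ n (z - a) = t * δ → ∃ y ∈ F.closedInterior,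
              0 < t ∧ t ≤ 1 ∧ z = a + t • (y - a) := by
            intro z hz hzt
            obtain ⟨y, hy, s, hs0, hs1, rfl⟩ := exists_of_mem_cone hz
            rw [add_sub_cancel_left, inner_smul_right,
              hnδ y (F.closedInterior_subset_affineSpan hy)] at hzt
            obtain rfl := mul_right_cancel₀ hδ.ne' hzt
            exact ⟨y, hy, lt_of_le_of_ne hs0 (Ne.symm ht0), hs1, rfl⟩
          by_cases htI : t ∈ Ioc (0 : ℝ) 1
          · rw [indicator_of_mem (Ioc_subset_Icc_self htI),
              lintegral_slice_eq hn a δ htI.1 (measurable_one.indicator hHm)]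
            calc _ ≤ 1 * ∫⁻ u : D, (ψ ⁻¹' F.closedInterior).indicator 1 u := by
                  refine mul_le_mul' ?_ (lintegral_mono fun u => ?_)
                  · rw [← ENNReal.ofReal_one]
                    exact ENNReal.ofReal_le_ofReal (pow_le_one₀ htI.1.le htI.2)
                  · by_cases hz : a + t • (ψ u - a) ∈ H
                    · obtain ⟨y, hy, _, _, he⟩ := hlevel _ hz (by
                        rw [add_sub_cancel_left, inner_smul_right, hψn])
                      have h1 := smul_right_injective _ ht0 (add_left_cancel he)
                      have h2 : ψ u = y := sub_left_injective h1
                      have h3 : u ∈ ψ ⁻¹' F.closedInterior := by rw [mem_preimage, h2]; exact hy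
                      rw [indicator_of_mem h3]
                      exact indicator_le_self _ _ _
                    · rw [indicator_of_notMem hz]; exact zero_le
              _ = _ := by
                  rw [one_mul, lintegral_indicator_one
                    (F.isClosed_closedInterior.preimage hψc).measurableSet]
          · have hz : ∀ u : D, H.indicator (1 : Pt d → ℝ≥0∞) (a + (t * δ) • n + u) = 0 := by
              intro u
              refine indicator_of_notMem (fun hu => ?_) _
              obtain ⟨y, _, h0, h1, _⟩ := hlevel _ hu (by
                have h1 : (inner ℝ n (u : Pt d) : ℝ) = 0 :=
                  Submodule.inner_right_of_mem_orthogonal (Submodule.mem_span_singleton_self n) u.2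
                rw [add_assoc, add_sub_cancel_left, inner_add_right, h1, inner_smul_right,
                  real_inner_self_eq_norm_sq, hn]
                ring)
              exact htI ⟨h0, h1⟩
            simp [hz]
      _ = _ := by
          rw [lintegral_indicator measurableSet_Icc, setLIntegral_const]; simp [hψ]
  -- On each ray from a to the face the weighted end point inequality with m = d − 1 applies, and
  -- t^{d−1} is precisely the Jacobian of the slice at relative height t.
  have htrace : ENNReal.ofReal δ * ∫⁻ x, ENNReal.ofReal (polyVal q x ^ 2) ∂(faceMeasure F)
      ≤ ENNReal.ofReal ((p + d) ^ 2) * ∫⁻ x in κ, ENNReal.ofReal (polyVal q x ^ 2) := by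
    have hκH : ∫⁻ x, H.indicator (fun z => ENNReal.ofReal (polyVal q z ^ 2)) x
        ≤ ∫⁻ x in κ, ENNReal.ofReal (polyVal q x ^ 2) := by
      rw [lintegral_indicator hHm, ← setLIntegral_congr
        ((convex_convexHull ℝ _).addHaar_frontier volume |> interior_ae_eq_of_null_frontier)]
      exact lintegral_mono_set hsub
    refine le_trans ?_ (mul_le_mul_right hκH _)
    have hgm : Measurable (H.indicator fun z => ENNReal.ofReal (polyVal q z ^ 2)) :=
      hg0.indicator hHm
    rw [lintegral_eq_lintegral_cone hn a hδ hgm, mul_left_comm, hface]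
    gcongr
    have hmeas : Measurable fun z : ℝ × D => ENNReal.ofReal (z.1 ^ (d - 1)) *
        ENNReal.ofReal (polyVal q (a + z.1 • (ψ z.2 - a)) ^ 2) := by
      have := hψc.measurable
      have h2 : Measurable fun z : ℝ × D => polyVal q (a + z.1 • (ψ z.2 - a)) :=
        hqc.measurable.comp (by fun_prop)
      fun_prop
    calc ∫⁻ u in F', ENNReal.ofReal (polyVal q (ψ u) ^ 2)
        ≤ ∫⁻ u in F', ENNReal.ofReal ((p + d) ^ 2) * ∫⁻ t in Ioc (0 : ℝ) 1,
            ENNReal.ofReal (t ^ (d - 1)) *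
              ENNReal.ofReal (polyVal q (a + t • (ψ u - a)) ^ 2) := by
          refine lintegral_mono fun u => ?_
          have h1 := sq_eval_one_le (d - 1) p (linePoly q a (ψ u))
            ((natDegree_linePoly_le _ _ _).trans hq)
          have e : ((p : ℝ) + (d - 1 : ℕ) + 1) = p + d := by
            rw [Nat.cast_sub (by omega)]; push_cast; ring
          rw [e, linePoly_eval, one_smul, add_sub_cancel] at h1
          refine (ENNReal.ofReal_le_ofReal h1).trans_eq ?_
          rw [ENNReal.ofReal_mul (by positivity), intervalIntegral.integral_of_le zero_le_one,
            ofReal_integral_eq_lintegral_ofReal]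
          · congr 1
            refine setLIntegral_congr_fun measurableSet_Ioc fun t ht => ?_
            simp only [linePoly_eval]
            rw [ENNReal.ofReal_mul (pow_nonneg ht.1.le _)]
          · change IntegrableOn _ _ _
            rw [← intervalIntegrable_iff_integrableOn_Ioc_of_le zero_le_one]
            exact Continuous.intervalIntegrable (by fun_prop) _ _
          · refine (ae_restrict_iff' measurableSet_Ioc).2 (ae_of_all _ fun t ht => ?_)
            exact mul_nonneg (pow_nonneg ht.1.le _) (sq_nonneg _)
      _ = ENNReal.ofReal ((p + d) ^ 2) * ∫⁻ t in Ioc (0 : ℝ) 1, ∫⁻ u in F',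
            ENNReal.ofReal (t ^ (d - 1)) *
              ENNReal.ofReal (polyVal q (a + t • (ψ u - a)) ^ 2) := by
          rw [lintegral_const_mul' _ _ ENNReal.ofReal_ne_top, lintegral_lintegral_swap]
          exact (hmeas.comp measurable_swap).aemeasurable
      _ ≤ ENNReal.ofReal ((p + d) ^ 2) * ∫⁻ t : ℝ, ∫⁻ u : D,
            H.indicator (fun z => ENNReal.ofReal (polyVal q z ^ 2)) (a + (t * δ) • n + u) := by
          refine mul_le_mul_right (le_trans ?_ (setLIntegral_le_lintegral (Ioc (0 : ℝ) 1) _)) _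
          refine setLIntegral_mono' measurableSet_Ioc fun t ht => ?_
          rw [lintegral_slice_eq hn a δ ht.1 hgm,
            lintegral_const_mul' _ _ ENNReal.ofReal_ne_top]
          refine mul_le_mul_right (le_trans ?_ (setLIntegral_le_lintegral F' _)) _
          refine setLIntegral_mono' hF'm fun u hu => ?_
          rw [indicator_of_mem]
          exact mem_cone_of_mem (F.interior_subset_closedInterior hu) ht.1.le ht.2
  calc _ ≤ (ENNReal.ofReal δ * faceMeasure F univ) *
        ∫⁻ x, ENNReal.ofReal (polyVal q x ^ 2) ∂(faceMeasure F) := by gcongr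
    _ = faceMeasure F univ *
        (ENNReal.ofReal δ * ∫⁻ x, ENNReal.ofReal (polyVal q x ^ 2) ∂(faceMeasure F)) := by ring
    _ ≤ faceMeasure F univ * (ENNReal.ofReal ((p + d) ^ 2) *
        ∫⁻ x in κ, ENNReal.ofReal (polyVal q x ^ 2)) := by gcongr
    _ = _ := by ring

end Cone

/-! ### Inverse inequalities on a face with the constant C_INV -/

theorem IsOpenPolytope.isBounded {d : ℕ} {s : Set (Pt d)} (hs : IsOpenPolytope s) :
    Bornology.IsBounded s := by
  obtain ⟨_, _, _, m, T, hT⟩ := hs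
  refine Bornology.IsBounded.subset ?_ (subset_closure (s := s))
  rw [hT]
  exact Bornology.isBounded_iUnion.2 fun j => (T j).isCompact_closedInterior.isBounded

theorem totalDegree_pderiv_le {d : ℕ} (j : Fin d) (q : MvPolynomial (Fin d) ℝ) :
    (MvPolynomial.pderiv j q).totalDegree ≤ q.totalDegree := by
  rw [q.as_sum, map_sum]
  refine MvPolynomial.totalDegree_finsetSum_le fun m hm => ?_
  rw [← q.as_sum, MvPolynomial.pderiv_monomial]
  refine (MvPolynomial.totalDegree_monomial_le _ _).trans ?_
  refine le_trans ?_ (MvPolynomial.le_totalDegree hm)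
  exact Finsupp.degree_mono tsub_le_self

theorem isFiniteMeasure_faceMeasure {d : ℕ} (F : Face d) (hd : 2 ≤ d) :
    IsFiniteMeasure (faceMeasure F) := by
  have : NeZero d := ⟨by omega⟩
  set S := affineSpan ℝ (Set.range F.points) with hS
  have hp : F.points 0 ∈ S := mem_affineSpan ℝ (mem_range_self 0)
  have hD : Module.finrank ℝ S.direction = d - 1 := by
    rw [hS, direction_affineSpan]
    exact F.independent.finrank_vectorSpan (by simp)
  have hF : F.interior ⊆ Set.range (planeMap (F.points 0) S.direction) := by
    intro y hy
    have h1 := F.closedInterior_subset_affineSpan (F.interior_subset_closedInterior hy)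
    exact ⟨⟨y - F.points 0, AffineSubspace.vsub_mem_direction h1 hp⟩, by
      rw [planeMap_apply]; simp⟩
  rw [faceMeasure_eq_map hD hF]
  have hb : Bornology.IsBounded (planeMap (F.points 0) S.direction ⁻¹' F.interior) :=
    (isometry_planeMap _ _).antilipschitz.isBounded_preimage
      (F.isCompact_closedInterior.isBounded.subset F.interior_subset_closedInterior)
  have : IsFiniteMeasure
      (volume.restrict (planeMap (F.points 0) S.direction ⁻¹' F.interior)) :=
    ⟨by rw [Measure.restrict_apply_univ]; exact hb.measure_lt_top⟩
  infer_instance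

theorem ae_mem_interior {d : ℕ} (hd : 2 ≤ d) (F : Face d) :
    ∀ᵐ x ∂(faceMeasure F), x ∈ F.interior :=
  ae_restrict_mem (Face.measurableSet_interior hd F)

theorem memLp_faceMeasure_of_continuous {d : ℕ} (hd : 2 ≤ d) (F : Face d) {E : Type*}
    [NormedAddCommGroup E] [SecondCountableTopology E] {f : Pt d → E}
    (hf : Continuous f) (p : ℝ≥0∞) : MemLp f p (faceMeasure F) := by
  have := isFiniteMeasure_faceMeasure F hd
  obtain ⟨C, hC⟩ := F.isCompact_closedInterior.exists_bound_of_continuousOn hf.continuousOn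
  borelize E
  refine MemLp.of_bound hf.aestronglyMeasurable C ?_
  filter_upwards [ae_mem_interior hd F] with x hx
  exact hC x (F.interior_subset_closedInterior hx)

theorem integrable_faceMeasure_of_continuous {d : ℕ} (hd : 2 ≤ d) (F : Face d) {f : Pt d → ℝ}
    (hf : Continuous f) : Integrable f (faceMeasure F) :=
  memLp_one_iff_integrable.1 (memLp_faceMeasure_of_continuous hd F hf 1)

theorem norm_polyGrad_sq {d : ℕ} (q : MvPolynomial (Fin d) ℝ) (x : Pt d) :
    ‖polyGrad q x‖ ^ 2 = ∑ j, polyVal (MvPolynomial.pderiv j q) x ^ 2 := by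
  rw [EuclideanSpace.norm_sq_eq]
  simp [polyGrad]

theorem supFlatVolume_le {d : ℕ} (κ : Set (Pt d)) (F : Face d) :
    supFlatVolume κ F ≤ volume κ := by
  refine iSup_le fun a => iSup_le fun _ => iSup_le fun h => ?_
  rw [← measure_interior_of_null_frontier ((convex_convexHull ℝ _).addHaar_frontier volume)]
  exact measure_mono h

/-- Only the left side of the cone inequality involves the apex, so the supremum over apices may be
taken there. Without an admissible simplex it is 0. -/
theorem supFlatVolume_mul_integral_face_le {d : ℕ} (hd : 2 ≤ d) {κ : Set (Pt d)}
    (hb : Bornology.IsBounded κ) (F : Face d) {p : ℕ} (q : MvPolynomial (Fin d) ℝ)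
    (hq : q.totalDegree ≤ p) :
    (supFlatVolume κ F).toReal * ∫ x, polyVal q x ^ 2 ∂(faceMeasure F)
      ≤ (p + d) ^ 2 * faceArea F * ∫ x in κ, polyVal q x ^ 2 := by
  have := isFiniteMeasure_faceMeasure F hd
  have hc := continuous_polyVal q
  have h : supFlatVolume κ F * ∫⁻ x, ENNReal.ofReal (polyVal q x ^ 2) ∂(faceMeasure F)
      ≤ ENNReal.ofReal ((p + d) ^ 2) * faceMeasure F univ *
        ∫⁻ x in κ, ENNReal.ofReal (polyVal q x ^ 2) := by
    rw [supFlatVolume, ENNReal.iSup_mul]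
    refine iSup_le fun a => ?_
    rw [ENNReal.iSup_mul]
    refine iSup_le fun ha => ?_
    rw [ENNReal.iSup_mul]
    exact iSup_le fun hsub => volume_cone_mul_integral_face_le hd F ha hsub q hq
  rw [← ofReal_integral_eq_lintegral_ofReal
      (integrable_faceMeasure_of_continuous hd F (by fun_prop)) (ae_of_all _ fun _ => sq_nonneg _),
    ← ofReal_integral_eq_lintegral_ofReal (integrableOn_of_continuous hb (by fun_prop))
      (ae_of_all _ fun _ => sq_nonneg _)] at h
  have h2 := ENNReal.toReal_mono (by
    exact ENNReal.mul_ne_top (ENNReal.mul_ne_top ENNReal.ofReal_ne_top (measure_ne_top _ _))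
      ENNReal.ofReal_ne_top) h
  rw [ENNReal.toReal_mul, ENNReal.toReal_mul, ENNReal.toReal_mul,
    ENNReal.toReal_ofReal (integral_nonneg fun _ => sq_nonneg _),
    ENNReal.toReal_ofReal (integral_nonneg fun _ => sq_nonneg _),
    ENNReal.toReal_ofReal (by positivity)] at h2
  exact h2

/-- Combines the two alternatives into the minimum. When S = 0 the quotient is ∞ and the minimum is
P, so the conversion to a real number does not replace it by a spurious 0. -/
theorem le_toReal_min_mul {v S P : ℝ≥0∞} (hv0 : v ≠ 0) (hS : S ≠ ⊤) {x y : ℝ}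
    (h1 : x ≤ P.toReal * y) (h2 : S.toReal * x ≤ v.toReal * y) :
    x ≤ (min (v / S) P).toReal * y := by
  rcases le_total P (v / S) with h | h
  · rwa [min_eq_right h]
  · rw [min_eq_left h]
    rcases eq_or_ne S 0 with rfl | hS0
    · rw [ENNReal.div_zero hv0, top_le_iff] at h
      rw [ENNReal.div_zero hv0, ← h]; exact h1
    · have hpos : 0 < S.toReal := ENNReal.toReal_pos hS0 hS
      rw [ENNReal.toReal_div, div_mul_eq_mul_div, le_div_iff₀ hpos]
      linarith

/-- A pointwise bound on κ extends to the closure by continuity, hence to the face. -/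
theorem integral_face_le {d : ℕ} (hd : 2 ≤ d) {κ : Set (Pt d)} (F : Face d)
    (hF : F.interior ⊆ frontier κ) {g : Pt d → ℝ} (hg : Continuous g) {c : ℝ}
    (h : ∀ x ∈ κ, g x ≤ c) : ∫ x, g x ∂(faceMeasure F) ≤ c * faceArea F := by
  have := isFiniteMeasure_faceMeasure F hd
  have hcl : closure κ ⊆ {x | g x ≤ c} := closure_minimal h (isClosed_le hg continuous_const)
  calc _ ≤ ∫ _, c ∂(faceMeasure F) := by
        refine integral_mono_ae (integrable_faceMeasure_of_continuous hd F hg)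
          (integrable_const _) ?_
        filter_upwards [ae_mem_interior hd F] with x hx
        exact hcl (frontier_subset_closure (hF hx))
    _ = _ := by rw [integral_const, smul_eq_mul, mul_comm, faceArea]

/-- The trace inverse inequalities for `q` and `∇q` on a face of an element, with the constants
that enter the penalties. -/
theorem exists_face_inequalities (d : ℕ) (hd : 2 ≤ d) {Cr Cas cas Csh Cinv1 Cinv2 : ℝ}
    (hCr : 0 < Cr) (hCas : 0 < Cas) (hcas : 0 < cas) (hCsh : 0 < Csh) (hCinv1 : 0 < Cinv1)
    (hCinv2 : 0 < Cinv2) :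
    ∃ C : ℝ, 0 < C ∧ ∀ (κ : Set (Pt d)) (p : ℕ) (F : Face d), IsOpenPolytope κ → 2 ≤ p →
      Metric.diam κ / inballDiam κ ≤ Cr → IsPCoverable Cas cas Csh κ p →
      F.interior ⊆ frontier κ → ∀ q : MvPolynomial (Fin d) ℝ, q.totalDegree ≤ p →
      ∫ x, polyVal q x ^ 2 ∂(faceMeasure F) ≤
        C * (CINV Cas cas Csh Cinv1 p κ F * ((p : ℝ) ^ 2 * faceArea F / volume.real κ)) *
          ∫ z in κ, polyVal q z ^ 2 ∧
      ∫ x, ‖polyGrad q x‖ ^ 2 ∂(faceMeasure F) ≤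
        C * (CINV Cas cas Csh Cinv1 p κ F * ((p : ℝ) ^ 2 * faceArea F / volume.real κ) *
          (Cinv2 * ((p : ℝ) ^ 4 / Metric.diam κ ^ 2))) * ∫ z in κ, polyVal q z ^ 2 := by
  have : NeZero d := ⟨by omega⟩
  obtain ⟨c₀, A, ε₀, hc₀, _, hε₀, hcones⟩ := exists_hasTruncatedCones d hCr hCas hcas hCsh
  obtain ⟨K, hK, hinv⟩ := exists_inverse_inequalities d (A := A) hc₀ hε₀
  set K' : ℝ := (1 + d) ^ 2 * (1 + K) + K with hK'
  have hK'0 : 0 < K' := by positivity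
  have hKK : K ≤ K' := by rw [hK']; linarith [show 0 ≤ (1 + (d : ℝ)) ^ 2 * (1 + K) by positivity]
  have hdK : (1 + (d : ℝ)) ^ 2 ≤ K' := by
    rw [hK']; nlinarith [show 0 ≤ (1 + (d : ℝ)) ^ 2 * K by positivity]
  have hdKK : (1 + (d : ℝ)) ^ 2 * K ≤ K' := by
    rw [hK']; nlinarith [show 0 ≤ (1 + (d : ℝ)) ^ 2 by positivity]
  refine ⟨K' / Cinv1 + K' / (Cinv1 * Cinv2), by positivity, ?_⟩
  intro κ p F hpoly hp hratio hcov hF q hq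
  have hb := hpoly.isBounded
  have ho := hpoly.1
  have hne := hpoly.2.1
  obtain ⟨ε, hε1, hεA, hεε, hcone⟩ := hcones κ p hb ho hne hp hratio hcov
  obtain ⟨hval, hgrad, hL2⟩ := hinv κ p ε hb ho hne (by omega) hε1 hεA hεε hcone q hq
  have hp0 : (1 : ℝ) ≤ p := by exact_mod_cast (by omega : 1 ≤ p)
  set N : ℝ := ∫ z in κ, polyVal q z ^ 2 with hN
  have hN0 : 0 ≤ N := integral_nonneg fun _ => sq_nonneg _
  have hv0 : volume κ ≠ 0 := (ho.measure_pos volume hne).ne'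
  have hv : volume κ ≠ ⊤ := hb.measure_lt_top.ne
  set V : ℝ := volume.real κ with hV
  have hV0 : 0 < V := ENNReal.toReal_pos hv0 hv
  set h : ℝ := Metric.diam κ with hh
  have hh0 : 0 < h := diam_pos_of_isOpen hb ho hne
  have hS : supFlatVolume κ F ≠ ⊤ := ((supFlatVolume_le κ F).trans_lt hv.lt_top).ne
  have hA0 : 0 ≤ faceArea F := measureReal_nonneg
  have hpd : ((p : ℝ) + d) ^ 2 ≤ (1 + d) ^ 2 * p ^ 2 := by
    rw [← mul_pow]
    gcongr
    nlinarith [(Nat.cast_nonneg d : (0 : ℝ) ≤ d)]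
  have hP : ((p : ℝ≥0∞) ^ (2 * (d - 1))).toReal = (p : ℝ) ^ (2 * (d - 1)) := by simp
  -- The maximum norm factor splits into the alternative p^{2(d−1)} of C_INV and the p² already
  -- present in the penalty.
  have hpow : (p : ℝ) ^ (2 * d) = p ^ (2 * (d - 1)) * p ^ 2 := by
    rw [← pow_add]; congr 1; omega
  set M : ℝ := (min (volume κ / supFlatVolume κ F) ((p : ℝ≥0∞) ^ (2 * (d - 1)))).toReal with hM
  have hM0 : 0 ≤ M := ENNReal.toReal_nonneg
  have hCINV : CINV Cas cas Csh Cinv1 p κ F = Cinv1 * M := by rw [CINV, if_pos hcov]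
  rw [hCINV]
  have hgc := continuous_polyGrad q
  have hqc := continuous_polyVal q
  constructor
  · have key : ∫ x, polyVal q x ^ 2 ∂(faceMeasure F)
        ≤ M * (K' * (p ^ 2 * faceArea F / V) * N) := by
      refine le_toReal_min_mul hv0 hS ?_ ?_
      · rw [hP]
        have h1 := integral_face_le hd F hF (g := fun x => polyVal q x ^ 2) (by fun_prop)
          (c := K * p ^ (2 * d) * N / V) (fun x hx => by
            rw [le_div_iff₀ hV0]; linarith [hval x hx])
        refine h1.trans ?_
        rw [hpow]
        calc _ = p ^ (2 * (d - 1)) * (K * (p ^ 2 * faceArea F / V) * N) := by ring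
          _ ≤ _ := by gcongr
      · have h1 := supFlatVolume_mul_integral_face_le hd hb F q hq
        refine h1.trans ?_
        calc _ ≤ ((1 + d) ^ 2 * p ^ 2) * faceArea F * N := by gcongr
          _ ≤ (K' * p ^ 2) * faceArea F * N := by gcongr
          _ = V * (K' * (p ^ 2 * faceArea F / V) * N) := by field_simp
          _ = _ := rfl
    calc _ ≤ _ := key
      _ = (K' / Cinv1 + 0) * (Cinv1 * M * (p ^ 2 * faceArea F / V)) * N := by field_simp; ring
      _ ≤ _ := by gcongr; positivity
  · have key : ∫ x, ‖polyGrad q x‖ ^ 2 ∂(faceMeasure F)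
        ≤ M * (K' * (p ^ 2 * faceArea F / V) * (p ^ 4 / h ^ 2) * N) := by
      refine le_toReal_min_mul hv0 hS ?_ ?_
      · rw [hP]
        have h1 := integral_face_le hd F hF (g := fun x => ‖polyGrad q x‖ ^ 2) (by fun_prop)
          (c := K * p ^ (2 * d) * (p ^ 4 / h ^ 2) * N / V) (fun x hx => by
            rw [le_div_iff₀ hV0]; linarith [hgrad x hx])
        refine h1.trans ?_
        rw [hpow]
        calc _ = p ^ (2 * (d - 1)) * (K * (p ^ 2 * faceArea F / V) * (p ^ 4 / h ^ 2) * N) := by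
              ring
          _ ≤ _ := by gcongr
      -- The simplex trace inequality is applied to each partial derivative; the L₂ inverse
      -- inequality for ∇q on κ then supplies p⁴/h².
      · have h1 : (supFlatVolume κ F).toReal * ∫ x, ‖polyGrad q x‖ ^ 2 ∂(faceMeasure F)
            ≤ (p + d) ^ 2 * faceArea F * ∫ x in κ, ‖polyGrad q x‖ ^ 2 := by
          have hpc := fun j => continuous_polyVal (MvPolynomial.pderiv j q)
          simp_rw [norm_polyGrad_sq]
          rw [integral_finsetSum _ fun j _ =>
              integrable_faceMeasure_of_continuous hd F (by have := hpc j; fun_prop),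
            integral_finsetSum _ fun j _ =>
              integrableOn_of_continuous hb (by have := hpc j; fun_prop),
            Finset.mul_sum, Finset.mul_sum]
          exact Finset.sum_le_sum fun j _ => supFlatVolume_mul_integral_face_le hd hb F _
            ((totalDegree_pderiv_le j q).trans hq)
        refine h1.trans ?_
        calc _ ≤ ((1 + d) ^ 2 * p ^ 2) * faceArea F * (K * (p ^ 4 / h ^ 2) * N) := by gcongr
          _ = (((1 + d) ^ 2 * K) * p ^ 2) * faceArea F * ((p ^ 4 / h ^ 2) * N) := by ring
          _ ≤ (K' * p ^ 2) * faceArea F * ((p ^ 4 / h ^ 2) * N) := by gcongr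
          _ = V * (K' * (p ^ 2 * faceArea F / V) * (p ^ 4 / h ^ 2) * N) := by field_simp
          _ = _ := rfl
    calc _ ≤ _ := key
      _ = (0 + K' / (Cinv1 * Cinv2)) *
          (Cinv1 * M * (p ^ 2 * faceArea F / V) * (Cinv2 * (p ^ 4 / h ^ 2))) * N := by
        field_simp; ring
      _ ≤ _ := by gcongr; positivity

/-! ### Cauchy–Schwarz for sums of integrals -/

section CauchySchwarz

variable {α : Type*} [MeasurableSpace α] {E : Type*} [NormedAddCommGroup E]

theorem integrable_norm_sq {μ : Measure α} {f : α → E} (hf : MemLp f 2 μ) :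
    Integrable (fun x => ‖f x‖ ^ 2) μ :=
  (memLp_two_iff_integrable_sq_norm hf.1).1 hf

variable [InnerProductSpace ℝ E]

theorem integrable_inner_of_memLp {μ : Measure α} {f g : α → E} (hf : MemLp f 2 μ)
    (hg : MemLp g 2 μ) : Integrable (fun x => (inner ℝ (f x) (g x) : ℝ)) μ := by
  refine ((integrable_norm_sq hf).add (integrable_norm_sq hg)).mono (hf.1.inner hg.1)
    (ae_of_all _ fun x => ?_)
  rw [Pi.add_apply, Real.norm_of_nonneg (by positivity : 0 ≤ ‖f x‖ ^ 2 + ‖g x‖ ^ 2)]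
  refine (norm_inner_le_norm _ _).trans ?_
  nlinarith [sq_nonneg (‖f x‖ - ‖g x‖), sq_nonneg (‖f x‖), sq_nonneg (‖g x‖)]

theorem abs_integral_inner_le {μ : Measure α} {f g : α → E} (hf : MemLp f 2 μ)
    (hg : MemLp g 2 μ) : |∫ x, inner ℝ (f x) (g x) ∂μ| ≤
      Real.sqrt (∫ x, ‖f x‖ ^ 2 ∂μ) * Real.sqrt (∫ x, ‖g x‖ ^ 2 ∂μ) := by
  have h := integral_mul_norm_le_Lp_mul_Lq (μ := μ) (f := f) (g := g) Real.HolderConjugate.two_two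
    (by simpa using hf) (by simpa using hg)
  simp only [Real.rpow_two, ← Real.sqrt_eq_rpow] at h
  refine le_trans ?_ h
  rw [← Real.norm_eq_abs]
  refine norm_integral_le_of_norm_le ?_ (ae_of_all _ fun x => norm_inner_le_norm _ _)
  exact hf.norm.integrable_mul hg.norm

/-- The weighted Cauchy–Schwarz inequality for sums of integrals. -/
theorem abs_sum_integral_inner_le {ι : Type*} [Fintype ι] {μ : ι → Measure α} {f g : ι → α → E}
    (hf : ∀ k, MemLp (f k) 2 (μ k)) (hg : ∀ k, MemLp (g k) 2 (μ k)) {θ s : ι → ℝ}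
    (hθ : ∀ k, 0 ≤ θ k) (hs : ∀ k, 0 ≤ s k) (h : ∀ k, ∫ x, ‖f k x‖ ^ 2 ∂(μ k) ≤ θ k * s k) :
    |∑ k, ∫ x, inner ℝ (f k x) (g k x) ∂(μ k)| ≤
      Real.sqrt (∑ k, θ k) * Real.sqrt (∑ k, s k * ∫ x, ‖g k x‖ ^ 2 ∂(μ k)) := by
  have hg0 : ∀ k, 0 ≤ ∫ x, ‖g k x‖ ^ 2 ∂(μ k) := fun k => integral_nonneg fun _ => sq_nonneg _
  refine (Finset.abs_sum_le_sum_abs _ _).trans (le_trans (Finset.sum_le_sum fun k _ => ?_)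
    (Real.sum_sqrt_mul_sqrt_le Finset.univ hθ fun k => mul_nonneg (hs k) (hg0 k)))
  refine (abs_integral_inner_le (hf k) (hg k)).trans ?_
  rw [← Real.sqrt_mul (integral_nonneg fun _ => sq_nonneg _), ← Real.sqrt_mul (hθ k)]
  refine Real.sqrt_le_sqrt ?_
  rw [← mul_assoc]
  exact mul_le_mul_of_nonneg_right (h k) (hg0 k)

end CauchySchwarz

/-! ### Square integrability of weak derivatives and traces -/

section Traces

variable {d : ℕ}

theorem memL2_weakPartial (U : Set (Pt d)) (j : Fin d) (u : Pt d → ℝ) :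
    MemL2 U (weakPartial U j u) := by
  unfold weakPartial
  split_ifs with h
  · exact h.choose_spec.1
  · exact MemLp.zero'

theorem memL2_weakLaplacian (U : Set (Pt d)) (u : Pt d → ℝ) : MemL2 U (weakLaplacian U u) :=
  memLp_finsetSum _ fun j _ => memL2_weakPartial U j _

/-- Square integrability is part of the definition of a trace, and the default value 0 has it too.
This is the only property of the traces that the face estimates need. -/
theorem memLp_faceTrace (κ : Set (Pt d)) (F : Face d) (n : Pt d) (g : Pt d → ℝ) :
    MemLp (faceTrace κ F n g) 2 (faceMeasure F) := by
  unfold faceTrace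
  split_ifs with h
  · exact h.choose_spec.1
  · exact MemLp.zero'

end Traces

/-! ### Mesh estimates: projection, counting of faces, averages -/

namespace PolytopicMesh

variable {d : ℕ} {Ω : Set (Pt d)} (T : PolytopicMesh d Ω)

theorem memLp_jump (v : Pt d → ℝ) (k : Fin T.numFace) :
    MemLp (T.jump v k) 2 (faceMeasure (T.face k)) := by
  refine memLp_finsetSum _ fun i _ => ?_
  exact (ContinuousLinearMap.toSpanSingleton ℝ (T.normal k i)).comp_memLp'
    (memLp_faceTrace _ _ _ _)

theorem memLp_gradJump (v : Pt d → ℝ) (k : Fin T.numFace) :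
    MemLp (T.gradJump v k) 2 (faceMeasure (T.face k)) := by
  refine memLp_finsetSum _ fun i _ => ?_
  have h : (fun x => (inner ℝ (T.gradTrace v k i x) (T.normal k i) : ℝ))
      = fun x => ∑ j, T.normal k i j * T.trace (weakPartial (T.elem i) j v) k i x := by
    ext x
    simp [PiLp.inner_apply, gradTrace]
  rw [h]
  exact memLp_finsetSum _ fun j _ => (memLp_faceTrace _ _ _ _).const_mul _

/-- The square of the `L₂` norm of the broken Laplacian of `v` on the element `i`. -/
def lapEnergy (v : Pt d → ℝ) (i : Fin T.numElem) : ℝ := ∫ x in T.elem i, T.laplacian v i x ^ 2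

theorem lapEnergy_nonneg (v : Pt d → ℝ) (i : Fin T.numElem) : 0 ≤ T.lapEnergy v i :=
  integral_nonneg fun _ => sq_nonneg _

theorem memLp_polyVal {κ : Set (Pt d)} (hb : Bornology.IsBounded κ) (q : MvPolynomial (Fin d) ℝ) :
    MemLp (polyVal q) 2 (volume.restrict κ) := by
  have hc := continuous_polyVal q
  rw [memLp_two_iff_integrable_sq hc.aestronglyMeasurable]
  exact integrableOn_of_continuous hb (by fun_prop)

/-- Pythagoras on a single element, since the projection onto a broken space decouples. The default
value 0 satisfies the bounds trivially. -/
theorem projLaplacian_spec (p : Fin T.numElem → ℕ) (v : Pt d → ℝ) (i : Fin T.numElem) :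
    (T.projLaplacian p v i).totalDegree ≤ p i ∧
      ∫ x in T.elem i, polyVal (T.projLaplacian p v i) x ^ 2 ≤ T.lapEnergy v i := by
  unfold projLaplacian
  split_ifs with h
  · have hQ := h.choose_spec
    set Q := h.choose with hQdef
    refine ⟨(hQ.1 i).trans (Nat.sub_le _ _), ?_⟩
    have hb := (T.isOpenPolytope_elem i).isBounded
    set f := T.laplacian v i with hf
    have hfL : MemLp f 2 (volume.restrict (T.elem i)) := memL2_weakLaplacian _ _
    have hqL := memLp_polyVal hb (Q i)
    have horth : ∫ x in T.elem i, (f x - polyVal (Q i) x) * polyVal (Q i) x = 0 := by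
      classical
      -- Testing with the projection on the element i, extended by zero, localises the
      -- orthogonality.
      have h1 := hQ.2 (fun j => if j = i then Q i else 0) (fun j => by
        split_ifs with hj
        · subst hj; exact hQ.1 j
        · simp)
      rw [Finset.sum_eq_single i] at h1
      · simpa using h1
      · intro j _ hj
        simp [hj, polyVal]
      · simp
    have hfq : Integrable (fun x => (f x - polyVal (Q i) x) * polyVal (Q i) x)
        (volume.restrict (T.elem i)) := (hfL.sub hqL).integrable_mul hqL
    have hff : Integrable (fun x => (f x - polyVal (Q i) x) ^ 2)
        (volume.restrict (T.elem i)) := (hfL.sub hqL).integrable_sq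
    have hqq : Integrable (fun x => polyVal (Q i) x ^ 2) (volume.restrict (T.elem i)) :=
      hqL.integrable_sq
    have e : T.lapEnergy v i = (∫ x in T.elem i, (f x - polyVal (Q i) x) ^ 2)
        + 2 * (∫ x in T.elem i, (f x - polyVal (Q i) x) * polyVal (Q i) x)
        + ∫ x in T.elem i, polyVal (Q i) x ^ 2 := by
      have hs : Integrable (fun x => (f x - polyVal (Q i) x) ^ 2
          + 2 * ((f x - polyVal (Q i) x) * polyVal (Q i) x)) (volume.restrict (T.elem i)) :=
        hff.add (hfq.const_mul 2)
      rw [← integral_const_mul, ← integral_add hff (hfq.const_mul 2), ← integral_add hs hqq,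
        lapEnergy]
      refine integral_congr_ae (ae_of_all _ fun x => ?_)
      simp only [← hf]; ring
    have h0 : 0 ≤ ∫ x in T.elem i, (f x - polyVal (Q i) x) ^ 2 :=
      integral_nonneg fun _ => sq_nonneg _
    rw [e, horth]; linarith
  · exact ⟨by simp, by simpa [polyVal] using T.lapEnergy_nonneg v i⟩

/-- Double counting: each element enters once for each of its faces. -/
theorem sum_adj_lapEnergy_le (v : Pt d → ℝ) {CF : ℕ} (h : ∀ i, T.faceCount i ≤ CF) :
    ∑ k, ∑ i ∈ T.adj k, T.lapEnergy v i ≤ CF * ∑ i, T.lapEnergy v i := by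
  classical
  have h1 : ∑ k, ∑ i ∈ T.adj k, T.lapEnergy v i = ∑ i, T.faceCount i * T.lapEnergy v i := by
    simp only [adj, adjElems, Finset.sum_filter]
    rw [Finset.sum_comm]
    refine Finset.sum_congr rfl fun i _ => ?_
    rw [← Finset.sum_filter, Finset.sum_const, nsmul_eq_mul, faceCount]
  rw [h1, Finset.mul_sum]
  refine Finset.sum_le_sum fun i _ => ?_
  have := T.lapEnergy_nonneg v i
  gcongr
  exact h i

theorem norm_card_inv_smul_sum_sq_le {ι E : Type*} [NormedAddCommGroup E] [NormedSpace ℝ E]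
    (s : Finset ι) (f : ι → E) : ‖((s.card : ℝ)⁻¹) • ∑ i ∈ s, f i‖ ^ 2 ≤ ∑ i ∈ s, ‖f i‖ ^ 2 := by
  rcases s.eq_empty_or_nonempty with rfl | hs
  · simp
  have hc : (1 : ℝ) ≤ s.card := by exact_mod_cast hs.card_pos
  have h1 : ‖∑ i ∈ s, f i‖ ^ 2 ≤ s.card * ∑ i ∈ s, ‖f i‖ ^ 2 :=
    (pow_le_pow_left₀ (norm_nonneg _) (norm_sum_le _ _) 2).trans sq_sum_le_card_mul_sum_sq
  have h0 : 0 ≤ ∑ i ∈ s, ‖f i‖ ^ 2 := Finset.sum_nonneg fun _ _ => sq_nonneg _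
  rw [norm_smul, norm_inv, Real.norm_of_nonneg (by positivity), mul_pow]
  calc _ ≤ ((s.card : ℝ)⁻¹) ^ 2 * (s.card * ∑ i ∈ s, ‖f i‖ ^ 2) := by gcongr
    _ = ((s.card : ℝ)⁻¹) * ∑ i ∈ s, ‖f i‖ ^ 2 := by field_simp
    _ ≤ 1 * ∑ i ∈ s, ‖f i‖ ^ 2 := by
      gcongr
      exact inv_le_one_of_one_le₀ hc
    _ = _ := one_mul _

theorem continuous_polyMean (Q : Fin T.numElem → MvPolynomial (Fin d) ℝ) (k : Fin T.numFace) :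
    Continuous (T.polyMean Q k) := by
  have := fun i => continuous_polyVal (Q i)
  unfold polyMean
  fun_prop

theorem continuous_polyGradMean (Q : Fin T.numElem → MvPolynomial (Fin d) ℝ) (k : Fin T.numFace) :
    Continuous (T.polyGradMean Q k) := by
  have := fun i => continuous_polyGrad (Q i)
  unfold polyGradMean
  fun_prop

theorem integral_polyMean_sq_le (hd : 2 ≤ d) (Q : Fin T.numElem → MvPolynomial (Fin d) ℝ)
    (k : Fin T.numFace) {B : Fin T.numElem → ℝ} {s : ℝ}
    (h : ∀ i ∈ T.adj k, ∫ x, polyVal (Q i) x ^ 2 ∂(faceMeasure (T.face k)) ≤ B i * s) :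
    ∫ x, ‖T.polyMean Q k x‖ ^ 2 ∂(faceMeasure (T.face k)) ≤ (∑ i ∈ T.adj k, B i) * s := by
  have hc := fun i => continuous_polyVal (Q i)
  have hm := T.continuous_polyMean Q k
  calc _ ≤ ∫ x, ∑ i ∈ T.adj k, polyVal (Q i) x ^ 2 ∂(faceMeasure (T.face k)) := by
        refine integral_mono (integrable_faceMeasure_of_continuous hd _ (by fun_prop))
          (integrable_faceMeasure_of_continuous hd _ (by fun_prop)) fun x => ?_
        have := norm_card_inv_smul_sum_sq_le (T.adj k) fun i => polyVal (Q i) x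
        simpa [polyMean] using this
    _ ≤ _ := by
        rw [integral_finsetSum _ fun i _ =>
          integrable_faceMeasure_of_continuous hd _ (by have := hc i; fun_prop), Finset.sum_mul]
        exact Finset.sum_le_sum h

theorem integral_polyGradMean_sq_le (hd : 2 ≤ d) (Q : Fin T.numElem → MvPolynomial (Fin d) ℝ)
    (k : Fin T.numFace) {B : Fin T.numElem → ℝ} {s : ℝ}
    (h : ∀ i ∈ T.adj k, ∫ x, ‖polyGrad (Q i) x‖ ^ 2 ∂(faceMeasure (T.face k)) ≤ B i * s) :
    ∫ x, ‖T.polyGradMean Q k x‖ ^ 2 ∂(faceMeasure (T.face k)) ≤ (∑ i ∈ T.adj k, B i) * s := by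
  have hc := fun i => continuous_polyGrad (Q i)
  have hm := T.continuous_polyGradMean Q k
  calc _ ≤ ∫ x, ∑ i ∈ T.adj k, ‖polyGrad (Q i) x‖ ^ 2 ∂(faceMeasure (T.face k)) := by
        refine integral_mono (integrable_faceMeasure_of_continuous hd _ (by fun_prop))
          (integrable_faceMeasure_of_continuous hd _ (by fun_prop)) fun x => ?_
        exact norm_card_inv_smul_sum_sq_le (T.adj k) fun i => polyGrad (Q i) x
    _ ≤ _ := by
        rw [integral_finsetSum _ fun i _ =>
          integrable_faceMeasure_of_continuous hd _ (by have := hc i; fun_prop), Finset.sum_mul]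
        exact Finset.sum_le_sum h

section Penalties

variable (p : Fin T.numElem → ℕ) {Cas cas Csh Cinv1 Cinv2 : ℝ}

theorem traceFactor_nonneg (hCinv1 : 0 < Cinv1) (k : Fin T.numFace) (i : Fin T.numElem) :
    0 ≤ T.traceFactor p Cas cas Csh Cinv1 k i := by
  unfold traceFactor CINV faceArea
  positivity

theorem gradFactor_nonneg (hCinv2 : 0 < Cinv2) (i : Fin T.numElem) :
    0 ≤ T.gradFactor p Cinv2 i := by
  unfold gradFactor
  positivity

theorem sup'_adj_nonneg {f : Fin T.numElem → ℝ} (hf : ∀ i, 0 ≤ f i) (k : Fin T.numFace) :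
    0 ≤ (T.adj k).sup' (T.adj_nonempty k) f := by
  obtain ⟨i, hi⟩ := T.adj_nonempty k
  exact (hf i).trans (Finset.le_sup' f hi)

end Penalties

end PolytopicMesh

/-! ### Coercivity and boundedness from the face inequalities -/

namespace PolytopicMesh

variable {d : ℕ} {Ω : Set (Pt d)} (T : PolytopicMesh d Ω)

/-- The penalty energy of the jumps of `v`. -/
def jumpEnergy (σ : Fin T.numFace → ℝ) (v : Pt d → ℝ) : ℝ :=
  ∑ k, σ k * ∫ x, ‖T.jump v k x‖ ^ 2 ∂(faceMeasure (T.face k))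

/-- The penalty energy of the jumps of `∇v`. -/
def gradJumpEnergy (τ : Fin T.numFace → ℝ) (v : Pt d → ℝ) : ℝ :=
  ∑ k, τ k * ∫ x, ‖T.gradJump v k x‖ ^ 2 ∂(faceMeasure (T.face k))

theorem jumpEnergy_nonneg {σ : Fin T.numFace → ℝ} (hσ : ∀ k, 0 ≤ σ k) (v : Pt d → ℝ) :
    0 ≤ T.jumpEnergy σ v :=
  Finset.sum_nonneg fun k _ => mul_nonneg (hσ k) (integral_nonneg fun _ => sq_nonneg _)

theorem gradJumpEnergy_nonneg {τ : Fin T.numFace → ℝ} (hτ : ∀ k, 0 ≤ τ k) (v : Pt d → ℝ) :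
    0 ≤ T.gradJumpEnergy τ v :=
  Finset.sum_nonneg fun k _ => mul_nonneg (hτ k) (integral_nonneg fun _ => sq_nonneg _)

theorem dgNorm_sq {σ τ : Fin T.numFace → ℝ} (hσ : ∀ k, 0 ≤ σ k) (hτ : ∀ k, 0 ≤ τ k)
    (v : Pt d → ℝ) : T.dgNorm σ τ v ^ 2 =
      ∑ i, T.lapEnergy v i + T.jumpEnergy σ v + T.gradJumpEnergy τ v := by
  have h : ∑ k, ∫ x, (σ k * ‖T.jump v k x‖ ^ 2 + τ k * T.gradJump v k x ^ 2)
      ∂(faceMeasure (T.face k)) = T.jumpEnergy σ v + T.gradJumpEnergy τ v := by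
    rw [jumpEnergy, gradJumpEnergy, ← Finset.sum_add_distrib]
    refine Finset.sum_congr rfl fun k _ => ?_
    rw [integral_add ((integrable_norm_sq (T.memLp_jump v k)).const_mul _)
      ((T.memLp_gradJump v k).integrable_sq.const_mul _), integral_const_mul, integral_const_mul]
    simp
  have h1 := T.jumpEnergy_nonneg hσ v
  have h2 := T.gradJumpEnergy_nonneg hτ v
  have h3 : 0 ≤ ∑ i, T.lapEnergy v i := Finset.sum_nonneg fun i _ => T.lapEnergy_nonneg v i
  rw [dgNorm, Real.sq_sqrt, h, add_assoc]
  · rfl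
  · rw [h]
    have : 0 ≤ ∑ i, ∫ x in T.elem i, T.laplacian v i x ^ 2 := h3
    positivity

/-- All factors are square integrable on the faces, so each integral of a sum splits, and every term
takes the form required by `abs_sum_integral_inner_le`. -/
theorem Btilde_eq (hd : 2 ≤ d) (p : Fin T.numElem → ℕ) (σ τ : Fin T.numFace → ℝ)
    (u v : Pt d → ℝ) : T.Btilde p σ τ u v =
      ∑ i, (∫ x in T.elem i, inner ℝ (T.laplacian u i x) (T.laplacian v i x))
      + (∑ k, (∫ x, inner ℝ (T.polyGradMean (T.projLaplacian p u) k x) (T.jump v k x)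
            ∂(faceMeasure (T.face k)))
        + ∑ k, ∫ x, inner ℝ (T.polyGradMean (T.projLaplacian p v) k x) (T.jump u k x)
            ∂(faceMeasure (T.face k)))
      - (∑ k, (∫ x, inner ℝ (T.polyMean (T.projLaplacian p u) k x) (T.gradJump v k x)
            ∂(faceMeasure (T.face k)))
        + ∑ k, ∫ x, inner ℝ (T.polyMean (T.projLaplacian p v) k x) (T.gradJump u k x)
            ∂(faceMeasure (T.face k)))
      + (∑ k, (∫ x, inner ℝ (σ k • T.jump u k x) (T.jump v k x) ∂(faceMeasure (T.face k)))
        + ∑ k, ∫ x, inner ℝ (τ k • T.gradJump u k x) (T.gradJump v k x)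
            ∂(faceMeasure (T.face k))) := by
  have hG := fun (w : Pt d → ℝ) k => memLp_faceMeasure_of_continuous hd (T.face k)
    (T.continuous_polyGradMean (T.projLaplacian p w) k) 2
  have hM := fun (w : Pt d → ℝ) k => memLp_faceMeasure_of_continuous hd (T.face k)
    (T.continuous_polyMean (T.projLaplacian p w) k) 2
  have hJ := T.memLp_jump
  have hN := T.memLp_gradJump
  have hinner : ∀ a b : ℝ, (inner ℝ a b : ℝ) = a * b := fun a b => by
    simp [mul_comm]
  simp only [← Finset.sum_add_distrib]
  unfold Btilde
  congr 1
  · congr 1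
    · congr 1
      · simp only [hinner]
      · refine Finset.sum_congr rfl fun k _ => ?_
        exact integral_add (integrable_inner_of_memLp (hG u k) (hJ v k))
          (integrable_inner_of_memLp (hG v k) (hJ u k))
    · refine Finset.sum_congr rfl fun k _ => ?_
      rw [← integral_add (integrable_inner_of_memLp (hM u k) (hN v k))
          (integrable_inner_of_memLp (hM v k) (hN u k))]
      simp only [hinner]
  · refine Finset.sum_congr rfl fun k _ => ?_
    simp only [real_inner_smul_left]
    rw [← integral_add ((integrable_inner_of_memLp (hJ u k) (hJ v k)).const_mul (σ k))
          ((integrable_inner_of_memLp (hN u k) (hN v k)).const_mul (τ k))]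
    simp only [hinner]

theorem abs_sum_integral_laplacian_le (u v : Pt d → ℝ) :
    |∑ i, ∫ x in T.elem i, inner ℝ (T.laplacian u i x) (T.laplacian v i x)| ≤
      √(∑ i, T.lapEnergy u i) * √(∑ i, T.lapEnergy v i) := by
  have h := abs_sum_integral_inner_le (μ := fun i => volume.restrict (T.elem i))
    (f := T.laplacian u) (g := T.laplacian v) (θ := T.lapEnergy u) (s := fun _ => 1)
    (fun i => memL2_weakLaplacian _ _) (fun i => memL2_weakLaplacian _ _) (T.lapEnergy_nonneg u)
    (fun _ => zero_le_one) (fun i => by simp [lapEnergy])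
  simpa [lapEnergy] using h

theorem abs_sum_integral_jump_le {σ : Fin T.numFace → ℝ} (hσ : ∀ k, 0 ≤ σ k) (u v : Pt d → ℝ) :
    |∑ k, ∫ x, inner ℝ (σ k • T.jump u k x) (T.jump v k x) ∂(faceMeasure (T.face k))| ≤
      √(T.jumpEnergy σ u) * √(T.jumpEnergy σ v) := by
  refine abs_sum_integral_inner_le (μ := fun k => faceMeasure (T.face k))
    (f := fun k x => σ k • T.jump u k x)
    (θ := fun k => σ k * ∫ x, ‖T.jump u k x‖ ^ 2 ∂(faceMeasure (T.face k)))
    (fun k => (T.memLp_jump u k).const_smul (σ k)) (fun k => T.memLp_jump v k)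
    (fun k => mul_nonneg (hσ k) (integral_nonneg fun _ => sq_nonneg _)) hσ fun k => le_of_eq ?_
  simp only [norm_smul, mul_pow, Real.norm_eq_abs, sq_abs]
  rw [integral_const_mul]; ring

theorem abs_sum_integral_gradJump_le {τ : Fin T.numFace → ℝ} (hτ : ∀ k, 0 ≤ τ k)
    (u v : Pt d → ℝ) :
    |∑ k, ∫ x, inner ℝ (τ k • T.gradJump u k x) (T.gradJump v k x) ∂(faceMeasure (T.face k))| ≤
      √(T.gradJumpEnergy τ u) * √(T.gradJumpEnergy τ v) := by
  refine abs_sum_integral_inner_le (μ := fun k => faceMeasure (T.face k))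
    (f := fun k x => τ k • T.gradJump u k x)
    (θ := fun k => τ k * ∫ x, ‖T.gradJump u k x‖ ^ 2 ∂(faceMeasure (T.face k)))
    (fun k => (T.memLp_gradJump u k).const_smul (τ k)) (fun k => T.memLp_gradJump v k)
    (fun k => mul_nonneg (hτ k) (integral_nonneg fun _ => sq_nonneg _)) hτ fun k => le_of_eq ?_
  simp only [norm_smul, mul_pow, Real.norm_eq_abs, sq_abs]
  rw [integral_const_mul]; ring

theorem sqrt_sum_adj_lapEnergy_le {A : ℝ} (hA : 0 ≤ A) {CF : ℕ} (hCF : ∀ i, T.faceCount i ≤ CF)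
    (hACF : 16 * (A * CF) ≤ 1) (v : Pt d → ℝ) :
    √(∑ k, ∑ i ∈ T.adj k, A * T.lapEnergy v i) ≤ √(∑ i, T.lapEnergy v i) / 4 := by
  have h3 : 0 ≤ ∑ i, T.lapEnergy v i := Finset.sum_nonneg fun i _ => T.lapEnergy_nonneg v i
  refine Real.sqrt_le_iff.2 ⟨by positivity, ?_⟩
  rw [div_pow, Real.sq_sqrt h3]
  simp only [← Finset.mul_sum]
  have := mul_le_mul_of_nonneg_left (T.sum_adj_lapEnergy_le v hCF) hA
  nlinarith [mul_le_mul_of_nonneg_right hACF h3]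

/-- Weighted Cauchy–Schwarz: the face inequality converts the average into σ times the energy of the
adjacent elements, and σ moves onto the jump. The factor 1/4 is the square root of the bound 1/16
for A C_F. -/
theorem abs_sum_integral_polyGradMean_le (hd : 2 ≤ d) {p : Fin T.numElem → ℕ}
    {σ : Fin T.numFace → ℝ} (hσ : ∀ k, 0 ≤ σ k) {A : ℝ} (hA : 0 ≤ A) {CF : ℕ}
    (hCF : ∀ i, T.faceCount i ≤ CF) (hACF : 16 * (A * CF) ≤ 1)
    (h : ∀ k, ∀ i ∈ T.adj k, ∀ q : MvPolynomial (Fin d) ℝ, q.totalDegree ≤ p i →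
      ∫ x, ‖polyGrad q x‖ ^ 2 ∂(faceMeasure (T.face k)) ≤
        A * σ k * ∫ z in T.elem i, polyVal q z ^ 2) (u v : Pt d → ℝ) :
    |∑ k, ∫ x, inner ℝ (T.polyGradMean (T.projLaplacian p u) k x) (T.jump v k x)
      ∂(faceMeasure (T.face k))| ≤ √(∑ i, T.lapEnergy u i) / 4 * √(T.jumpEnergy σ v) := by
  refine le_trans (abs_sum_integral_inner_le (μ := fun k => faceMeasure (T.face k))
    (θ := fun k => ∑ i ∈ T.adj k, A * T.lapEnergy u i) (s := σ)
    (fun k => memLp_faceMeasure_of_continuous hd (T.face k) (T.continuous_polyGradMean _ k) 2)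
    (T.memLp_jump v)
    (fun k => Finset.sum_nonneg fun i _ => mul_nonneg hA (T.lapEnergy_nonneg u i)) hσ fun k => ?_)
    (mul_le_mul_of_nonneg_right (T.sqrt_sum_adj_lapEnergy_le hA hCF hACF u) (Real.sqrt_nonneg _))
  refine T.integral_polyGradMean_sq_le hd _ k fun i hi => ?_
  have hs := T.projLaplacian_spec p u i
  refine (h k i hi _ hs.1).trans ?_
  have := mul_le_mul_of_nonneg_left hs.2 (mul_nonneg hA (hσ k))
  linarith

theorem abs_sum_integral_polyMean_le (hd : 2 ≤ d) {p : Fin T.numElem → ℕ}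
    {τ : Fin T.numFace → ℝ} (hτ : ∀ k, 0 ≤ τ k) {A : ℝ} (hA : 0 ≤ A) {CF : ℕ}
    (hCF : ∀ i, T.faceCount i ≤ CF) (hACF : 16 * (A * CF) ≤ 1)
    (h : ∀ k, ∀ i ∈ T.adj k, ∀ q : MvPolynomial (Fin d) ℝ, q.totalDegree ≤ p i →
      ∫ x, polyVal q x ^ 2 ∂(faceMeasure (T.face k)) ≤
        A * τ k * ∫ z in T.elem i, polyVal q z ^ 2) (u v : Pt d → ℝ) :
    |∑ k, ∫ x, inner ℝ (T.polyMean (T.projLaplacian p u) k x) (T.gradJump v k x)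
      ∂(faceMeasure (T.face k))| ≤ √(∑ i, T.lapEnergy u i) / 4 * √(T.gradJumpEnergy τ v) := by
  refine le_trans (abs_sum_integral_inner_le (μ := fun k => faceMeasure (T.face k))
    (θ := fun k => ∑ i ∈ T.adj k, A * T.lapEnergy u i) (s := τ)
    (fun k => memLp_faceMeasure_of_continuous hd (T.face k) (T.continuous_polyMean _ k) 2)
    (T.memLp_gradJump v)
    (fun k => Finset.sum_nonneg fun i _ => mul_nonneg hA (T.lapEnergy_nonneg u i)) hτ fun k => ?_)
    (mul_le_mul_of_nonneg_right (T.sqrt_sum_adj_lapEnergy_le hA hCF hACF u) (Real.sqrt_nonneg _))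
  refine T.integral_polyMean_sq_le hd _ k fun i hi => ?_
  have hs := T.projLaplacian_spec p u i
  refine (h k i hi _ hs.1).trans ?_
  have := mul_le_mul_of_nonneg_left hs.2 (mul_nonneg hA (hτ k))
  linarith

theorem coercive_and_continuous (hd : 2 ≤ d) {p : Fin T.numElem → ℕ} {σ τ : Fin T.numFace → ℝ}
    (hσ : ∀ k, 0 ≤ σ k) (hτ : ∀ k, 0 ≤ τ k) {A : ℝ} (hA : 0 ≤ A) {CF : ℕ}
    (hCF : ∀ i, T.faceCount i ≤ CF) (hACF : 16 * (A * CF) ≤ 1)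
    (h : ∀ k, ∀ i ∈ T.adj k, ∀ q : MvPolynomial (Fin d) ℝ, q.totalDegree ≤ p i →
      ∫ x, polyVal q x ^ 2 ∂(faceMeasure (T.face k)) ≤
        A * τ k * (∫ z in T.elem i, polyVal q z ^ 2) ∧
      ∫ x, ‖polyGrad q x‖ ^ 2 ∂(faceMeasure (T.face k)) ≤
        A * σ k * ∫ z in T.elem i, polyVal q z ^ 2) :
    (∀ v, 1 / 2 * T.dgNorm σ τ v ^ 2 ≤ T.Btilde p σ τ v v) ∧
      ∀ w v, T.Btilde p σ τ w v ≤ 4 * T.dgNorm σ τ w * T.dgNorm σ τ v := by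
  have hE : ∀ v, 0 ≤ ∑ i, T.lapEnergy v i := fun v =>
    Finset.sum_nonneg fun i _ => T.lapEnergy_nonneg v i
  have hG := T.abs_sum_integral_polyGradMean_le hd (p := p) hσ hA hCF hACF
    fun k i hi q hq => (h k i hi q hq).2
  have hM := T.abs_sum_integral_polyMean_le hd (p := p) hτ hA hCF hACF
    fun k i hi q hq => (h k i hi q hq).1
  have hn : ∀ v, T.dgNorm σ τ v ^ 2 =
      √(∑ i, T.lapEnergy v i) ^ 2 + √(T.jumpEnergy σ v) ^ 2 + √(T.gradJumpEnergy τ v) ^ 2 :=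
    fun v => by
      rw [Real.sq_sqrt (hE v), Real.sq_sqrt (T.jumpEnergy_nonneg hσ v),
        Real.sq_sqrt (T.gradJumpEnergy_nonneg hτ v), T.dgNorm_sq hσ hτ]
  constructor
  · intro v
    rw [T.Btilde_eq hd, hn]
    have hg := abs_le.1 (hG v v)
    have hm := abs_le.1 (hM v v)
    have e1 : ∑ i, ∫ x in T.elem i, inner ℝ (T.laplacian v i x) (T.laplacian v i x)
        = √(∑ i, T.lapEnergy v i) ^ 2 := by
      rw [Real.sq_sqrt (hE v)]
      simp [lapEnergy]
    have e2 : ∑ k, ∫ x, inner ℝ (σ k • T.jump v k x) (T.jump v k x) ∂(faceMeasure (T.face k))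
        = √(T.jumpEnergy σ v) ^ 2 := by
      rw [Real.sq_sqrt (T.jumpEnergy_nonneg hσ v)]
      simp [jumpEnergy, real_inner_smul_left, integral_const_mul]
    have e3 : ∑ k, ∫ x, inner ℝ (τ k • T.gradJump v k x) (T.gradJump v k x)
        ∂(faceMeasure (T.face k)) = √(T.gradJumpEnergy τ v) ^ 2 := by
      rw [Real.sq_sqrt (T.gradJumpEnergy_nonneg hτ v)]
      simp only [gradJumpEnergy, real_inner_smul_left, integral_const_mul,
        real_inner_self_eq_norm_sq]
    rw [e1, e2, e3]
    -- The cross terms occur twice, each at most XY/4 or XZ/4, so B̃(v,v) ≥ X² + Y² + Z² − XY/2 −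
    -- XZ/2, which is at least half the sum of squares.
    nlinarith [sq_nonneg (√(∑ i, T.lapEnergy v i) - √(T.jumpEnergy σ v)),
      sq_nonneg (√(∑ i, T.lapEnergy v i) - √(T.gradJumpEnergy τ v)),
      sq_nonneg (√(T.jumpEnergy σ v)), sq_nonneg (√(T.gradJumpEnergy τ v))]
  · intro w v
    rw [T.Btilde_eq hd]
    have hN : ∀ v, 0 ≤ T.dgNorm σ τ v := fun v => Real.sqrt_nonneg _
    have hX : ∀ v, √(∑ i, T.lapEnergy v i) ≤ T.dgNorm σ τ v := fun v => by
      refine le_of_abs_le (abs_le_of_sq_le_sq ?_ (hN v))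
      rw [hn]
      linarith [sq_nonneg (√(T.jumpEnergy σ v)), sq_nonneg (√(T.gradJumpEnergy τ v))]
    have hY : ∀ v, √(T.jumpEnergy σ v) ≤ T.dgNorm σ τ v := fun v => by
      refine le_of_abs_le (abs_le_of_sq_le_sq ?_ (hN v))
      rw [hn]
      linarith [sq_nonneg (√(∑ i, T.lapEnergy v i)), sq_nonneg (√(T.gradJumpEnergy τ v))]
    have hZ : ∀ v, √(T.gradJumpEnergy τ v) ≤ T.dgNorm σ τ v := fun v => by
      refine le_of_abs_le (abs_le_of_sq_le_sq ?_ (hN v))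
      rw [hn]
      linarith [sq_nonneg (√(∑ i, T.lapEnergy v i)), sq_nonneg (√(T.jumpEnergy σ v))]
    have hprod : ∀ {a b c d : ℝ}, 0 ≤ b → 0 ≤ c → a ≤ c → b ≤ d → a * b ≤ c * d :=
      fun hb hc h1 h2 => mul_le_mul h1 h2 hb hc
    have t1 := (abs_le.1 (T.abs_sum_integral_laplacian_le w v)).2
    have t2 := (abs_le.1 (hG w v)).2
    have t3 := (abs_le.1 (hG v w)).2
    have t4 := (abs_le.1 (hM w v)).1
    have t5 := (abs_le.1 (hM v w)).1
    have t6 := (abs_le.1 (T.abs_sum_integral_jump_le hσ w v)).2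
    have t7 := (abs_le.1 (T.abs_sum_integral_gradJump_le hτ w v)).2
    have s1 := hprod (Real.sqrt_nonneg _) (hN w) (hX w) (hX v)
    have s2 := hprod (Real.sqrt_nonneg _) (hN w) (hX w) (hY v)
    have s3 := hprod (Real.sqrt_nonneg _) (hN v) (hX v) (hY w)
    have s4 := hprod (Real.sqrt_nonneg _) (hN w) (hX w) (hZ v)
    have s5 := hprod (Real.sqrt_nonneg _) (hN v) (hX v) (hZ w)
    have s6 := hprod (Real.sqrt_nonneg _) (hN w) (hY w) (hY v)
    have s7 := hprod (Real.sqrt_nonneg _) (hN w) (hZ w) (hZ v)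
    -- The constant 4 is 1 for the Laplacians, 4 · 1/4 for the cross terms and 2 for the penalties.
    linarith

end PolytopicMesh

end DGBiharmonic

end

/-! ### Choice of the thresholds -/

theorem mainTheorem5 (d : ℕ) (hd : d = 2 ∨ d = 3)
    (CF : ℕ) (Cr : ℝ) (hCr : 0 < Cr)
    (Cas cas Csh : ℝ) (hCas : 0 < Cas) (hcas : 0 < cas) (hCsh : 0 < Csh)
    (Cinv1 Cinv2 : ℝ) (hCinv1 : 0 < Cinv1) (hCinv2 : 0 < Cinv2) :
    ∃ Cσ₀ Cτ₀ Ccoer Ccont : ℝ, 0 < Cσ₀ ∧ 0 < Cτ₀ ∧ 0 < Ccoer ∧ 0 < Ccont ∧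
      ∀ Cσ Cτ : ℝ, Cσ₀ ≤ Cσ → Cτ₀ ≤ Cτ →
      ∀ (Ω : Set (DGBiharmonic.Pt d)), DGBiharmonic.IsOpenPolytope Ω →
      ∀ (T : DGBiharmonic.PolytopicMesh d Ω) (p : Fin T.numElem → ℕ),
        (∀ i, 2 ≤ p i) →
        (∀ i, T.faceCount i ≤ CF) →
        (∀ i, Metric.diam (T.elem i) / DGBiharmonic.inballDiam (T.elem i) ≤ Cr) →
        (∀ i, DGBiharmonic.IsPCoverable Cas cas Csh (T.elem i) (p i)) →
        ∀ σ τ : Fin T.numFace → ℝ,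
          (∀ k, σ k = T.sigma p Cas cas Csh Cinv1 Cinv2 Cσ k) →
          (∀ k, τ k = T.tau p Cas cas Csh Cinv1 Cτ k) →
          (∀ v, T.MemSumSpace p v →
            Ccoer * T.dgNorm σ τ v ^ 2 ≤ T.Btilde p σ τ v v) ∧
          (∀ w v, T.MemSumSpace p w → T.MemSumSpace p v →
            T.Btilde p σ τ w v ≤ Ccont * T.dgNorm σ τ w * T.dgNorm σ τ v) := by
  have hd2 : 2 ≤ d := by omega
  obtain ⟨C, hC, hface⟩ := DGBiharmonic.exists_face_inequalities d hd2 (Cr := Cr) hCr hCas hcas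
    hCsh hCinv1 hCinv2
  have hM : 0 < 16 * (C * CF) + 1 := by positivity
  -- Dividing C by this threshold gives A with 16 A C_F ≤ 1; the summand 1 keeps it positive even
  -- when C_F = 0.
  refine ⟨16 * (C * CF) + 1, 16 * (C * CF) + 1, 1 / 2, 4, hM, hM, by norm_num, by norm_num, ?_⟩
  intro Cσ Cτ hCσ hCτ Ω _ T p hp hCF hratio hcov σ τ hσ hτ
  have hT := T.traceFactor_nonneg (p := p) (Cas := Cas) (cas := cas) (Csh := Csh) hCinv1
  have hTG := fun k i => mul_nonneg (hT k i) (T.gradFactor_nonneg (p := p) hCinv2 i)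
  have hσ0 : ∀ k, 0 ≤ σ k := fun k => by
    rw [hσ]
    exact mul_nonneg (hM.le.trans hCσ) (T.sup'_adj_nonneg (hTG k) k)
  have hτ0 : ∀ k, 0 ≤ τ k := fun k => by
    rw [hτ]
    exact mul_nonneg (hM.le.trans hCτ) (T.sup'_adj_nonneg (hT k) k)
  suffices h : ∀ k, ∀ i ∈ T.adj k, ∀ q : MvPolynomial (Fin d) ℝ, q.totalDegree ≤ p i →
      ∫ x, DGBiharmonic.polyVal q x ^ 2 ∂(DGBiharmonic.faceMeasure (T.face k)) ≤
        C / (16 * (C * CF) + 1) * τ k * (∫ z in T.elem i, DGBiharmonic.polyVal q z ^ 2) ∧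
      ∫ x, ‖DGBiharmonic.polyGrad q x‖ ^ 2 ∂(DGBiharmonic.faceMeasure (T.face k)) ≤
        C / (16 * (C * CF) + 1) * σ k * ∫ z in T.elem i, DGBiharmonic.polyVal q z ^ 2 by
    have hA : 16 * (C / (16 * (C * CF) + 1) * CF) ≤ 1 := by
      rw [div_mul_eq_mul_div, ← mul_div_assoc, div_le_one hM]
      linarith
    obtain ⟨hcoer, hcont⟩ := T.coercive_and_continuous hd2 hσ0 hτ0 (by positivity) hCF hA h
    exact ⟨fun v _ => hcoer v, fun w v _ _ => hcont w v⟩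
  intro k i hi q hq
  have hF : (T.face k).interior ⊆ frontier (T.elem i) := by
    simpa [DGBiharmonic.PolytopicMesh.adj, DGBiharmonic.adjElems] using hi
  obtain ⟨h1, h2⟩ := hface (T.elem i) (p i) (T.face k) (T.isOpenPolytope_elem i) (hp i) (hratio i)
    (hcov i) hF q hq
  have hq0 : 0 ≤ ∫ z in T.elem i, DGBiharmonic.polyVal q z ^ 2 :=
    MeasureTheory.integral_nonneg fun _ => sq_nonneg _
  -- Here t is the penalty factor of one element, s the maximum over the elements at the face and c
  -- the penalty constant.
  have key : ∀ {t c s : ℝ}, 0 ≤ t → t ≤ s → 16 * (C * CF) + 1 ≤ c →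
      C * t ≤ C / (16 * (C * CF) + 1) * (c * s) := by
    intro t c s ht hts hc
    rw [div_mul_eq_mul_div, le_div_iff₀ hM, mul_assoc, mul_comm t]
    exact mul_le_mul_of_nonneg_left (mul_le_mul hc hts ht (hM.le.trans hc)) hC.le
  rw [hσ, hτ]
  exact ⟨h1.trans (mul_le_mul_of_nonneg_right (key (hT k i)
      (Finset.le_sup' (fun j => T.traceFactor p Cas cas Csh Cinv1 k j) hi) hCτ) hq0),
    h2.trans (mul_le_mul_of_nonneg_right (key (hTG k i)
      (Finset.le_sup' (fun j => T.traceFactor p Cas cas Csh Cinv1 k j * T.gradFactor p Cinv2 j) hi)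
      hCσ) hq0)⟩
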